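/- **Setting.** Let $\mathcal F$ be one of the following three families of finite simple undirected graphs: all paths with at least two nodes, all cycles (with at least three nodes), or the union of the two. Let $\Pi$ be a locally checkable labeling problem (LCL) with finite input label set $I$ and finite output label set $O$: there are constants $r\ge 0$ and $\Delta\ge 2$ and a set $\mathcal S$ of centered graphs of radius at most $r$ and maximum degree at most $\Delta$, with inputs and outputs on their nodes, such that on every graph $G$ of maximum degree at most $\Delta$ with inputs $x$, an output labeling $y$ is permissible if and only if the labeled radius-$r$ neighborhood of every node is isomorphic to a member of $\mathcal S$. A *deterministic LOCAL* algorithm of locality $T$ for $\Pi$ on $\mathcal F$ knows $n$ and determines the output of each node $v$ of an $n$-node graph $G$ from the subgraph induced by the radius-$T(n)$ neighborhood of $v$, with its inputs and unique identifiers from $\{1,\dots,n^c\}$ ($c\ge 1$ a fixed integer constant); the output has to be permissible on every $G\in\mathcal F$, for all inputs and all identifiers. In *randomized online-LOCAL* with locality $T$, the algorithm knows $n$ and the set of nodes; the nodes are presented in an adversarial order $v_1,\dots,v_n$; when $v_i$ is presented, the algorithm sees the subgraph induced by $\bigcup_{j\le i} N_{T(n)}(v_j)$ with its inputs, the order $v_1,\dots,v_i$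 and all earlier outputs, and chooses the output of $v_i$ at random. The adversary is oblivious (graph, inputs and order are fixed independently of the randomness). On every $n$-node graph in $\mathcal F$, for all inputs and all orders, the output must be permissible except with probability at most $1/n$. The randomized online-LOCAL complexity of $\Pi$ on $\mathcal F$ is, for each $n$, the least locality that suffices for $n$-node graphs. **Theorem.** 1. If $\Pi$ can be solved on $\mathcal F$ with locality $T$ in randomized online-LOCAL, then it can be solved on $\mathcal F$ with locality $O(T+\log^* n)$ in deterministic LOCAL. 2. If $\Pi$ has a randomized online-LOCAL complexity $T(n)$ on $\mathcal F$ (i.e. it can be solved there at all), then $T(n)=O(1)$ or $T(n)=\Theta(n)$. 3. $\Pi$ can be solved on $\mathcal F$ with locality $O(1)$ in randomized online-LOCAL if and only if it can be solved on $\mathcal F$ with locality $O(\log^* n)$ in deterministic LOCAL. The constants in the asymptotic notation may depend on $\Pi$, $\mathcal F$, $c$ and the function $T$. -/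

import Mathlib

open Filter Asymptotics
open scoped ENNReal

noncomputable section

theorem clog_two_lt {n : ℕ} (h : ¬ n ≤ 1) : Nat.clog 2 n < n := by
  have h1 : n - 1 < 2 ^ (n - 1) := Nat.lt_two_pow_self
  have h2 : Nat.clog 2 n ≤ n - 1 := (Nat.clog_le_iff_le_pow (by norm_num)).2 (by omega)
  omega

/-- The iterated logarithm to base two. Rounding up does not change it: for integers, `log₂ n ≤ m`
holds exactly if `⌈log₂ n⌉ ≤ m` does. -/
def logStar (n : ℕ) : ℕ :=
  if n ≤ 1 then 0 else 1 + logStar (Nat.clog 2 n)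
termination_by n
decreasing_by exact clog_two_lt ‹_›

/-- The set of nodes at distance at most `t` from `v`. -/
def nbhd {V : Type*} (G : SimpleGraph V) (t : ℕ) (v : V) : Set V :=
  {u | G.edist v u ≤ (t : ℕ∞)}

theorem self_mem_nbhd {V : Type*} (G : SimpleGraph V) (t : ℕ) (v : V) : v ∈ nbhd G t v := by
  simp [nbhd]

/-- All nodes have degree at most `Δ`. -/
def DegreeAtMost {V : Type*} (G : SimpleGraph V) (Δ : ℕ) : Prop :=
  ∀ v, (G.neighborSet v).encard ≤ (Δ : ℕ∞)

/-! ### Labeling problems -/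

/-- A labeling problem: permissible output labelings for each finite graph with node inputs,
closed under graph isomorphism. -/
structure LabelingProblem (I O : Type*) where
  sol : ∀ {n : ℕ}, SimpleGraph (Fin n) → (Fin n → I) → Set (Fin n → O)
  iso_closed : ∀ {n : ℕ} (G G' : SimpleGraph (Fin n)) (φ : G ≃g G') (x : Fin n → I)
    (y : Fin n → O), y ∈ sol G' x → y ∘ φ ∈ sol G (x ∘ φ)

/-- A finite centered graph with an input and an output labeling. -/
structure CenteredLabeledGraph (I O : Type*) where
  size : ℕ
  graph : SimpleGraph (Fin size)
  center : Fin size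
  input : Fin size → I
  output : Fin size → O

/-- The radius-`r` neighborhood of `v`, with its labels, is isomorphic to `H`. -/
def NbhdIso {I O : Type*} {n : ℕ} (G : SimpleGraph (Fin n)) (x : Fin n → I) (y : Fin n → O)
    (r : ℕ) (v : Fin n) (H : CenteredLabeledGraph I O) : Prop :=
  ∃ φ : G.induce (nbhd G r v) ≃g H.graph,
    φ ⟨v, self_mem_nbhd G r v⟩ = H.center ∧
      ∀ u, H.input (φ u) = x u ∧ H.output (φ u) = y u

/-- `P` is locally checkable with checking radius `r` on graphs of maximum degree at most `Δ`. -/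
def LabelingProblem.IsLCL {I O : Type*} (P : LabelingProblem I O) (r Δ : ℕ) : Prop :=
  ∃ S : Set (CenteredLabeledGraph I O),
    (∀ H ∈ S, (∀ u, u ∈ nbhd H.graph r H.center) ∧ DegreeAtMost H.graph Δ) ∧
    ∀ (n : ℕ) (G : SimpleGraph (Fin n)) (x : Fin n → I), DegreeAtMost G Δ →
      ∀ y : Fin n → O, y ∈ P.sol G x ↔ ∀ v, ∃ H ∈ S, NbhdIso G x y r v H

/-! ### Paths and cycles -/

/-- A graph family: for each `n`, a set of graphs on `n` nodes. -/
abbrev GraphFamily : Type := ∀ n : ℕ, Set (SimpleGraph (Fin n))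

/-- Paths with at least one edge. -/
def paths : GraphFamily := fun n => {G | 2 ≤ n ∧ Nonempty (G ≃g SimpleGraph.pathGraph n)}

/-- Simple cycles. -/
def cycles : GraphFamily := fun n => {G | 3 ≤ n ∧ Nonempty (G ≃g SimpleGraph.cycleGraph n)}

def pathsAndCycles : GraphFamily := fun n => paths n ∪ cycles n

/-- Inputs restricted to the set `U`; `none` marks the nodes outside `U`. -/
def restrictInput {V I : Type*} (x : V → I) (U : Set V) (u : V) : Option I :=
  open scoped Classical in if u ∈ U then some (x u) else none

/-! ### The deterministic LOCAL model -/

/-- What a node sees: its own identifier, and the graph and the inputs in its neighborhood. Nodes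
are named by their identifiers; the visible nodes are those whose input is not `none`. -/
structure LocalView (I : Type*) where
  center : ℕ
  graph : SimpleGraph ℕ
  input : ℕ → Option I

/-- The radius-`t` view of the node `v`, i.e. the subgraph induced by its radius-`t` neighborhood
together with identifiers and inputs. -/
def localView {I : Type*} {n : ℕ} (t : ℕ) (G : SimpleGraph (Fin n)) (x : Fin n → I)
    (ident : Fin n ↪ ℕ) (v : Fin n) : LocalView I where
  center := ident v
  graph := ((G.induce (nbhd G t v)).spanningCoe).map ident
  input := Function.extend ident (restrictInput x (nbhd G t v)) (fun _ => none)

/-- On all `n`-node graphs of the family with any inputs, and any unique identifiers from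
`{1, …, n ^ c}`, the problem is solved by some deterministic LOCAL algorithm of locality `t`
(a map from radius-`t` views to outputs). -/
def LabelingProblem.LocalSolvable {I O : Type*} (P : LabelingProblem I O) (F : GraphFamily)
    (c n t : ℕ) : Prop :=
  ∃ a : LocalView I → O, ∀ G ∈ F n, ∀ (x : Fin n → I) (ident : Fin n ↪ ℕ),
    (∀ v, 1 ≤ ident v ∧ ident v ≤ n ^ c) →
      (fun v => a (localView t G x ident v)) ∈ P.sol G x

/-- Some deterministic LOCAL algorithm, which knows `n`, solves the problem with locality `T n`. -/
def LabelingProblem.HasLocalLocality {I O : Type*} (P : LabelingProblem I O) (F : GraphFamily)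
    (c : ℕ) (T : ℕ → ℕ) : Prop :=
  ∀ n, P.LocalSolvable F c n (T n)

/-! ### The randomized online-LOCAL model -/

/-- What an online-LOCAL algorithm knows when it has to label a node: the nodes presented so far
in order (the last one is to be labeled now), the subgraph revealed so far (with all inputs of the
revealed nodes, `none` elsewhere), and the outputs given so far (`none` elsewhere). -/
structure OnlineView (n : ℕ) (I O : Type*) where
  order : List (Fin n)
  graph : SimpleGraph (Fin n)
  input : Fin n → Option I
  output : Fin n → Option O

/-- The nodes within distance `t` of the presented nodes `σ 0, …, σ k`. -/
def revealed {n : ℕ} (t : ℕ) (G : SimpleGraph (Fin n)) (σ : Equiv.Perm (Fin n)) (k : ℕ) :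
    Set (Fin n) :=
  {u | ∃ j : Fin n, (j : ℕ) ≤ k ∧ u ∈ nbhd G t (σ j)}

def onlineView {I O : Type*} {n : ℕ} (t : ℕ) (G : SimpleGraph (Fin n)) (x : Fin n → I)
    (σ : Equiv.Perm (Fin n)) (k : ℕ) (y : Fin n → Option O) : OnlineView n I O where
  order := ((List.finRange n).take (k + 1)).map σ
  graph := (G.induce (revealed t G σ k)).spanningCoe
  input := restrictInput x (revealed t G σ k)
  output := y

/-- The partial labeling after the first `k` nodes have been presented to the deterministic
online-LOCAL algorithm `a` in the order `σ`. -/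
def onlineRun {I O : Type*} {n : ℕ} (a : OnlineView n I O → O) (t : ℕ) (G : SimpleGraph (Fin n))
    (x : Fin n → I) (σ : Equiv.Perm (Fin n)) : ℕ → Fin n → Option O
  | 0 => fun _ => none
  | k + 1 =>
    if h : k < n then
      Function.update (onlineRun a t G x σ k) (σ ⟨k, h⟩)
        (some (a (onlineView t G x σ k (onlineRun a t G x σ k))))
    else onlineRun a t G x σ k

/-- The algorithm `a` ends with a permissible output labeling. -/
def OnlineSuccess {I O : Type*} (P : LabelingProblem I O) {n : ℕ} (a : OnlineView n I O → O)
    (t : ℕ) (G : SimpleGraph (Fin n)) (x : Fin n → I) (σ : Equiv.Perm (Fin n)) : Prop :=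
  ∃ y ∈ P.sol G x, onlineRun a t G x σ n = fun v => some (y v)

/-- Some randomized online-LOCAL algorithm (a random deterministic one) of locality `t` fails with
probability at most `1 / n` on each `n`-node graph of the family, each input and each order. The
adversary is oblivious: graph, input and order are fixed before the random choice. -/
def LabelingProblem.RandOnlineSolvable {I O : Type*} (P : LabelingProblem I O) (F : GraphFamily)
    (n t : ℕ) : Prop :=
  ∃ A : PMF (OnlineView n I O → O), ∀ G ∈ F n, ∀ (x : Fin n → I) (σ : Equiv.Perm (Fin n)),
    A.toOuterMeasure {a | ¬ OnlineSuccess P a t G x σ} ≤ (n : ℝ≥0∞)⁻¹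

/-- Some randomized online-LOCAL algorithm, which knows `n`, solves the problem with locality
`T n`. -/
def LabelingProblem.HasRandOnlineLocality {I O : Type*} (P : LabelingProblem I O)
    (F : GraphFamily) (T : ℕ → ℕ) : Prop :=
  ∀ n, P.RandOnlineSolvable F n (T n)

/-- `T` is the randomized online-LOCAL complexity of the problem: for each `n`, the least
locality with which the problem can be solved. -/
def LabelingProblem.IsRandOnlineComplexity {I O : Type*} (P : LabelingProblem I O)
    (F : GraphFamily) (T : ℕ → ℕ) : Prop :=
  ∀ n, IsLeast {t | P.RandOnlineSolvable F n t} (T n)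

end

/-! On a path or cycle a labeling is a run of a finite automaton: a state holds the labels of `2 * r
+ 1` consecutive positions, and a step reads the input of the next node. The effect of an input
word, read in both directions, is one of finitely many pairs of relations on states. So words in a
gap can be exchanged for words of equal effect, and words of length at least the number `κ` of
effects can be pumped.

Everything turns on a finite object that does not mention `n`: `IsPatchLabeling`. It offers
labelings for patches of `2 * r + 1` nodes, depending only on the inputs of the patch and the
effects of the words of length `κ` on its two sides, such that far apart patches can be labeled
independently and the gap between them can still be completed. As there is no orientation, it is
closed under reversal.

From patch labelings to algorithms: take a maximal set of nodes at pairwise distance more than a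
constant `k`, label the patches around those that are not too close to an end of the path, and
complete each block in between, which has bounded length (`windowOK_fillOutput`). Only the set can
cost more than a constant. In LOCAL it comes from reducing the identifiers to a constant number of
colors within distance `O(log* n)` (`exists_colorReducible_names`); in online-LOCAL it is built
greedily in the order in which nodes are revealed, with constant locality (`SameReveal.greedy_iff`).

From algorithms to patch labelings (`exists_isPatchLabeling`): let an online algorithm have locality
`t` with `K * (t + 1) ≤ n` for a single large `n`. Build fragments: patches between pumped words
longer than `t`, several copies for each possible context. The adversary presents the patches first.
The algorithm does not see the ends of the fragments, so it cannot know in which order and direction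
they will be joined and by which words. Up to effects there are only constantly many arrangements to
consider, fewer than `n`, so by the union bound one outcome of the random choices succeeds in all of
them. Its labels of the patches are the same in all arrangements and hence fit together in every
way. A pigeonhole over the copies of a context gives two copies with equal labels, so that a
labeling can also be joined to itself.

Hence the `dichotomy`: either `K * (T n + 1) ≤ n` for some large `n`, and then locality `O(1)`
online and `O(log* n)` in LOCAL suffices for all large `n`, or `T` grows linearly and gathering the
whole graph is optimal up to a constant factor. -/

/-! ### Neighborhoods -/

theorem mem_nbhd_iff_walk {V : Type*} {G : SimpleGraph V} {t : ℕ} {v u : V} :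
    u ∈ nbhd G t v ↔ ∃ p : G.Walk v u, p.length ≤ t := by
  constructor
  · intro h
    have h1 : G.edist v u ≠ ⊤ := ne_top_of_le_ne_top (ENat.natCast_ne_top t) h
    obtain ⟨p, hp⟩ := SimpleGraph.exists_walk_of_edist_ne_top h1
    refine ⟨p, ?_⟩
    have h2 : (p.length : ℕ∞) ≤ t := hp ▸ h
    exact_mod_cast h2
  · rintro ⟨p, hp⟩
    exact (SimpleGraph.edist_le p).trans (by exact_mod_cast hp)

theorem nbhd_mono {V : Type*} {G : SimpleGraph V} {s t : ℕ} (h : s ≤ t) (v : V) :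
    nbhd G s v ⊆ nbhd G t v :=
  fun _ hu => le_trans (α := ℕ∞) hu (by exact_mod_cast h)

theorem mem_nbhd_zero {V : Type*} {G : SimpleGraph V} {v u : V} : u ∈ nbhd G 0 v ↔ u = v := by
  rw [nbhd, Set.mem_ofPred_eq, Nat.cast_zero, nonpos_iff_eq_zero, SimpleGraph.edist_eq_zero_iff,
    eq_comm]

theorem mem_nbhd_succ {V : Type*} {G : SimpleGraph V} {t : ℕ} {v u : V} :
    u ∈ nbhd G (t + 1) v ↔ u ∈ nbhd G t v ∨ ∃ w ∈ nbhd G t v, G.Adj w u := by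
  constructor
  · rw [mem_nbhd_iff_walk]
    rintro ⟨p, hp⟩
    rcases Nat.lt_or_ge p.length (t + 1) with h | h
    · exact Or.inl (mem_nbhd_iff_walk.2 ⟨p, by omega⟩)
    · right
      rcases hq : p.reverse with _ | ⟨hadj, q⟩
      · have := congrArg SimpleGraph.Walk.length hq
        simp only [SimpleGraph.Walk.length_reverse, SimpleGraph.Walk.length_nil] at this
        omega
      · have := congrArg SimpleGraph.Walk.length hq
        simp only [SimpleGraph.Walk.length_reverse, SimpleGraph.Walk.length_cons] at this
        exact ⟨_, mem_nbhd_iff_walk.2 ⟨q.reverse, by simp; omega⟩, hadj.symm⟩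
  · rintro (h | ⟨w, hw, hadj⟩)
    · exact nbhd_mono (Nat.le_succ t) v h
    · obtain ⟨p, hp⟩ := mem_nbhd_iff_walk.1 hw
      exact mem_nbhd_iff_walk.2 ⟨p.concat hadj, by simp; omega⟩

theorem mem_nbhd_symm {V : Type*} {G : SimpleGraph V} {t : ℕ} {v u : V} :
    u ∈ nbhd G t v ↔ v ∈ nbhd G t u := by
  simp [nbhd, SimpleGraph.edist_comm]

theorem mem_nbhd_trans {V : Type*} {G : SimpleGraph V} {s t : ℕ} {v u w : V}
    (hu : u ∈ nbhd G s v) (hw : w ∈ nbhd G t u) : w ∈ nbhd G (s + t) v := by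
  obtain ⟨p, hp⟩ := mem_nbhd_iff_walk.1 hu
  obtain ⟨q, hq⟩ := mem_nbhd_iff_walk.1 hw
  exact mem_nbhd_iff_walk.2 ⟨p.append q, by simp; omega⟩

/-- Two graphs whose edges agree at all nodes closer than `t` to `v` have the same
radius-`t` neighborhood of `v`. -/
theorem nbhd_congr {V : Type*} {G G' : SimpleGraph V} {v : V} {t : ℕ}
    (h : ∀ s < t, ∀ a ∈ nbhd G s v, ∀ b, G.Adj a b ↔ G'.Adj a b) : nbhd G t v = nbhd G' t v := by
  induction t with
  | zero => ext u; simp [mem_nbhd_zero]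
  | succ t ih =>
    have h1 := ih fun s hs => h s (by omega)
    ext u
    rw [mem_nbhd_succ, mem_nbhd_succ, ← h1]
    exact or_congr Iff.rfl (exists_congr fun w => and_congr_right fun hw => h t (by omega) w hw u)

/-- A subgraph which keeps all edges inside a set containing the radius-`t` neighborhood of `v`. -/
theorem nbhd_induce {V : Type*} {G : SimpleGraph V} {v : V} {t : ℕ} {U : Set V}
    (hU : nbhd G t v ⊆ U) : nbhd (G.induce U).spanningCoe t v = nbhd G t v := by
  refine (nbhd_congr fun s hs a ha b => ?_).symm
  have h1 : a ∈ U := hU (nbhd_mono hs.le v ha)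
  constructor
  · intro hab
    have h2 : b ∈ U := hU (nbhd_mono hs v (mem_nbhd_succ.2 (Or.inr ⟨a, ha, hab⟩)))
    simp [h1, h2, hab]
  · intro hab
    simp at hab
    exact hab.1

theorem spanningCoe_induce_adj {V : Type*} {G : SimpleGraph V} {U : Set V} {a b : V} :
    (G.induce U).spanningCoe.Adj a b ↔ G.Adj a b ∧ a ∈ U ∧ b ∈ U := by
  simp

/-! ### Charts of paths and cycles -/

/-- A parametrization of a path or a cycle by integers: a path has `none` outside an interval of
length `n`, a cycle is traversed with period `n`. -/
structure IsChart {n : ℕ} (G : SimpleGraph (Fin n)) (ψ : ℤ → Option (Fin n)) : Prop where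
  surj : ∀ v, ∃ i, ψ i = some v
  adj : ∀ i v w, ψ i = some v → (G.Adj v w ↔ ψ (i + 1) = some w ∨ ψ (i - 1) = some w)
  sep : ∀ i j v, ψ i = some v → ψ j = some v → i ≠ j → (n : ℤ) ≤ |i - j|
  per : ∀ i j v, ψ i = some v → ψ j = some v → ∀ k, ψ (i + k) = ψ (j + k)
  conv : ∀ i j k, i ≤ j → j ≤ k → ψ i ≠ none → ψ k ≠ none → ψ j ≠ none

theorem IsChart.neg {n : ℕ} {G : SimpleGraph (Fin n)} {ψ : ℤ → Option (Fin n)}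
    (h : IsChart G ψ) : IsChart G (fun i => ψ (-i)) where
  surj v := by
    obtain ⟨i, hi⟩ := h.surj v
    exact ⟨-i, by simpa using hi⟩
  adj i v w hv := by
    rw [h.adj _ _ w hv, or_comm, show -i - 1 = -(i + 1) by ring, show -i + 1 = -(i - 1) by ring]
  sep i j v hi hj hij := by
    have := h.sep _ _ v hi hj (by omega)
    rwa [show -i - -j = -(i - j) by ring, abs_neg] at this
  per i j v hi hj k := by
    have := h.per _ _ v hi hj (-k)
    rwa [← neg_add, ← neg_add] at this
  conv i j k hij hjk hi hk := h.conv (-k) (-j) (-i) (by omega) (by omega) hk hi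

theorem IsChart.shift {n : ℕ} {G : SimpleGraph (Fin n)} {ψ : ℤ → Option (Fin n)}
    (h : IsChart G ψ) (p : ℤ) : IsChart G (fun i => ψ (p + i)) where
  surj v := by
    obtain ⟨i, hi⟩ := h.surj v
    exact ⟨i - p, by simpa using hi⟩
  adj i v w hv := by
    rw [h.adj _ _ w hv, add_assoc, add_sub_assoc]
  sep i j v hi hj hij := by
    have := h.sep _ _ v hi hj (by omega)
    rwa [show p + i - (p + j) = i - j by ring] at this
  per i j v hi hj k := by
    have := h.per _ _ v hi hj k
    rwa [add_assoc, add_assoc] at this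
  conv i j k hij hjk hi hk := h.conv (p + i) (p + j) (p + k) (by omega) (by omega) hi hk

theorem IsChart.mem_nbhd_iff {n : ℕ} {G : SimpleGraph (Fin n)} {ψ : ℤ → Option (Fin n)}
    (h : IsChart G ψ) {p : ℤ} {v : Fin n} (hp : ψ p = some v) {t : ℕ} {u : Fin n} :
    u ∈ nbhd G t v ↔ ∃ i : ℤ, |i| ≤ t ∧ ψ (p + i) = some u := by
  induction t generalizing u with
  | zero =>
    rw [mem_nbhd_zero]
    constructor
    · rintro rfl
      exact ⟨0, by simp, by simpa using hp⟩
    · rintro ⟨i, hi, hu⟩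
      have : i = 0 := abs_eq_zero.1 (le_antisymm (by simpa using hi) (abs_nonneg i))
      subst this
      simpa [hp, eq_comm] using hu
  | succ t ih =>
    rw [mem_nbhd_succ]
    constructor
    · rintro (hu | ⟨w, hw, hadj⟩)
      · obtain ⟨i, hi, hu⟩ := ih.1 hu
        exact ⟨i, by push_cast; omega, hu⟩
      · obtain ⟨i, hi, hw⟩ := ih.1 hw
        rw [abs_le] at hi
        rcases (h.adj _ _ _ hw).1 hadj with h1 | h1
        · exact ⟨i + 1, by rw [abs_le]; push_cast; omega, by rw [← h1]; congr 1; ring⟩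
        · exact ⟨i - 1, by rw [abs_le]; push_cast; omega, by rw [← h1]; congr 1; ring⟩
    · rintro ⟨i, hi, hu⟩
      by_cases hit : |i| ≤ t
      · exact Or.inl (ih.2 ⟨i, hit, hu⟩)
      right
      have hp0 : ψ p ≠ none := by simp [hp]
      have hu0 : ψ (p + i) ≠ none := by simp [hu]
      rw [abs_le] at hi hit
      push_cast at hi
      rcases lt_or_ge i 0 with hi0 | hi0
      · have : ψ (p + (i + 1)) ≠ none := h.conv (p + i) _ p (by omega) (by omega) hu0 hp0
        obtain ⟨w, hw⟩ := Option.ne_none_iff_exists'.1 this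
        refine ⟨w, ih.2 ⟨i + 1, by rw [abs_le]; omega, hw⟩, (h.adj _ _ _ hw).2 (Or.inr ?_)⟩
        rw [← hu]; congr 1; ring
      · have : ψ (p + (i - 1)) ≠ none := h.conv p _ (p + i) (by omega) (by omega) hp0 hu0
        obtain ⟨w, hw⟩ := Option.ne_none_iff_exists'.1 this
        refine ⟨w, ih.2 ⟨i - 1, by rw [abs_le]; omega, hw⟩, (h.adj _ _ _ hw).2 (Or.inl ?_)⟩
        rw [← hu]; congr 1; ring

theorem IsChart.degreeAtMost {n : ℕ} {G : SimpleGraph (Fin n)} {ψ : ℤ → Option (Fin n)}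
    (h : IsChart G ψ) {Δ : ℕ} (hΔ : 2 ≤ Δ) : DegreeAtMost G Δ := by
  intro v
  obtain ⟨p, hp⟩ := h.surj v
  have h1 : some '' G.neighborSet v ⊆ {ψ (p + 1), ψ (p - 1)} := by
    rintro _ ⟨w, hw, rfl⟩
    rcases (h.adj p v w hp).1 hw with h2 | h2 <;> simp [h2]
  have h2 := Set.encard_le_encard h1
  rw [(Option.some_injective _).encard_image] at h2
  refine h2.trans ((Set.encard_insert_le _ _).trans ?_)
  rw [Set.encard_singleton, one_add_one_eq_two]
  exact_mod_cast hΔ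

/-- A path on `n` nodes visited in the order given by `π`. -/
def pathChart {n : ℕ} (π : Fin n → Fin n) (i : ℤ) : Option (Fin n) :=
  if h : 0 ≤ i ∧ i < n then some (π ⟨i.toNat, by omega⟩) else none

/-- A cycle on `n` nodes visited in the order given by `π`. -/
def cycleChart {n : ℕ} (hn : 0 < n) (π : Fin n → Fin n) (i : ℤ) : Option (Fin n) :=
  some (π ⟨(i % n).toNat, by
    have := Int.emod_nonneg i (b := n) (by omega)
    have := Int.emod_lt_of_pos i (b := n) (by omega)
    omega⟩)

theorem pathChart_eq_some {n : ℕ} {π : Fin n ≃ Fin n} {i : ℤ} {j : Fin n} :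
    pathChart π i = some (π j) ↔ i = j := by
  unfold pathChart
  split_ifs with h
  · simp only [Option.some.injEq, π.apply_eq_iff_eq, Fin.ext_iff]
    omega
  · simp only [false_iff]
    rintro rfl
    exact h ⟨by simp, by simp⟩

theorem pathChart_ne_none {n : ℕ} {π : Fin n → Fin n} {i : ℤ} :
    pathChart π i ≠ none ↔ 0 ≤ i ∧ i < n := by
  unfold pathChart
  split_ifs with h <;> simp [h]

theorem isChart_pathChart {n : ℕ} {G : SimpleGraph (Fin n)} (π : Fin n ≃ Fin n)
    (h : ∀ i j, G.Adj (π i) (π j) ↔ (SimpleGraph.pathGraph n).Adj i j) :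
    IsChart G (pathChart π) where
  surj v := ⟨(π.symm v : Fin n), by
    conv_rhs => rw [← π.apply_symm_apply v]
    exact pathChart_eq_some.2 rfl⟩
  adj i v w hv := by
    obtain ⟨a, rfl⟩ := π.surjective v
    obtain ⟨b, rfl⟩ := π.surjective w
    rw [pathChart_eq_some] at hv
    rw [pathChart_eq_some, pathChart_eq_some, h, SimpleGraph.pathGraph_adj]
    omega
  sep i j v hi hj hij := by
    obtain ⟨a, rfl⟩ := π.surjective v
    rw [pathChart_eq_some] at hi hj
    omega
  per i j v hi hj k := by
    obtain ⟨a, rfl⟩ := π.surjective v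
    rw [pathChart_eq_some] at hi hj
    rw [hi, hj]
  conv i j k hij hjk hi hk := by
    rw [pathChart_ne_none] at *
    omega

theorem cycleChart_eq_some {n : ℕ} (hn : 0 < n) {π : Fin n ≃ Fin n} {i : ℤ} {j : Fin n} :
    cycleChart hn π i = some (π j) ↔ (n : ℤ) ∣ i - j := by
  unfold cycleChart
  have h1 := Int.emod_nonneg i (b := n) (by omega)
  have h2 := Int.emod_lt_of_pos i (b := n) (by omega)
  simp only [Option.some.injEq, π.apply_eq_iff_eq, Fin.ext_iff]
  have h3 : (n : ℤ) ∣ i - j ↔ i % n = j := by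
    rw [← Int.modEq_iff_dvd, Int.ModEq, Int.emod_eq_of_lt (a := (j : ℤ)) (by omega) (by omega),
      eq_comm]
  rw [h3]
  omega

theorem cycleGraph_adj_iff {n : ℕ} (hn : 3 ≤ n) (a b : Fin n) :
    (SimpleGraph.cycleGraph n).Adj a b ↔ (n : ℤ) ∣ a + 1 - b ∨ (n : ℤ) ∣ a - 1 - b := by
  rw [SimpleGraph.cycleGraph_adj' ]
  have ha := a.2
  have hb := b.2
  rw [Fin.val_sub, Fin.val_sub]
  have key : ∀ x y : ℕ, x < n → y < n → ((n - y + x) % n = 1 ↔ (n : ℤ) ∣ x - 1 - y) := by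
    intro x y hx hy
    rw [← Int.natCast_inj]
    push_cast [hy.le]
    constructor
    · intro h
      have h1 := Int.mul_ediv_add_emod ((n : ℤ) - y + x) n
      rw [h] at h1
      refine ⟨((n : ℤ) - y + x) / n - 1, ?_⟩
      linarith
    · rintro ⟨k, hk⟩
      have : (n : ℤ) - y + x = 1 + n * (k + 1) := by linarith
      rw [this, Int.add_mul_emod_self_left]
      exact Int.emod_eq_of_lt (by norm_num) (by omega)
  rw [key _ _ ha hb, key _ _ hb ha, or_comm]
  refine or_congr ?_ Iff.rfl
  rw [← dvd_neg]
  ring_nf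

theorem isChart_cycleChart {n : ℕ} (hn : 3 ≤ n) {G : SimpleGraph (Fin n)} (π : Fin n ≃ Fin n)
    (h : ∀ i j, G.Adj (π i) (π j) ↔ (SimpleGraph.cycleGraph n).Adj i j) :
    IsChart G (cycleChart (by omega) π) where
  surj v := ⟨(π.symm v : Fin n), by
    conv_rhs => rw [← π.apply_symm_apply v]
    exact (cycleChart_eq_some _).2 (by simp)⟩
  adj i v w hv := by
    obtain ⟨a, rfl⟩ := π.surjective v
    obtain ⟨b, rfl⟩ := π.surjective w
    rw [cycleChart_eq_some] at hv
    rw [cycleChart_eq_some, cycleChart_eq_some, h, cycleGraph_adj_iff hn]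
    refine or_congr ?_ ?_
    · rw [show i + 1 - (b : ℤ) = (a + 1 - b) + (i - a) by ring, dvd_add_left hv]
    · rw [show i - 1 - (b : ℤ) = (a - 1 - b) + (i - a) by ring, dvd_add_left hv]
  sep i j v hi hj hij := by
    obtain ⟨a, rfl⟩ := π.surjective v
    rw [cycleChart_eq_some] at hi hj
    have h1 : (n : ℤ) ∣ i - j := by simpa using dvd_sub hi hj
    exact Int.le_of_dvd (abs_pos.2 (by omega)) ((dvd_abs _ _).2 h1)
  per i j v hi hj k := by
    obtain ⟨a, rfl⟩ := π.surjective v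
    rw [cycleChart_eq_some] at hi hj
    have h1 : (n : ℤ) ∣ i - j := by simpa using dvd_sub hi hj
    have h2 : (i + k) % n = (j + k) % n :=
      (Int.modEq_iff_dvd.2 (by simpa using h1) : (j + k) ≡ (i + k) [ZMOD n]).symm
    simp only [cycleChart, h2]
  conv i j k hij hjk hi hk := by simp [cycleChart]

theorem exists_chart_of_mem_paths {n : ℕ} {G : SimpleGraph (Fin n)} (h : G ∈ paths n) :
    ∃ ψ, IsChart G ψ := by
  obtain ⟨hn, ⟨e⟩⟩ := h
  exact ⟨_, isChart_pathChart e.symm.toEquiv fun i j => e.symm.map_adj_iff⟩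

theorem exists_chart_of_mem_cycles {n : ℕ} {G : SimpleGraph (Fin n)} (h : G ∈ cycles n) :
    ∃ ψ, IsChart G ψ ∧ ∀ i, ψ i ≠ none := by
  obtain ⟨hn, ⟨e⟩⟩ := h
  exact ⟨_, isChart_cycleChart hn e.symm.toEquiv fun i j => e.symm.map_adj_iff,
    fun i => by simp [cycleChart]⟩

/-- The last clause records that charts have no ends if the family contains only cycles; in this
case patch labelings need no condition on ends. -/
theorem exists_chart {F : GraphFamily} (hF : F = paths ∨ F = cycles ∨ F = pathsAndCycles)
    {n : ℕ} {G : SimpleGraph (Fin n)} (h : G ∈ F n) :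
    ∃ ψ, IsChart G ψ ∧ (F = cycles → ∀ i, ψ i ≠ none) := by
  have hpc : (G ∈ cycles n ∨ G ∈ paths n ∧ F ≠ cycles) := by
    -- The path on two nodes tells the families apart.
    have hne : paths ≠ cycles := fun h => by
      have h2 : SimpleGraph.pathGraph 2 ∈ cycles 2 :=
        h ▸ (⟨le_rfl, ⟨SimpleGraph.Iso.refl⟩⟩ : SimpleGraph.pathGraph 2 ∈ paths 2)
      exact absurd h2.1 (by norm_num)
    have hne' : pathsAndCycles ≠ cycles := fun h => by
      have h2 : SimpleGraph.pathGraph 2 ∈ cycles 2 :=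
        h ▸ (Or.inl ⟨le_rfl, ⟨SimpleGraph.Iso.refl⟩⟩ : SimpleGraph.pathGraph 2 ∈ pathsAndCycles 2)
      exact absurd h2.1 (by norm_num)
    rcases hF with rfl | rfl | rfl
    · exact Or.inr ⟨h, hne⟩
    · exact Or.inl h
    · exact h.symm.imp_right fun h => ⟨h, hne'⟩
  rcases hpc with h | ⟨h, hF'⟩
  · obtain ⟨ψ, h1, h2⟩ := exists_chart_of_mem_cycles h
    exact ⟨ψ, h1, fun _ => h2⟩
  · obtain ⟨ψ, h1⟩ := exists_chart_of_mem_paths h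
    exact ⟨ψ, h1, fun h => absurd h hF'⟩

/-- Every ordering of the nodes is the chart of a member of the family. -/
theorem exists_mem_family_of_perm {F : GraphFamily}
    (hF : F = paths ∨ F = cycles ∨ F = pathsAndCycles) {n : ℕ} (hn : 3 ≤ n) (π : Fin n ≃ Fin n) :
    ∃ G ∈ F n, ∃ ψ, IsChart G ψ ∧ (∀ i : Fin n, ψ i = some (π i)) ∧
      (F ≠ cycles → ∀ i < 0, ψ i = none) := by
  have hadj (H : SimpleGraph (Fin n)) (i j) : (H.comap π.symm).Adj (π i) (π j) ↔ H.Adj i j := by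
    simp
  have hiso (H : SimpleGraph (Fin n)) : Nonempty (H.comap π.symm ≃g H) :=
    ⟨SimpleGraph.Iso.comap π.symm H⟩
  have hpath : (SimpleGraph.pathGraph n).comap π.symm ∈ paths n := ⟨by omega, hiso _⟩
  have hcyc : (SimpleGraph.cycleGraph n).comap π.symm ∈ cycles n := ⟨by omega, hiso _⟩
  -- A path is used whenever the family has one, so that position `0` is an end.
  by_cases hFc : F = cycles
  · subst hFc
    exact ⟨_, hcyc, _, isChart_cycleChart hn π (hadj _),
      fun i => (cycleChart_eq_some _).2 (by simp), fun h => absurd rfl h⟩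
  · refine ⟨(SimpleGraph.pathGraph n).comap π.symm, ?_, _, isChart_pathChart π (hadj _),
      fun i => pathChart_eq_some.2 rfl, fun _ i hi => ?_⟩
    · rcases hF with rfl | rfl | rfl
      · exact hpath
      · exact absurd rfl hFc
      · exact Or.inl hpath
    · by_contra h
      exact absurd (pathChart_ne_none.1 h).1 (by omega)

/-! ### Equal views give equal charts up to reversal -/

/-- The two neighbors of a position never carry the same value, so the one that differs from the
predecessor is the successor. The values thus propagate from positions `0` and `1`, and a ray that
has ended stays ended. -/
theorem eq_on_ray {N : Type*} {z z' : ℤ → Option N} {t : ℕ}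
    (hne : ∀ i b, z (i + 1) = some b → z (i - 1) ≠ some b)
    (hne' : ∀ i b, z' (i + 1) = some b → z' (i - 1) ≠ some b)
    (hconv : ∀ i : ℤ, 0 ≤ i → z i = none → z (i + 1) = none)
    (hconv' : ∀ i : ℤ, 0 ≤ i → z' i = none → z' (i + 1) = none)
    (hnbr : ∀ i : ℤ, 0 ≤ i → i < t → ∀ a, z i = some a → z' i = some a → ∀ b,
      (z (i + 1) = some b ∨ z (i - 1) = some b) ↔ (z' (i + 1) = some b ∨ z' (i - 1) = some b))
    (h0 : z 0 = z' 0) (h1 : z 1 = z' 1) (m : ℕ) (hm : m ≤ t) :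
    z m = z' m := by
  suffices h : ∀ m : ℕ, m + 1 ≤ t → z m = z' m ∧ z (m + 1) = z' (m + 1) by
    rcases m with _ | m
    · exact_mod_cast h0
    · exact_mod_cast (h m hm).2
  intro m
  induction m with
  | zero => intro _; exact ⟨by simpa using h0, by simpa using h1⟩
  | succ m ih =>
    intro hm
    obtain ⟨ha, hb⟩ := ih (by omega)
    push_cast
    refine ⟨hb, ?_⟩
    rcases hz : z (m + 1) with _ | a
    · rw [hconv _ (by omega) hz, hconv' _ (by omega) (hb ▸ hz)]
    · have key := hnbr (m + 1) (by omega) (by omega) a hz (hb ▸ hz)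
      rw [show (m : ℤ) + 1 - 1 = m by ring] at key
      have n1 := hne (m + 1)
      have n2 := hne' (m + 1)
      rw [show (m : ℤ) + 1 - 1 = m by ring] at n1 n2
      rw [← ha] at key n2
      ext b
      constructor
      · intro h
        exact ((key b).1 (Or.inl h)).resolve_right (n1 b h)
      · intro h
        exact ((key b).2 (Or.inl h)).resolve_right (n2 b h)

/-- Without repetition, two optional values are determined by the set of their values up to a swap.
At the center of a window this swap is the orientation. -/
theorem pair_eq_of_forall {N : Type*} {A B C D : Option N}
    (h : ∀ b, (A = some b ∨ B = some b) ↔ (C = some b ∨ D = some b))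
    (hAB : ∀ b, A = some b → B ≠ some b) (hCD : ∀ b, C = some b → D ≠ some b) :
    (A = C ∧ B = D) ∨ (A = D ∧ B = C) := by
  have none_of {X : Option N} (hX : ∀ b, X ≠ some b) : X = none :=
    Option.eq_none_iff_forall_ne_some.2 hX
  rcases A with _ | a
  · rcases B with _ | b
    · have h1 : C = none := none_of fun b hb => by simpa using (h b).2 (Or.inl hb)
      have h2 : D = none := none_of fun b hb => by simpa using (h b).2 (Or.inr hb)
      simp [h1, h2]
    · rcases (h b).1 (Or.inr rfl) with rfl | rfl
      · have h2 : D = none := none_of fun c hc => by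
          have := (h c).2 (Or.inr hc)
          simp only [reduceCtorEq, Option.some.injEq, false_or] at this
          exact hCD b rfl (this ▸ hc)
        simp [h2]
      · have h2 : C = none := none_of fun c hc => by
          have := (h c).2 (Or.inl hc)
          simp only [reduceCtorEq, Option.some.injEq, false_or] at this
          exact hCD c hc (by rw [this])
        simp [h2]
  · have hBa : B ≠ some a := hAB a rfl
    have aux {C D : Option N} (h : ∀ b, (some a = some b ∨ B = some b) ↔ (C = some b ∨ D = some b))
        (hCD : ∀ b, C = some b → D ≠ some b) (hC : C = some a) : B = D := by
      ext b
      constructor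
      · intro hb
        refine ((h b).1 (Or.inr hb)).resolve_left fun hc => hBa ?_
        rw [hb, ← hc, hC]
      · intro hd
        refine ((h b).2 (Or.inr hd)).resolve_left fun hc => ?_
        exact hCD b (hC.trans hc) hd
    rcases (h a).1 (Or.inl rfl) with hC | hD
    · exact Or.inl ⟨hC.symm, aux h hCD hC⟩
    · exact Or.inr ⟨hD.symm, aux (fun b => (h b).trans or_comm)
        (fun b h1 h2 => hCD b h2 h1) hD⟩

/-- The neighbors of the center agree in one of two orientations; once it is fixed, both rays are
forced by `eq_on_ray`. -/
theorem eq_window_of_nbr {N : Type*} {z z' : ℤ → Option N} {t : ℕ}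
    (hne : ∀ i b, z (i + 1) = some b → z (i - 1) ≠ some b)
    (hne' : ∀ i b, z' (i + 1) = some b → z' (i - 1) ≠ some b)
    (hconv : ∀ i j k, i ≤ j → j ≤ k → z i ≠ none → z k ≠ none → z j ≠ none)
    (hconv' : ∀ i j k, i ≤ j → j ≤ k → z' i ≠ none → z' k ≠ none → z' j ≠ none)
    (hnbr : ∀ i j : ℤ, |i| < t → |j| < t → ∀ a, z i = some a → z' j = some a → ∀ b,
      (z (i + 1) = some b ∨ z (i - 1) = some b) ↔ (z' (j + 1) = some b ∨ z' (j - 1) = some b))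
    (h0 : z 0 = z' 0) (h0n : z 0 ≠ none) :
    (∀ i : ℤ, |i| ≤ t → z i = z' i) ∨ (∀ i : ℤ, |i| ≤ t → z i = z' (-i)) := by
  have main : ∀ w w' : ℤ → Option N,
      (∀ i b, w (i + 1) = some b → w (i - 1) ≠ some b) →
      (∀ i b, w' (i + 1) = some b → w' (i - 1) ≠ some b) →
      (∀ i j k, i ≤ j → j ≤ k → w i ≠ none → w k ≠ none → w j ≠ none) →
      (∀ i j k, i ≤ j → j ≤ k → w' i ≠ none → w' k ≠ none → w' j ≠ none) →
      (∀ i : ℤ, |i| < t → ∀ a, w i = some a → w' i = some a → ∀ b,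
        (w (i + 1) = some b ∨ w (i - 1) = some b) ↔ (w' (i + 1) = some b ∨ w' (i - 1) = some b)) →
      w 0 = w' 0 → w 0 ≠ none → w 1 = w' 1 → ∀ m : ℕ, m ≤ t → w m = w' m := by
    intro w w' a1 a2 a3 a4 a5 a6 a7 a8 m hm
    refine eq_on_ray a1 a2 ?_ ?_ (fun i hi hit => a5 i (by rw [abs_lt]; omega)) a6 a8 m hm
    · intro i hi h
      by_contra hc
      exact a3 0 i (i + 1) hi (by omega) a7 hc h
    · intro i hi h
      by_contra hc
      exact a4 0 i (i + 1) hi (by omega) (a6 ▸ a7) hc h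
  have main2 : ∀ w' : ℤ → Option N,
      (∀ i b, w' (i + 1) = some b → w' (i - 1) ≠ some b) →
      (∀ i j k, i ≤ j → j ≤ k → w' i ≠ none → w' k ≠ none → w' j ≠ none) →
      (∀ i : ℤ, |i| < t → ∀ a, z i = some a → w' i = some a → ∀ b,
        (z (i + 1) = some b ∨ z (i - 1) = some b) ↔ (w' (i + 1) = some b ∨ w' (i - 1) = some b)) →
      z 0 = w' 0 → z 1 = w' 1 → z (-1) = w' (-1) → ∀ i : ℤ, |i| ≤ t → z i = w' i := by
    intro w' a2 a4 a5 a6 a7 a8 i hi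
    have hneg (u : ℤ → Option N) (hu : ∀ i b, u (i + 1) = some b → u (i - 1) ≠ some b) :
        ∀ i b, u (-(i + 1)) = some b → u (-(i - 1)) ≠ some b := by
      intro i b h1 h2
      refine hu (-i) b ?_ ?_
      · rw [← h2]; congr 1; ring
      · rw [← h1]; congr 1; ring
    rw [abs_le] at hi
    rcases le_total 0 i with h | h
    · have := main z w' hne a2 hconv a4 a5 a6 h0n a7 i.toNat (by omega)
      rwa [Int.toNat_of_nonneg h] at this
    · have := main (fun i => z (-i)) (fun i => w' (-i)) (hneg z hne) (hneg w' a2)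
        (fun i j k hij hjk hi hk => hconv (-k) (-j) (-i) (by omega) (by omega) hk hi)
        (fun i j k hij hjk hi hk => a4 (-k) (-j) (-i) (by omega) (by omega) hk hi)
        (fun i hi a ha ha' b => by
          have := a5 (-i) (by simpa using hi) a ha ha' b
          rw [show -(i + 1) = -i - 1 by ring, show -(i - 1) = -i + 1 by ring, or_comm, this, or_comm])
        (by simpa using a6) (by simpa using h0n) a8 (-i).toNat (by omega)
      simpa [Int.toNat_of_nonneg (show 0 ≤ -i by omega)] using this
  rcases Nat.eq_zero_or_pos t with rfl | ht
  · left
    intro i hi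
    have : i = 0 := abs_eq_zero.1 (le_antisymm (by simpa using hi) (abs_nonneg i))
    rw [this, h0]
  obtain ⟨a, ha⟩ := Option.ne_none_iff_exists'.1 h0n
  have key := hnbr 0 0 (by simpa using ht) (by simpa using ht) a ha (h0 ▸ ha)
  have n1 := hne 0
  have n2 := hne' 0
  simp only [zero_add, zero_sub] at key n1 n2
  have hcase : (z 1 = z' 1 ∧ z (-1) = z' (-1)) ∨ (z 1 = z' (-1) ∧ z (-1) = z' 1) := by
    exact pair_eq_of_forall key n1 n2
  rcases hcase with ⟨h1, h2⟩ | ⟨h1, h2⟩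
  · exact Or.inl (main2 z' hne' hconv' (fun i hi => hnbr i i hi hi) h0 h1 h2)
  · right
    refine main2 (fun i => z' (-i)) ?_ (fun i j k hij hjk hi hk =>
      hconv' (-k) (-j) (-i) (by omega) (by omega) hk hi) ?_ (by simpa using h0) h1 (by simpa using h2)
    · intro i b h1 h2
      refine hne' (-i) b ?_ ?_
      · rw [← h2]; congr 1; ring
      · rw [← h1]; congr 1; ring
    · intro i hi a ha ha' b
      have := hnbr i (-i) hi (by simpa using hi) a ha ha' b
      rw [this, show -(i + 1) = -i - 1 by ring, show -(i - 1) = -i + 1 by ring, or_comm]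

/-- If all nodes that are closer than `t` to `v` have the same named neighbors as the nodes of the
same name close to `v'`, then the named charts around `v` and `v'` agree up to distance `t`, up to
reversal. -/
theorem window_eq_or_reverse {N : Type*} {n n' : ℕ} (hn : 3 ≤ n) (hn' : 3 ≤ n')
    {G : SimpleGraph (Fin n)} {G' : SimpleGraph (Fin n')} {ψ ψ'} (h : IsChart G ψ)
    (h' : IsChart G' ψ') (g : Fin n ↪ N) (g' : Fin n' ↪ N) {v v' p p'} (hp : ψ p = some v)
    (hp' : ψ' p' = some v') (hv : g v = g' v') {t : ℕ}
    (H : ∀ s < t, ∀ a ∈ nbhd G s v, ∀ a' ∈ nbhd G' s v', g a = g' a' →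
      g '' G.neighborSet a = g' '' G'.neighborSet a') :
    (∀ i : ℤ, |i| ≤ t → (ψ (p + i)).map g = (ψ' (p' + i)).map g') ∨
      (∀ i : ℤ, |i| ≤ t → (ψ (p + i)).map g = (ψ' (p' - i)).map g') := by
  -- The two neighbors of a position are two apart, which is less than `n`, so they are different
  -- nodes.
  have hne {n : ℕ} (hn : 3 ≤ n) {G : SimpleGraph (Fin n)} {ψ} (h : IsChart G ψ) (g : Fin n ↪ N)
      (p i : ℤ) (b : N) (h1 : (ψ (p + (i + 1))).map g = some b) :
      (ψ (p + (i - 1))).map g ≠ some b := by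
    intro h2
    obtain ⟨x, hx, hxb⟩ := Option.map_eq_some_iff.1 h1
    obtain ⟨y, hy, hyb⟩ := Option.map_eq_some_iff.1 h2
    have hxy : x = y := g.injective (hxb.trans hyb.symm)
    subst hxy
    have := h.sep _ _ _ hx hy (by omega)
    rw [show p + (i + 1) - (p + (i - 1)) = 2 by ring] at this
    norm_num at this
    omega
  have hconv {n : ℕ} {G : SimpleGraph (Fin n)} {ψ} (h : IsChart G ψ) (g : Fin n ↪ N) (p : ℤ)
      (i j k : ℤ) (hij : i ≤ j) (hjk : j ≤ k) (hi : (ψ (p + i)).map g ≠ none)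
      (hk : (ψ (p + k)).map g ≠ none) : (ψ (p + j)).map g ≠ none := by
    simp only [ne_eq, Option.map_eq_none_iff] at *
    exact h.conv (p + i) (p + j) (p + k) (by omega) (by omega) hi hk
  have hnbr {n : ℕ} {G : SimpleGraph (Fin n)} {ψ} (h : IsChart G ψ) (g : Fin n ↪ N) (p i : ℤ)
      (x : Fin n) (hx : ψ (p + i) = some x) (b : N) :
      ((ψ (p + (i + 1))).map g = some b ∨ (ψ (p + (i - 1))).map g = some b) ↔
        b ∈ g '' G.neighborSet x := by
    simp only [Option.map_eq_some_iff, Set.mem_image, SimpleGraph.mem_neighborSet]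
    rw [← exists_or]
    refine exists_congr fun w => ?_
    rw [h.adj _ _ w hx, add_assoc, add_sub_assoc]
    tauto
  have := eq_window_of_nbr (z := fun i => (ψ (p + i)).map g) (z' := fun i => (ψ' (p' + i)).map g')
    (t := t) (hne hn h g p) (hne hn' h' g' p') (hconv h g p) (hconv h' g' p') ?_
    (by simp [hp, hp', hv]) (by simp [hp])
  · simpa [sub_eq_add_neg] using this
  · intro i j hi hj a ha ha' b
    obtain ⟨x, hx, hxa⟩ := Option.map_eq_some_iff.1 ha
    obtain ⟨x', hx', hxa'⟩ := Option.map_eq_some_iff.1 ha'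
    rw [hnbr h g p i x hx, hnbr h' g' p' j x' hx']
    rw [H (t - 1) (by have := abs_nonneg i; omega) x ((h.mem_nbhd_iff hp).2 ⟨i, by omega, hx⟩) x'
      ((h'.mem_nbhd_iff hp').2 ⟨j, by omega, hx'⟩) (hxa.trans hxa'.symm)]

/-! ### Local checking in charts -/

/-- The integers of absolute value at most `r` at which `ω` is defined. -/
abbrev WindowDom {α : Type*} (r : ℕ) (ω : ℤ → Option α) : Type := {i : ℤ // |i| ≤ r ∧ ω i ≠ none}

/-- The labeled integer interval around `0` of radius `r`, where `none` marks the integers that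
are not nodes, is isomorphic to an allowed neighborhood (or `0` is not a node). -/
def WindowOK {I O : Type*} (S : Set (CenteredLabeledGraph I O)) (r : ℕ)
    (ω : ℤ → Option (I × O)) : Prop :=
  ω 0 = none ∨ ∃ H ∈ S, ∃ φ : WindowDom r ω ≃ Fin H.size,
    (∀ i j, H.graph.Adj (φ i) (φ j) ↔ (j : ℤ) = i + 1 ∨ (j : ℤ) = i - 1) ∧
    (∀ i : WindowDom r ω, (i : ℤ) = 0 → φ i = H.center) ∧
    ∀ i : WindowDom r ω, ω i = some (H.input (φ i), H.output (φ i))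

section WindowOK

variable {I O : Type*} {S : Set (CenteredLabeledGraph I O)} {r : ℕ}

theorem WindowOK.of_center {ω : ℤ → Option (I × O)} (h : ω 0 = none) : WindowOK S r ω :=
  Or.inl h

theorem WindowOK.congr {ω ω' : ℤ → Option (I × O)} (h : ∀ i : ℤ, |i| ≤ r → ω i = ω' i)
    (hω : WindowOK S r ω) : WindowOK S r ω' := by
  rcases hω with h0 | ⟨H, hH, φ, h1, h2, h3⟩
  · exact Or.inl (h 0 (by simp) ▸ h0)
  · have e (i : ℤ) : (|i| ≤ r ∧ ω' i ≠ none) ↔ (|i| ≤ r ∧ ω i ≠ none) :=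
      and_congr_right fun hi => by rw [h i hi]
    refine Or.inr ⟨H, hH, (Equiv.subtypeEquivRight e).trans φ, fun i j => h1 _ _, fun i hi => h2 _ hi,
      fun i => ?_⟩
    exact (h i i.2.1).symm.trans (h3 (Equiv.subtypeEquivRight e i))

theorem windowOK_congr {ω ω' : ℤ → Option (I × O)} (h : ∀ i : ℤ, |i| ≤ r → ω i = ω' i) :
    WindowOK S r ω ↔ WindowOK S r ω' :=
  ⟨WindowOK.congr h, WindowOK.congr fun i hi => (h i hi).symm⟩

theorem WindowOK.neg {ω : ℤ → Option (I × O)} (hω : WindowOK S r ω) :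
    WindowOK S r (fun i => ω (-i)) := by
  rcases hω with h0 | ⟨H, hH, φ, h1, h2, h3⟩
  · exact Or.inl (by simpa using h0)
  · refine Or.inr ⟨H, hH, ((Equiv.neg ℤ).subtypeEquiv fun i => by simp).trans φ, fun i j => ?_,
      fun i hi => h2 _ (by simp [hi]), fun i => h3 ⟨-i, by simpa using i.2⟩⟩
    rw [Equiv.trans_apply, Equiv.trans_apply, h1]
    simp only [Equiv.subtypeEquiv_apply, Equiv.neg_apply]
    omega

/-- The part of a chart around `p` is isomorphic to the neighborhood of its center. -/
theorem IsChart.exists_equiv_nbhd {n : ℕ} {G : SimpleGraph (Fin n)} {ψ : ℤ → Option (Fin n)}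
    (h : IsChart G ψ) {p : ℤ} {v : Fin n} (hp : ψ p = some v) (hn : 2 * r + 2 ≤ n) :
    ∃ e : WindowDom r (fun i => ψ (p + i)) ≃ nbhd G r v,
      (∀ i : WindowDom r (fun i => ψ (p + i)), ψ (p + i) = some (e i : Fin n)) ∧
      ∀ i j, G.Adj (e i) (e j) ↔ (j : ℤ) = i + 1 ∨ (j : ℤ) = i - 1 := by
  -- Such positions differ by at most `2 * r + 1 < n`. The bound `r + 1` is needed for neighbors
  -- just outside the window.
  have hinj {i j : ℤ} {u : Fin n} (hi : |i| ≤ r + 1) (hj : |j| ≤ r) (hiu : ψ (p + i) = some u)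
      (hju : ψ (p + j) = some u) : i = j := by
    by_contra hij
    have := h.sep _ _ _ hiu hju (by omega)
    have := abs_sub (p + i) (p + j)
    rw [abs_le] at hi hj
    rw [le_abs] at *
    omega
  let f (i : WindowDom r (fun i => ψ (p + i))) : nbhd G r v :=
    ⟨(ψ (p + i)).get (Option.isSome_iff_ne_none.2 i.2.2),
      (h.mem_nbhd_iff hp).2 ⟨i, i.2.1, (Option.some_get _).symm⟩⟩
  have hf (i : WindowDom r (fun i => ψ (p + i))) : ψ (p + i) = some (f i : Fin n) := (Option.some_get _).symm
  have hbij : Function.Bijective f := by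
    constructor
    · intro i j hij
      refine Subtype.ext (hinj (i.2.1.trans (by omega)) j.2.1 (hf i) ?_)
      rw [hij]; exact hf j
    · rintro ⟨u, hu⟩
      obtain ⟨i, hi, hiu⟩ := (h.mem_nbhd_iff hp).1 hu
      refine ⟨⟨i, hi, by simp [hiu]⟩, Subtype.ext (Option.some_injective _ ?_)⟩
      rw [← hf, hiu]
  refine ⟨Equiv.ofBijective f hbij, hf, fun i j => ?_⟩
  refine (h.adj _ _ _ (hf i)).trans ?_
  refine or_congr ⟨fun hj => ?_, fun hj => ?_⟩ ⟨fun hj => ?_, fun hj => ?_⟩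
  · rw [add_assoc] at hj
    exact (hinj ((abs_add_le _ _).trans (by simpa using i.2.1)) j.2.1 hj (hf j)).symm
  · rw [add_assoc, ← hj]; exact hf j
  · rw [add_sub_assoc] at hj
    exact (hinj ((abs_sub _ _).trans (by simpa using i.2.1)) j.2.1 hj (hf j)).symm
  · rw [add_sub_assoc, ← hj]; exact hf j

theorem IsChart.exists_nbhdIso_iff {n : ℕ} {G : SimpleGraph (Fin n)} {ψ : ℤ → Option (Fin n)}
    (h : IsChart G ψ) (x : Fin n → I) (y : Fin n → O) {p : ℤ} {v : Fin n} (hp : ψ p = some v)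
    (hn : 2 * r + 2 ≤ n) : (∃ H ∈ S, NbhdIso G x y r v H) ↔
      WindowOK S r (fun i => (ψ (p + i)).map fun v => (x v, y v)) := by
  obtain ⟨e, he, hadj⟩ := h.exists_equiv_nbhd hp hn
  have hc (i) : (|i| ≤ (r : ℤ) ∧ (ψ (p + i)).map (fun v => (x v, y v)) ≠ none) ↔
      (|i| ≤ (r : ℤ) ∧ ψ (p + i) ≠ none) := by simp
  have he0 : e ⟨0, by simp [hp]⟩ = ⟨v, self_mem_nbhd G r v⟩ := by
    refine Subtype.ext (Option.some_injective _ ?_)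
    rw [← he, add_zero, hp]
  constructor
  · rintro ⟨H, hH, φ, h1, h2⟩
    refine Or.inr ⟨H, hH, (Equiv.subtypeEquivRight hc).trans (e.trans φ.toEquiv), fun i j => ?_,
      fun i hi => ?_, fun i => ?_⟩
    · exact φ.map_adj_iff.trans (hadj _ _)
    · have : Equiv.subtypeEquivRight hc i = ⟨0, by simp [hp]⟩ := Subtype.ext hi
      simp only [Equiv.trans_apply, this, he0]
      exact h1
    · have := he (Equiv.subtypeEquivRight hc i)
      rw [Equiv.subtypeEquivRight_apply_coe] at this
      beta_reduce
      rw [this, Option.map_some]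
      obtain ⟨h3, h4⟩ := h2 (e (Equiv.subtypeEquivRight hc i))
      rw [← h3, ← h4]
      rfl
  · rintro (h0 | ⟨H, hH, φ, h1, h2, h3⟩)
    · simp [hp] at h0
    · refine ⟨H, hH, ⟨e.symm.trans ((Equiv.subtypeEquivRight hc).symm.trans φ), ?_⟩, ?_, ?_⟩
      · intro a b
        obtain ⟨i, rfl⟩ := e.surjective a
        obtain ⟨j, rfl⟩ := e.surjective b
        simp only [Equiv.trans_apply, Equiv.symm_apply_apply]
        exact (h1 _ _).trans (hadj i j).symm
      · refine h2 _ ?_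
        rw [← he0, Equiv.symm_apply_apply]
        rfl
      · intro a
        obtain ⟨i, rfl⟩ := e.surjective a
        have := h3 ((Equiv.subtypeEquivRight hc).symm i)
        beta_reduce at this
        rw [show ((Equiv.subtypeEquivRight hc).symm i : ℤ) = i from rfl, he i, Option.map_some,
          Option.some_inj, Prod.mk.injEq] at this
        change H.input (φ ((Equiv.subtypeEquivRight hc).symm (e.symm (e i)))) = _ ∧
          H.output (φ ((Equiv.subtypeEquivRight hc).symm (e.symm (e i)))) = _
        rw [e.symm_apply_apply]
        exact ⟨this.1.symm, this.2.symm⟩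

/-- Turns permissibility into a condition on integer windows, the only form used below. Positions
beyond the ends of a path impose nothing. -/
theorem IsChart.mem_sol_iff {P : LabelingProblem I O} {Δ : ℕ} (hΔ : 2 ≤ Δ)
    (hS : ∀ (n : ℕ) (G : SimpleGraph (Fin n)) (x : Fin n → I), DegreeAtMost G Δ →
      ∀ y : Fin n → O, y ∈ P.sol G x ↔ ∀ v, ∃ H ∈ S, NbhdIso G x y r v H)
    {n : ℕ} {G : SimpleGraph (Fin n)} {ψ : ℤ → Option (Fin n)}
    (h : IsChart G ψ) (x : Fin n → I) (y : Fin n → O) (hn : 2 * r + 2 ≤ n) :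
    y ∈ P.sol G x ↔ ∀ p, WindowOK S r (fun i => (ψ (p + i)).map fun v => (x v, y v)) := by
  rw [hS n G x (h.degreeAtMost hΔ) y]
  constructor
  · intro hv p
    rcases hp : ψ p with _ | v
    · exact WindowOK.of_center (by simp [hp])
    · exact (h.exists_nbhdIso_iff x y hp hn).1 (hv v)
  · intro hp v
    obtain ⟨p, hpv⟩ := h.surj v
    exact (h.exists_nbhdIso_iff x y hpv hn).2 (hp p)

end WindowOK

/-! ### Labelings as runs of an automaton -/

/-- The factor of length `k` of the two-sided infinite word `X` that starts at `a`. -/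
def factor {I : Type*} (X : ℤ → I) (a : ℤ) : ℕ → List I
  | 0 => []
  | k + 1 => X a :: factor X (a + 1) k

/-- The labels at the `d` positions from `a` on. -/
def labelsAt {Λ : Type*} (d : ℕ) (y : ℤ → Λ) (a : ℤ) : Fin d → Λ := fun j => y (a + (j : ℕ))

section factor

variable {I : Type*}

@[simp] theorem length_factor (X : ℤ → I) (a : ℤ) (k : ℕ) : (factor X a k).length = k := by
  induction k generalizing a with
  | zero => rfl
  | succ k ih => simp [factor, ih]

theorem factor_add (X : ℤ → I) (a : ℤ) (k l : ℕ) :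
    factor X a (k + l) = factor X a k ++ factor X (a + k) l := by
  induction k generalizing a with
  | zero => simp [factor]
  | succ k ih =>
    rw [Nat.add_right_comm, factor, factor, ih, List.cons_append]
    push_cast
    rw [add_assoc, add_comm (1 : ℤ)]

theorem factor_congr {X X' : ℤ → I} {a : ℤ} {k : ℕ}
    (h : ∀ i, a ≤ i → i < a + k → X i = X' i) : factor X a k = factor X' a k := by
  induction k generalizing a with
  | zero => rfl
  | succ k ih =>
    rw [factor, factor, h a le_rfl (by push_cast; omega),
      ih fun i h1 h2 => h i (by omega) (by push_cast; omega)]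

theorem factor_shift (X : ℤ → I) (b a : ℤ) (k : ℕ) :
    factor (fun i => X (b + i)) a k = factor X (b + a) k := by
  induction k generalizing a with
  | zero => rfl
  | succ k ih => rw [factor, factor, ih, add_assoc]

/-- Reflection sends the last position `a + k - 1` to `-(a + k) + 1`, where the reversed word
starts. -/
theorem reverse_factor (X : ℤ → I) (a : ℤ) (k : ℕ) :
    (factor X a k).reverse = factor (fun i => X (-i)) (-(a + k) + 1) k := by
  induction k generalizing a with
  | zero => rfl
  | succ k ih =>
    rw [factor, List.reverse_cons, ih, factor_add _ _ k 1]
    push_cast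
    congr 2
    · congr 1; ring
    · congr 1; ring

theorem ofFn_eq_factor (X : ℤ → I) (a : ℤ) (k : ℕ) :
    List.ofFn (fun j : Fin k => X (a + (j : ℕ))) = factor X a k := by
  induction k generalizing a with
  | zero => rfl
  | succ k ih =>
    rw [List.ofFn_succ, factor, ← ih]
    simp only [Fin.val_zero, Nat.cast_zero, add_zero, Fin.val_succ]
    push_cast
    simp only [add_assoc, add_comm (1 : ℤ)]

end factor

section automaton

variable {I O : Type*}

/-- The labels of `2 * r + 1` consecutive positions. -/
abbrev State (I O : Type*) (r : ℕ) : Type _ := Fin (2 * r + 1) → Option (I × O)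

variable (S : Set (CenteredLabeledGraph I O)) (r : ℕ)

/-- Among `2 * r + 2` consecutive labels, those around the two middle positions are allowed. -/
def PairOK (ω : Fin (2 * r + 1 + 1) → Option (I × O)) : Prop :=
  ∃ y : ℤ → Option (I × O), labelsAt _ y 0 = ω ∧ WindowOK S r (fun i => y (r + i)) ∧
    WindowOK S r (fun i => y (r + 1 + i))

/-- The automaton moves by one position and reads the input of the new position. -/
def Step (p : State I O r) (a : I) (q : State I O r) : Prop :=
  ∃ ω : Fin (2 * r + 1 + 1) → Option (I × O), PairOK S r ω ∧ Fin.init ω = p ∧ Fin.tail ω = q ∧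
    ∃ o, ω (Fin.last _) = some (a, o)

/-- The automaton can go from `p` to `q` by reading a word. -/
def Reach : State I O r → List I → State I O r → Prop
  | p, [], q => p = q
  | p, a :: w, q => ∃ p', Step S r p a p' ∧ Reach p' w q

variable {S r}

/-- The windows around the two middle positions fill exactly the `2 * r + 2` given positions, so the
extension chosen in `PairOK` is irrelevant. -/
theorem pairOK_labelsAt {y : ℤ → Option (I × O)} {a : ℤ} : PairOK S r (labelsAt _ y a) ↔
    WindowOK S r (fun i => y (a + r + i)) ∧ WindowOK S r (fun i => y (a + r + 1 + i)) := by
  constructor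
  · rintro ⟨y', h, h1, h2⟩
    have key (i : ℤ) (h0 : 0 ≤ i) (hi : i < 2 * r + 2) : y' i = y (a + i) := by
      have := congrFun h ⟨i.toNat, by omega⟩
      simpa [labelsAt, Int.toNat_of_nonneg h0] using this
    constructor
    · refine h1.congr fun i hi => ?_
      rw [abs_le] at hi
      rw [key _ (by omega) (by omega), add_assoc]
    · refine h2.congr fun i hi => ?_
      rw [abs_le] at hi
      rw [key _ (by omega) (by omega), add_assoc, add_assoc, add_assoc]
  · rintro ⟨h1, h2⟩
    refine ⟨fun i => y (a + i), ?_, ?_, ?_⟩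
    · funext j; simp [labelsAt]
    · simpa only [add_assoc] using h1
    · simpa only [add_assoc] using h2

theorem reach_append {p q : State I O r} {w w' : List I} :
    Reach S r p (w ++ w') q ↔ ∃ m, Reach S r p w m ∧ Reach S r m w' q := by
  induction w generalizing p with
  | nil => simp [Reach]
  | cons a w ih =>
    simp only [List.cons_append, Reach, ih]
    constructor
    · rintro ⟨p', h, m, h1, h2⟩; exact ⟨m, ⟨p', h, h1⟩, h2⟩
    · rintro ⟨m, ⟨p', h, h1⟩, h2⟩; exact ⟨p', h, m, h1, h2⟩

theorem init_labelsAt {Λ : Type*} {d : ℕ} (y : ℤ → Λ) (a : ℤ) :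
    Fin.init (labelsAt (d + 1) y a) = labelsAt d y a := by
  funext j; simp [labelsAt, Fin.init]

theorem tail_labelsAt {Λ : Type*} {d : ℕ} (y : ℤ → Λ) (a : ℤ) :
    Fin.tail (labelsAt (d + 1) y a) = labelsAt d y (a + 1) := by
  funext j; simp [labelsAt, Fin.tail, add_assoc, add_comm (1 : ℤ)]

/-- The state at `a` covers the positions `a, …, a + 2 * r`, so the first letter read is the input
at `a + (2 * r + 1)`. The state itself may contain `none`, which allows a run to enter a path at its
end. -/
theorem reach_of_labeling {X : ℤ → I} {y : ℤ → Option (I × O)} {a : ℤ} {k : ℕ}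
    (h : ∀ i, a ≤ i → i < a + k → PairOK S r (labelsAt _ y i) ∧
      ∃ o, y (i + (2 * r + 1 : ℕ)) = some (X (i + (2 * r + 1 : ℕ)), o)) :
    Reach S r (labelsAt _ y a) (factor X (a + (2 * r + 1 : ℕ)) k) (labelsAt _ y (a + k)) := by
  induction k generalizing a with
  | zero => simp [Reach, factor]
  | succ k ih =>
    rw [factor]
    obtain ⟨h1, h2⟩ := h a le_rfl (by push_cast; omega)
    refine ⟨labelsAt _ y (a + 1), ⟨labelsAt _ y a, h1, init_labelsAt y a, tail_labelsAt y a, ?_⟩, ?_⟩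
    · simpa [labelsAt] using h2
    · have := ih (a := a + 1) fun i h1 h2 => h i (by omega) (by push_cast; omega)
      rw [add_right_comm] at this
      convert this using 2
      push_cast; ring

theorem exists_labeling_of_reach {X : ℤ → I} {a : ℤ} {k : ℕ} {p q : State I O r}
    (h : Reach S r p (factor X (a + (2 * r + 1 : ℕ)) k) q) :
    ∃ y : ℤ → Option (I × O), labelsAt _ y a = p ∧ labelsAt _ y (a + k) = q ∧
      ∀ i, a ≤ i → i < a + k → PairOK S r (labelsAt _ y i) ∧
        ∃ o, y (i + (2 * r + 1 : ℕ)) = some (X (i + (2 * r + 1 : ℕ)), o) := by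
  induction k generalizing a p with
  | zero =>
    refine ⟨fun i => if h : 0 ≤ i - a ∧ i - a < (2 * r + 1 : ℕ) then
      p ⟨(i - a).toNat, by omega⟩ else none, ?_, ?_, fun i h1 h2 => by push_cast at h2; omega⟩
    · funext j
      exact (dif_pos (by omega)).trans (by simp)
    · rw [← show p = q from h]
      funext j
      exact (dif_pos (by push_cast; omega)).trans (by simp)
  | succ k ih =>
    rw [factor] at h
    obtain ⟨p', ⟨ω, h1, rfl, rfl, o, ho⟩, h3⟩ := h
    rw [add_right_comm a] at h3
    obtain ⟨y', hp, hq, hy⟩ := ih h3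
    -- The run of the remaining word is extended by the first label of the current step; values left
    -- of `a` are never read.
    let y (i : ℤ) : Option (I × O) := if i ≤ a then ω 0 else y' i
    have hy' (i : ℤ) (hi : a < i) : y i = y' i := if_neg (by omega)
    have hw (d : ℕ) (i : ℤ) (hi : a < i) : labelsAt d y i = labelsAt d y' i := by
      funext j; exact hy' _ (by omega)
    have hω : labelsAt _ y a = ω := by
      funext j
      induction j using Fin.cases with
      | zero => simp [labelsAt, y]
      | succ j =>
        refine Eq.trans ?_ (congrFun hp j)
        simp only [labelsAt, Fin.val_succ]
        rw [hy' _ (by push_cast; omega)]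
        congr 1; push_cast; ring
    refine ⟨y, ?_, ?_, fun i hi1 hi2 => ?_⟩
    · rw [← init_labelsAt, hω]
    · rw [hw _ _ (by push_cast; omega), ← hq]
      congr 1; push_cast; ring
    · rcases hi1.eq_or_lt with rfl | hi1
      · refine ⟨hω ▸ h1, o, ?_⟩
        rw [← ho, ← hω]
        simp [labelsAt]
      · rw [hw _ _ hi1, hy' _ (by omega)]
        exact hy i (by omega) (by push_cast at hi2; omega)

/-! ### Types of words -/

/-- The possible effects of a word and of its reversal on states. -/
abbrev EffectPair (I O : Type*) (r : ℕ) : Type _ :=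
  Set (State I O r × State I O r) × Set (State I O r × State I O r)

variable (S r) in
/-- The effect of a word read in both directions. -/
def effect (w : List I) : EffectPair I O r :=
  ({pq | Reach S r pq.1 w pq.2}, {pq | Reach S r pq.1 w.reverse pq.2})

theorem reach_congr {w w' : List I} (h : effect S r w = effect S r w') {p q : State I O r} :
    Reach S r p w q ↔ Reach S r p w' q :=
  Set.ext_iff.1 (congrArg Prod.fst h) (p, q)

theorem reach_reverse_congr {w w' : List I} (h : effect S r w = effect S r w')
    {p q : State I O r} : Reach S r p w.reverse q ↔ Reach S r p w'.reverse q :=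
  Set.ext_iff.1 (congrArg Prod.snd h) (p, q)

variable (S r) in
/-- The automaton that computes the effect of a word. -/
def effectDFA : DFA I (EffectPair I O r) where
  step T a := ({pq | ∃ m, (pq.1, m) ∈ T.1 ∧ Reach S r m [a] pq.2},
    {pq | ∃ m, Reach S r pq.1 [a] m ∧ (m, pq.2) ∈ T.2})
  start := effect S r []
  accept := ∅

/-- Appending a letter to a word puts it in front of the reversed word, hence the composition on the
left in the second component. -/
theorem effectDFA_eval (w : List I) : (effectDFA S r).eval w = effect S r w := by
  induction w using List.reverseRecOn with
  | nil => rfl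
  | append_singleton w a ih =>
    rw [DFA.eval_append_singleton, ih]
    ext pq
    · exact reach_append.symm
    · simp only [effect, List.reverse_append, List.reverse_singleton]
      exact reach_append.symm

/-- A word this long repeats a state of `effectDFA`. Going `L` times through the nonempty loop keeps
the effect and makes the word long enough, but at most `L + 1` times as long. -/
theorem effect_pump [Finite I] [Finite O] {w : List I}
    (hw : Nat.card (EffectPair I O r) ≤ w.length) (L : ℕ) :
    ∃ w', effect S r w' = effect S r w ∧ L ≤ w'.length ∧ w'.length ≤ w.length * (L + 1) := by
  have := Fintype.ofFinite (EffectPair I O r)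
  rw [Nat.card_eq_fintype_card] at hw
  obtain ⟨q, a, b, c, hx, -, hb, h1, h2, h3⟩ :=
    (effectDFA S r).evalFrom_split hw (s := (effectDFA S r).start) rfl
  have hpow (k : ℕ) : (effectDFA S r).evalFrom q (List.replicate k b).flatten = q := by
    induction k with
    | zero => rfl
    | succ k ih =>
      rw [List.replicate_succ, List.flatten_cons, DFA.evalFrom_of_append, h2, ih]
  refine ⟨a ++ (List.replicate L b).flatten ++ c, ?_, ?_, ?_⟩
  · rw [← effectDFA_eval, ← effectDFA_eval]
    change (effectDFA S r).evalFrom (effectDFA S r).start _ = _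
    rw [DFA.evalFrom_of_append, DFA.evalFrom_of_append, h1, hpow, h3]
    rfl
  · have : 1 ≤ b.length := List.length_pos_iff.2 hb
    simp
    nlinarith
  · rw [hx]
    simp
    nlinarith [Nat.zero_le (a.length * L), Nat.zero_le (c.length * L)]

variable (S r) in
/-- The combinatorial condition that characterizes the easy problems. Far apart patches of
`2 * r + 1` nodes can be labeled independently, each depending only on its inputs and on the effects
of the two words that leave the patch, such that the labelings of any two consecutive patches, and,
if `paths` holds, of an end of the path and a patch, can be completed in between. -/
structure IsPatchLabeling (paths : Prop)
    (L : EffectPair I O r → (Fin (2 * r + 1) → I) → EffectPair I O r → Set (State I O r)) :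
    Prop where
  nonempty : ∀ (v w : List I) (u), v.length = Nat.card (EffectPair I O r) →
    w.length = Nat.card (EffectPair I O r) → (L (effect S r v) u (effect S r w)).Nonempty
  input : ∀ α u β, ∀ p ∈ L α u β, ∀ j, ∃ o, p j = some (u j, o)
  rev : ∀ α u β, ∀ p ∈ L α u β, p ∘ Fin.rev ∈ L β (u ∘ Fin.rev) α
  -- Context words are read away from their patch, so the left one of the second patch is reversed.
  -- The rest `m` of the gap is arbitrary and may be empty.
  join : ∀ α u v w u' β, ∀ p ∈ L α u (effect S r v), ∀ q ∈ L (effect S r w) u' β, ∀ m,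
    Reach S r p (v ++ m ++ w.reverse ++ List.ofFn u') q
  join_end : paths → ∀ w u β, ∀ q ∈ L (effect S r w) u β, ∀ m,
    Reach S r (fun _ => none) (m ++ w.reverse ++ List.ofFn u) q

end automaton

/-! ### Local rules -/

/-- A function of labeled two-sided infinite sequences that depends only on the radius-`ρ` window
around `0` and not on the direction. -/
def IsRule {α β : Type*} (ρ : ℕ) (Y : (ℤ → Option α) → β) : Prop :=
  (∀ z z', (∀ i : ℤ, |i| ≤ ρ → z i = z' i) → Y z = Y z') ∧ ∀ z, Y (fun i => z (-i)) = Y z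

/-- The sequence `z`, moved such that position `i` becomes position `0`. -/
def shiftBy {α : Type*} (z : ℤ → α) (i : ℤ) : ℤ → α := fun j => z (i + j)

section shiftBy

variable {α : Type*}

@[simp] theorem shiftBy_apply (z : ℤ → α) (i j : ℤ) : shiftBy z i j = z (i + j) := rfl

@[simp] theorem shiftBy_shiftBy (z : ℤ → α) (i j : ℤ) :
    shiftBy (shiftBy z i) j = shiftBy z (i + j) := by
  funext l; simp [add_assoc]

theorem shiftBy_neg (z : ℤ → α) (j : ℤ) :
    shiftBy (fun i => z (-i)) j = fun i => shiftBy z (-j) (-i) := by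
  funext i; simp; congr 1; ring

theorem shiftBy_agree {z z' : ℤ → α} {ρ σ : ℕ} {j : ℤ} (h : ∀ i : ℤ, |i| ≤ (ρ : ℤ) → z i = z' i)
    (hj : |j| + σ ≤ ρ) (i : ℤ) (hi : |i| ≤ (σ : ℤ)) : shiftBy z j i = shiftBy z' j i :=
  h _ ((abs_add_le _ _).trans (by omega))

end shiftBy

theorem IsRule.mono {α β : Type*} {ρ ρ' : ℕ} {Y : (ℤ → Option α) → β} (h : IsRule ρ Y)
    (hρ : ρ ≤ ρ') : IsRule ρ' Y :=
  ⟨fun z z' hz => h.1 z z' fun i hi => hz i (hi.trans (by exact_mod_cast hρ)), h.2⟩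

theorem IsRule.comp {α β γ δ : Type*} {ρ σ : ℕ} {Y : (ℤ → Option α) → β}
    {Z : (ℤ → Option γ) → δ} (hZ : IsRule σ Z) (hY : IsRule ρ Y) (f : α → β → γ) :
    IsRule (σ + ρ) (fun z => Z fun i => (z i).map fun a => f a (Y (shiftBy z i))) := by
  constructor
  · intro z z' h
    refine hZ.1 _ _ fun i hi => ?_
    rw [h i (hi.trans (by simp)), hY.1 _ _ (shiftBy_agree h (σ := ρ) (by push_cast; omega))]
  · intro z
    refine Eq.trans ?_ (hZ.2 _)
    beta_reduce
    congr 1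
    funext i
    rw [shiftBy_neg, hY.2]

/-- Some element of `s`, which depends only on `s`, if there is one. -/
noncomputable def pick {α : Type*} [Nonempty α] (s : Set α) : α := Classical.epsilon (· ∈ s)

theorem pick_mem {α : Type*} [Nonempty α] {s : Set α} (h : s.Nonempty) : pick s ∈ s :=
  Classical.epsilon_spec h

/-- Local names are distinct in an interval, so labels can be given by names. -/
theorem exists_of_name {α O : Type*} [Nonempty O] {z : ℤ → Option α} {name : α → ℕ} {s : Set ℤ}
    (h : ∀ i ∈ s, ∀ j ∈ s, ∀ a b, z i = some a → z j = some b → name a = name b → i = j)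
    (o : ℤ → O) : ∃ g : ℕ → O, ∀ i ∈ s, ∀ a, z i = some a → g (name a) = o i := by
  classical
  refine ⟨fun m => if h : ∃ i ∈ s, ∃ a, z i = some a ∧ name a = m then o h.choose
    else Classical.arbitrary O, fun i hi a ha => ?_⟩
  have hex : ∃ i ∈ s, ∃ b, z i = some b ∧ name b = name a := ⟨i, hi, a, ha, rfl⟩
  refine (dif_pos hex).trans ?_
  obtain ⟨h1, b, h2, h3⟩ := hex.choose_spec
  rw [h _ h1 i hi b a h2 ha h3]

/-! ### Completing a labeling between patches -/

section marked

variable {I : Type*}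

/-- The node at `0` is in the given set and farther than `k` from the ends of the path. -/
def Marked (k : ℕ) (z : ℤ → Option (ℕ × I × Prop)) : Prop :=
  (∃ a, z 0 = some a ∧ a.2.2) ∧ ∀ j : ℤ, |j| ≤ k → z j ≠ none

theorem isRule_marked (k : ℕ) : IsRule k (Marked (I := I) k) := by
  constructor
  · intro z z' h
    rw [Marked, Marked, h 0 (by simp)]
    congr 1
    refine propext (forall_congr' fun j => forall_congr' fun hj => ?_)
    rw [h j hj]
  · intro z
    rw [Marked, Marked, neg_zero]
    congr 1
    refine propext ⟨fun h j hj => by simpa using h (-j) (by simpa using hj),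
      fun h j hj => h (-j) (by simpa using hj)⟩

end marked

section fill

variable {I O : Type*} [Nonempty I] (S : Set (CenteredLabeledGraph I O)) (r : ℕ)
  (L : EffectPair I O r → (Fin (2 * r + 1) → I) → EffectPair I O r → Set (State I O r)) (κ B : ℕ)

/-- The inputs of a sequence. -/
noncomputable def inputs (z : ℤ → Option (ℕ × I × Prop)) (i : ℤ) : I :=
  (z i).elim (Classical.arbitrary I) fun a => a.2.1

/-- The allowed labelings of the patch around `0`, as functions of the names. -/
def patchSet (z : ℤ → Option (ℕ × I × Prop)) : Set (ℕ → O) :=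
  {g | labelsAt (2 * r + 1) (fun i => (z i).map fun a => (a.2.1, g a.1)) (-r) ∈
    L (effect S r (factor (inputs z) (-r - κ) κ).reverse) (fun j => inputs z (-r + (j : ℕ)))
      (effect S r (factor (inputs z) (r + 1) κ))}

variable {S r L κ} in
-- Labelings are functions of names instead of positions, so the set can be independent of the
-- reading direction; `rev` exchanges the two sides of the patch.
theorem isRule_patchSet {b : Prop} (hL : IsPatchLabeling S r b L) :
    IsRule (r + κ) (patchSet S r L κ) := by
  constructor
  · intro z z' h
    have hin (i : ℤ) (hi : |i| ≤ ((r + κ : ℕ) : ℤ)) : inputs z i = inputs z' i := by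
      rw [inputs, inputs, h i hi]
    ext g
    rw [patchSet, patchSet, Set.mem_ofPred_eq, Set.mem_ofPred_eq]
    rw [factor_congr (X := inputs z) (X' := inputs z') fun i h1 h2 => hin i (by
        rw [abs_le]; push_cast; omega),
      factor_congr (X := inputs z) (X' := inputs z') fun i h1 h2 => hin i (by
        rw [abs_le]; push_cast; omega)]
    have h1 (j : Fin (2 * r + 1)) : |(-r + (j : ℕ) : ℤ)| ≤ ((r + κ : ℕ) : ℤ) := by
      have := j.2
      rw [abs_le]; push_cast; omega
    have h2 : (fun j : Fin (2 * r + 1) => inputs z (-r + (j : ℕ))) =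
        fun j : Fin (2 * r + 1) => inputs z' (-r + (j : ℕ)) := funext fun j => hin _ (h1 j)
    have h3 : labelsAt (2 * r + 1) (fun i => (z i).map fun a => (a.2.1, g a.1)) (-r) =
        labelsAt (2 * r + 1) (fun i => (z' i).map fun a => (a.2.1, g a.1)) (-r) :=
      funext fun j => by simp only [labelsAt]; rw [h _ (h1 j)]
    rw [h2, h3]
  · have key (z : ℤ → Option (ℕ × I × Prop)) (g : ℕ → O) (hg : g ∈ patchSet S r L κ z) :
        g ∈ patchSet S r L κ (fun i => z (-i)) := by
      have h1 := hL.rev _ _ _ _ hg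
      have hj (j : Fin (2 * r + 1)) : -(r : ℤ) + ((Fin.rev j : Fin _) : ℕ) = -(-r + (j : ℕ)) := by
        have := j.2
        rw [Fin.val_rev]; omega
      have e1 : (factor (inputs fun i => z (-i)) (-r - κ) κ).reverse =
          factor (inputs z) (r + 1) κ := by
        rw [reverse_factor]
        simp only [inputs, neg_neg]
        congr 1; ring
      have e2 : factor (inputs fun i => z (-i)) (r + 1) κ =
          (factor (inputs z) (-r - κ) κ).reverse := by
        rw [reverse_factor, show -((-r - κ : ℤ) + κ) + 1 = r + 1 by ring]
        rfl
      rw [patchSet, Set.mem_ofPred_eq, e1, e2]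
      convert h1 using 1
      · refine congrArg (fun u => L _ u _) ?_
        funext j; simp only [Function.comp, hj]; rfl
      · funext j; simp only [Function.comp, labelsAt, hj]
    intro z
    ext g
    exact ⟨fun h => by simpa using key _ g h, key z g⟩

variable [Nonempty O]

/-- The labels that the node at `0` gets from patches. -/
def patchLabel (z : ℤ → Option (ℕ × I × Prop)) : Set O :=
  {o | ∃ j : ℤ, |j| ≤ r ∧ Marked (r + κ) (shiftBy z j) ∧
    ∃ a, z 0 = some a ∧ o = pick (patchSet S r L κ (shiftBy z j)) a.1}

open scoped Classical in
/-- The label of the node at `0`: the one from a patch or else the one from `g`. -/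
noncomputable def nodeLabel (z : ℤ → Option (ℕ × I × Prop)) (g : ℕ → O) : Option (I × O) :=
  (z 0).map fun a => (a.2.1, if (patchLabel S r L κ z).Nonempty then pick (patchLabel S r L κ z)
    else g a.1)

/-- The valid labelings of the block that contains `0`. -/
def blockSet (z : ℤ → Option (ℕ × I × Prop)) : Set (ℕ → O) :=
  {g | ∀ i : ℤ, |i| ≤ B → z i ≠ none →
    (∀ j, 0 < j ∧ j < i ∨ i < j ∧ j < 0 → ¬ Marked (r + κ) (shiftBy z j)) →
    WindowOK S r (fun j => nodeLabel S r L κ (shiftBy z (i + j)) g)}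

open scoped Classical in
/-- The output of the node at `0`. -/
noncomputable def fillOutput (z : ℤ → Option (ℕ × I × Prop)) : O :=
  if (patchLabel S r L κ z).Nonempty then pick (patchLabel S r L κ z)
  else pick (blockSet S r L κ B z) ((z 0).elim 0 Prod.fst)

variable {S r L κ B}

theorem nodeLabel_pick (z : ℤ → Option (ℕ × I × Prop)) :
    nodeLabel S r L κ z (pick (blockSet S r L κ B z)) =
      (z 0).map fun a => (a.2.1, fillOutput S r L κ B z) := by
  rcases h : z 0 with _ | a <;> simp [nodeLabel, fillOutput, h]

theorem isRule_patchLabel {b : Prop} (hL : IsPatchLabeling S r b L) :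
    IsRule (2 * r + κ) (patchLabel S r L κ) := by
  constructor
  · intro z z' h
    ext o
    refine exists_congr fun j => and_congr_right fun hj => ?_
    have hs := shiftBy_agree h (j := j) (σ := r + κ) (by push_cast; omega)
    rw [(isRule_marked _).1 _ _ hs, (isRule_patchSet hL).1 _ _ hs, h 0 (by simp; omega)]
  · intro z
    ext o
    constructor
    · rintro ⟨j, hj, hm, a, ha, ho⟩
      rw [shiftBy_neg, (isRule_marked _).2] at hm
      rw [shiftBy_neg, (isRule_patchSet hL).2] at ho
      exact ⟨-j, by simpa using hj, hm, a, by simpa using ha, ho⟩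
    · rintro ⟨j, hj, hm, a, ha, ho⟩
      refine ⟨-j, by simpa using hj, ?_, a, by simpa using ha, ?_⟩
      · rw [shiftBy_neg, (isRule_marked _).2, neg_neg]; exact hm
      · rw [shiftBy_neg, (isRule_patchSet hL).2, neg_neg]; exact ho

theorem isRule_nodeLabel {b : Prop} (hL : IsPatchLabeling S r b L) (g : ℕ → O) :
    IsRule (2 * r + κ) (fun z => nodeLabel S r L κ z g) := by
  constructor
  · intro z z' h
    beta_reduce
    rw [nodeLabel, nodeLabel, (isRule_patchLabel hL).1 _ _ h, h 0 (by simp only [abs_zero]; positivity)]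
  · intro z
    beta_reduce
    rw [nodeLabel, nodeLabel, (isRule_patchLabel hL).2, neg_zero]

/-- The radius adds up `B` for the center of a window, `r` for the window, and `2 * r + κ` for the
patch labels in it. -/
theorem isRule_blockSet {b : Prop} (hL : IsPatchLabeling S r b L) :
    IsRule (B + 3 * r + κ) (blockSet S r L κ B) := by
  constructor
  · intro z z' h
    ext g
    refine forall_congr' fun i => forall_congr' fun hi => ?_
    rw [h i (hi.trans (by push_cast; omega))]
    refine forall_congr' fun _ => imp_congr (forall_congr' fun j => forall_congr' fun hj => ?_) ?_
    · rw [abs_le] at hi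
      rw [(isRule_marked _).1 _ _ (shiftBy_agree h (j := j) (by
        have : |j| ≤ B := abs_le.2 (by omega)
        push_cast; omega))]
    · refine windowOK_congr fun j hj => (isRule_nodeLabel hL g).1 _ _ (shiftBy_agree h ?_)
      have := abs_add_le i j
      push_cast; omega
  · have key (z : ℤ → Option (ℕ × I × Prop)) (g : ℕ → O) (hg : g ∈ blockSet S r L κ B z) :
        g ∈ blockSet S r L κ B (fun i => z (-i)) := by
      intro i hi hz hm
      have := hg (-i) (by simpa using hi) hz fun j hj => by
        have := hm (-j) (by omega)
        rwa [shiftBy_neg, (isRule_marked _).2, neg_neg] at this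
      refine (windowOK_congr fun j hj => ?_).1 this.neg
      rw [shiftBy_neg]
      refine Eq.trans ?_ ((isRule_nodeLabel hL g).2 _).symm
      beta_reduce
      congr 2; ring
    intro z
    ext g
    exact ⟨fun h => by simpa using key _ g h, key z g⟩

theorem isRule_fillOutput {b : Prop} (hL : IsPatchLabeling S r b L) :
    IsRule (B + 3 * r + κ) (fillOutput S r L κ B) := by
  constructor
  · intro z z' h
    rw [fillOutput, fillOutput, (isRule_patchLabel hL).1 _ _ fun i hi =>
      h i (hi.trans (by push_cast; omega)), (isRule_blockSet hL).1 _ _ h,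
      h 0 (by simp only [abs_zero]; positivity)]
  · intro z
    rw [fillOutput, fillOutput, (isRule_patchLabel hL).2, (isRule_blockSet hL).2, neg_zero]

end fill

/-! ### Correctness of patches and of the blocks between them -/

section fill

variable {I O : Type*} [Nonempty I] [Nonempty O] {S : Set (CenteredLabeledGraph I O)} {r : ℕ}
  {L : EffectPair I O r → (Fin (2 * r + 1) → I) → EffectPair I O r → Set (State I O r)} {κ B : ℕ}
  {z : ℤ → Option (ℕ × I × Prop)}

/-- All nodes strictly between the two end states compute the same set of labelings: by `hblock`,
each of them checks exactly the windows centered from `a + r` to `a + k + r`. Hence they pick the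
same function of names. The end states may be patches or, outside a path, `none`. -/
theorem windowOK_block {a : ℤ} {k : ℕ} (hk : 0 < k) (h0 : a + r ≤ 0) (h0' : 0 ≤ a + k + r)
    (hends : ∀ i, (a ≤ i ∧ i ≤ a + 2 * r ∨ a + k ≤ i ∧ i ≤ a + k + 2 * r) →
      z i = none ∨ (patchLabel S r L κ (shiftBy z i)).Nonempty)
    (hmid : ∀ i, a + 2 * r < i → i < a + k →
      z i ≠ none ∧ ¬ (patchLabel S r L κ (shiftBy z i)).Nonempty)
    (hinj : ∀ i j, a ≤ i → i ≤ a + k + 2 * r → a ≤ j → j ≤ a + k + 2 * r → ∀ b c, z i = some b →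
      z j = some c → b.1 = c.1 → i = j)
    (hblock : ∀ l, a + 2 * r < l → l < a + k → ∀ i, z i ≠ none →
      ((|i - l| ≤ B ∧ ∀ j, l < j ∧ j < i ∨ i < j ∧ j < l → ¬ Marked (r + κ) (shiftBy z j)) ↔
        a + r ≤ i ∧ i ≤ a + k + r))
    (hreach : ∀ g, Reach S r (labelsAt _ (fun i => nodeLabel S r L κ (shiftBy z i) g) a)
      (factor (inputs z) (a + (2 * r + 1 : ℕ)) k)
      (labelsAt _ (fun i => nodeLabel S r L κ (shiftBy z i) g) (a + k))) :
    WindowOK S r (fun j => (z j).map fun a => (a.2.1, fillOutput S r L κ B (shiftBy z j))) := by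
  have hindep (i) (hi : z i = none ∨ (patchLabel S r L κ (shiftBy z i)).Nonempty) (g g' : ℕ → O) :
      nodeLabel S r L κ (shiftBy z i) g = nodeLabel S r L κ (shiftBy z i) g' := by
    rcases hi with hi | hi <;> simp [nodeLabel, hi]
  let Q : Set (ℕ → O) := {g | ∀ i, z i ≠ none → a + r ≤ i ∧ i ≤ a + k + r →
    WindowOK S r (fun j => nodeLabel S r L κ (shiftBy z (i + j)) g)}
  have hQ (l) (h1 : a + 2 * r < l) (h2 : l < a + k) : blockSet S r L κ B (shiftBy z l) = Q := by
    ext g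
    constructor
    · intro hg i hi hi'
      obtain ⟨h3, h4⟩ := (hblock l h1 h2 i hi).2 hi'
      have := hg (i - l) h3 (by simpa using hi) fun j hj => by
        rw [shiftBy_shiftBy]
        exact h4 (l + j) (by omega)
      simpa only [shiftBy_shiftBy, add_sub_cancel, ← add_assoc] using this
    · intro hg i hi hz hm
      have h5 : (fun j => nodeLabel S r L κ (shiftBy (shiftBy z l) (i + j)) g) =
          fun j => nodeLabel S r L κ (shiftBy z (l + i + j)) g := by
        funext j; rw [shiftBy_shiftBy, add_assoc]
      rw [h5]
      refine hg (l + i) hz ((hblock l h1 h2 (l + i) hz).1 ⟨by simpa using hi, fun j hj => ?_⟩)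
      have := hm (j - l) (by omega)
      rwa [shiftBy_shiftBy, add_sub_cancel] at this
  have hQne : Q.Nonempty := by
    -- The end states do not depend on the function, so a run for an arbitrary one supplies the
    -- labels in between, which distinct names turn into a new function.
    obtain ⟨g0⟩ : Nonempty (ℕ → O) := inferInstance
    obtain ⟨y, hya, hyk, hy⟩ := exists_labeling_of_reach (hreach g0)
    obtain ⟨g, hg⟩ := exists_of_name (z := z) (name := Prod.fst)
      (s := {i | a ≤ i ∧ i ≤ a + k + 2 * r})
      (fun i hi j hj b c => hinj i j hi.1 hi.2 hj.1 hj.2 b c)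
      (fun i => (y i).elim (Classical.arbitrary O) Prod.snd)
    have hyg (i) (hi : a ≤ i) (hi' : i ≤ a + k + 2 * r) :
        nodeLabel S r L κ (shiftBy z i) g = y i := by
      by_cases h1 : i ≤ a + 2 * r
      · rw [hindep i (hends i (by omega)) g g0]
        have := congrFun hya ⟨(i - a).toNat, by omega⟩
        simpa [labelsAt, Int.toNat_of_nonneg (show 0 ≤ i - a by omega)] using this.symm
      by_cases h2 : a + k ≤ i
      · rw [hindep i (hends i (by omega)) g g0]
        have := congrFun hyk ⟨(i - (a + k)).toNat, by omega⟩
        simpa [labelsAt, Int.toNat_of_nonneg (show 0 ≤ i - (a + k) by omega)] using this.symm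
      · obtain ⟨hz, hp⟩ := hmid i (by omega) (by omega)
        obtain ⟨b, hb⟩ := Option.ne_none_iff_exists'.1 hz
        obtain ⟨-, o, ho⟩ := hy (i - (2 * r + 1 : ℕ)) (by push_cast; omega) (by push_cast; omega)
        rw [sub_add_cancel] at ho
        have h3 := hg i ⟨hi, hi'⟩ b hb
        simp [nodeLabel, hp, hb, ho, h3, inputs]
    refine ⟨g, fun i hz hi => ?_⟩
    have h3 : ∀ i, a + r ≤ i → i ≤ a + k + r → WindowOK S r (fun j => y (i + j)) := by
      intro i h1 h2
      by_cases h3 : i < a + k + r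
      · obtain ⟨h4, -⟩ := hy (i - r) (by omega) (by omega)
        simpa using (pairOK_labelsAt.1 h4).1
      · obtain ⟨h4, -⟩ := hy (i - r - 1) (by omega) (by omega)
        simpa [show i - r - 1 + r + 1 = i by ring] using (pairOK_labelsAt.1 h4).2
    refine (h3 i hi.1 hi.2).congr fun j hj => ?_
    rw [abs_le] at hj
    exact (hyg (i + j) (by omega) (by omega)).symm
  rcases hz0 : z 0 with _ | b
  · exact WindowOK.of_center (by simp [hz0])
  have := pick_mem hQne 0 (by simp [hz0]) ⟨h0, h0'⟩
  refine this.congr fun j hj => ?_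
  rw [abs_le] at hj
  rw [zero_add]
  have hlab : nodeLabel S r L κ (shiftBy z j) (pick (blockSet S r L κ B (shiftBy z j))) =
      (z j).map fun a => (a.2.1, fillOutput S r L κ B (shiftBy z j)) := by
    rw [nodeLabel_pick, shiftBy_apply, add_zero]
  rw [← hlab]
  by_cases h1 : a + 2 * r < j ∧ j < a + k
  · rw [hQ j h1.1 h1.2]
  · exact hindep j (hends j (by omega)) _ _

/-- No other marked position is within `2 * r`, so each node of the patch has a single candidate
label, and these come from one labeling picked at the center. -/
theorem patch_of_marked [Finite I] [Finite O] {b : Prop} (hL : IsPatchLabeling S r b L)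
    (hκ : κ = Nat.card (EffectPair I O r)) {m : ℤ}
    (hm : Marked (r + κ) (shiftBy z m))
    (hinj : ∀ i j, |i - m| ≤ r → |j - m| ≤ r → ∀ b c, z i = some b → z j = some c → b.1 = c.1 →
      i = j)
    (huniq : ∀ j, |j - m| ≤ 2 * r → Marked (r + κ) (shiftBy z j) → j = m) :
    (∀ i, |i - m| ≤ r → (patchLabel S r L κ (shiftBy z i)).Nonempty) ∧
      ∀ g, labelsAt _ (fun i => nodeLabel S r L κ (shiftBy z i) g) (m - r) ∈
        L (effect S r (factor (inputs z) (m - r - κ) κ).reverse)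
          (fun j => inputs z (m - r + (j : ℕ))) (effect S r (factor (inputs z) (m + r + 1) κ)) := by
  have hlab (i) (hi : |i - m| ≤ r) (a) (ha : z i = some a) :
      patchLabel S r L κ (shiftBy z i) = {pick (patchSet S r L κ (shiftBy z m)) a.1} := by
    ext o
    constructor
    · rintro ⟨j, hj, hjm, a', ha', rfl⟩
      rw [shiftBy_shiftBy] at *
      have := huniq (i + j) (by rw [abs_le] at *; omega) hjm
      rw [shiftBy_apply, add_zero, ha, Option.some_inj] at ha'
      rw [this, ha']; rfl
    · rintro rfl
      refine ⟨m - i, by rwa [abs_sub_comm], by simpa using hm, a, by simpa using ha, by simp⟩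
  have hsome (i) (hi : |i - m| ≤ r) : ∃ a, z i = some a := by
    refine Option.ne_none_iff_exists'.1 ?_
    have := hm.2 (i - m) (hi.trans (by push_cast; omega))
    simpa using this
  have hne : (patchSet S r L κ (shiftBy z m)).Nonempty := by
    obtain ⟨p, hp⟩ := hL.nonempty (factor (inputs (shiftBy z m)) (-r - κ) κ).reverse
      (factor (inputs (shiftBy z m)) (r + 1) κ)
      (fun j => inputs (shiftBy z m) (-r + (j : ℕ))) (by simp [hκ]) (by simp [hκ])
    obtain ⟨g, hg⟩ := exists_of_name (z := z) (name := Prod.fst) (s := {i | |i - m| ≤ r})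
      (fun i hi j hj b c => hinj i j hi hj b c)
      (fun i => if h : 0 ≤ i - (m - r) ∧ i - (m - r) < (2 * r + 1 : ℕ) then
        (p ⟨(i - (m - r)).toNat, by omega⟩).elim (Classical.arbitrary O) Prod.snd
        else Classical.arbitrary O)
    refine ⟨g, ?_⟩
    rw [patchSet, Set.mem_ofPred_eq]
    convert hp using 1
    funext j
    obtain ⟨o, ho⟩ := hL.input _ _ _ _ hp j
    have hj : |m + (-r + (j : ℕ)) - m| ≤ (r : ℤ) := by
      have := j.2
      rw [abs_le]; omega
    obtain ⟨a, ha⟩ := hsome _ hj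
    have h1 := hg _ hj a ha
    rw [dif_pos (by have := j.2; push_cast; omega)] at h1
    have h2 : (⟨(m + (-r + (j : ℕ)) - (m - r)).toNat, by have := j.2; omega⟩ :
        Fin (2 * r + 1)) = j := by
      ext; simp only []; omega
    rw [h2, ho] at h1
    rw [ho]
    simp only [labelsAt, shiftBy_apply, ha, Option.map_some, h1, inputs, Option.elim_some]
  refine ⟨fun i hi => ?_, fun g => ?_⟩
  · obtain ⟨a, ha⟩ := hsome i hi
    rw [hlab i hi a ha]
    exact Set.singleton_nonempty _
  · have h1 := pick_mem hne
    generalize pick (patchSet S r L κ (shiftBy z m)) = g₁ at h1 hlab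
    rw [patchSet, Set.mem_ofPred_eq] at h1
    have hin : inputs (shiftBy z m) = fun i => inputs z (m + i) := rfl
    have e1 : m + (-(r : ℤ) - κ) = m - r - κ := by ring
    have e2 : m + ((r : ℤ) + 1) = m + r + 1 := by ring
    have e3 : (fun j : Fin (2 * r + 1) => inputs z (m + (-r + (j : ℕ)))) =
        fun j : Fin (2 * r + 1) => inputs z (m - r + (j : ℕ)) := by
      funext j; congr 1; ring
    have hst : labelsAt (2 * r + 1) (fun i => nodeLabel S r L κ (shiftBy z i) g) (m - r) =
        labelsAt (2 * r + 1) (fun i => (shiftBy z m i).map fun a => (a.2.1, g₁ a.1)) (-r) := by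
      funext j
      have hj : |m - r + (j : ℕ) - m| ≤ (r : ℤ) := by
        have := j.2
        rw [abs_le]; omega
      obtain ⟨a, ha⟩ := hsome _ hj
      have hl := hlab _ hj a ha
      have hne' : (patchLabel S r L κ (shiftBy z (m - r + (j : ℕ)))).Nonempty := by
        rw [hl]; exact Set.singleton_nonempty _
      have hp := pick_mem hne'
      rw [hl, Set.mem_singleton_iff, ← hl] at hp
      have e : m + (-(r : ℤ) + (j : ℕ)) = m - r + (j : ℕ) := by ring
      simp only [labelsAt, nodeLabel, shiftBy_apply, add_zero, ha, Option.map_some, e, if_pos hne', hp]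
    rw [hin, factor_shift, factor_shift, e1, e2] at h1
    rw [hst, ← e3]
    exact h1

end fill

/-! ### Sequences with a maximal set of far apart nodes -/

section regular

variable {I : Type*} {z : ℤ → Option (ℕ × I × Prop)}

/-- A sequence that describes a long path or cycle with names that are distinct in each stretch of
`n` nodes and a maximal set of nodes at pairwise distance more than `k`. -/
structure IsRegularSeq (n k : ℕ) (z : ℤ → Option (ℕ × I × Prop)) : Prop where
  inj : ∀ i j a b, z i = some a → z j = some b → a.1 = b.1 → i ≠ j → (n : ℤ) ≤ |i - j|
  conv : ∀ i j l, i ≤ j → j ≤ l → z i ≠ none → z l ≠ none → z j ≠ none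
  long : ∀ a c b, a < c → c < b → z a = none → z c ≠ none → z b = none → n < b - a
  indep : ∀ i j a b, z i = some a → z j = some b → a.2.2 → b.2.2 → i ≠ j → k < |i - j|
  dom : ∀ i, z i ≠ none → ∃ j a, |j - i| ≤ k ∧ z j = some a ∧ a.2.2

theorem IsRegularSeq.neg {n k : ℕ} (h : IsRegularSeq n k z) : IsRegularSeq n k (fun i => z (-i)) where
  inj i j a b hi hj hab hij := by
    have := h.inj _ _ a b hi hj hab (by omega)
    rwa [show -i - -j = -(i - j) by ring, abs_neg] at this
  conv i j l hij hjl hi hl := h.conv (-l) (-j) (-i) (by omega) (by omega) hl hi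
  long a c b hac hcb ha hc hb := by
    have := h.long (-b) (-c) (-a) (by omega) (by omega) hb hc ha
    omega
  indep i j a b hi hj ha hb hij := by
    have := h.indep _ _ a b hi hj ha hb (by omega)
    rwa [show -i - -j = -(i - j) by ring, abs_neg] at this
  dom i hi := by
    obtain ⟨j, a, hj, hz, ha⟩ := h.dom (-i) hi
    exact ⟨-j, a, by rwa [show -j - i = -(j - -i) by ring, abs_neg], by simpa using hz, ha⟩

theorem IsRegularSeq.shift {n k : ℕ} (h : IsRegularSeq n k z) (p : ℤ) : IsRegularSeq n k (shiftBy z p) where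
  inj i j a b hi hj hab hij := by
    have := h.inj _ _ a b hi hj hab (by omega)
    rwa [show p + i - (p + j) = i - j by ring] at this
  conv i j l hij hjl hi hl := h.conv (p + i) (p + j) (p + l) (by omega) (by omega) hi hl
  long a c b hac hcb ha hc hb := by
    have := h.long (p + a) (p + c) (p + b) (by omega) (by omega) ha hc hb
    omega
  indep i j a b hi hj ha hb hij := by
    have := h.indep _ _ a b hi hj ha hb (by omega)
    rwa [show p + i - (p + j) = i - j by ring] at this
  dom i hi := by
    obtain ⟨j, a, hj, hz, ha⟩ := h.dom (p + i) hi
    exact ⟨j - p, a, by rwa [show j - p - i = j - (p + i) by ring], by simpa using hz, ha⟩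

/-- A chosen node within `k` of the middle still has `s` nodes of the stretch on each side. -/
theorem IsRegularSeq.exists_marked {n k : ℕ} (h : IsRegularSeq n k z) {s : ℕ} {i : ℤ}
    (hi : ∀ l, i ≤ l → l ≤ i + (2 * s + 2 * k : ℕ) → z l ≠ none) :
    ∃ j, i ≤ j ∧ j ≤ i + (2 * s + 2 * k : ℕ) ∧ Marked s (shiftBy z j) := by
  push_cast at *
  obtain ⟨j, a, hj, hz, ha⟩ := h.dom (i + s + k) (hi _ (by omega) (by omega))
  rw [abs_le] at hj
  refine ⟨j, by omega, by omega, ⟨a, by simpa using hz, ha⟩, fun l hl => ?_⟩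
  rw [abs_le] at hl
  exact hi _ (by omega) (by omega)

theorem IsRegularSeq.marked_sep {n k s : ℕ} (h : IsRegularSeq n k z) {i j : ℤ}
    (hi : Marked s (shiftBy z i)) (hj : Marked s (shiftBy z j)) (hij : i ≠ j) : k < |i - j| := by
  obtain ⟨⟨a, ha, ha'⟩, -⟩ := hi
  obtain ⟨⟨b, hb, hb'⟩, -⟩ := hj
  exact h.indep i j a b (by simpa using ha) (by simpa using hb) ha' hb' hij

end regular

/-! ### Validity of the completed labeling -/

section fill_valid

variable {I O : Type*} [Nonempty I] [Nonempty O] [Finite I] [Finite O]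
  {S : Set (CenteredLabeledGraph I O)} {r : ℕ}
  {L : EffectPair I O r → (Fin (2 * r + 1) → I) → EffectPair I O r → Set (State I O r)} {κ k n : ℕ}
  {z : ℤ → Option (ℕ × I × Prop)} {b : Prop}

/-- Any `D + 1` nodes in a row contain a marked one. So the block at `0` ends on the left at a
marked node, handled by `join`, or at the end of the path, handled by `join_end`, and the radius `2
* D + 2` covers it. -/
theorem windowOK_of_marked_right (hL : IsPatchLabeling S r b L)
    (hκ : κ = Nat.card (EffectPair I O r)) (hz : IsRegularSeq n k z) (hb : ∀ i, z i = none → b)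
    (hk : 2 * r + 1 + 2 * κ ≤ k) {D : ℕ} (hD : D = 2 * (r + κ) + 2 * k)
    (hn : 2 * D + 4 * r + 10 ≤ n) (hm : ∃ m : ℕ, m ≤ D ∧ Marked (r + κ) (shiftBy z m)) :
    WindowOK S r (fun j => (z j).map fun a =>
      (a.2.1, fillOutput S r L κ (2 * D + 2) (shiftBy z j))) := by
  classical
  rcases hz0 : z 0 with _ | b0
  · exact WindowOK.of_center (by simp [hz0])
  have h0 : z 0 ≠ none := by simp [hz0]
  have hsome {m : ℤ} (h : Marked (r + κ) (shiftBy z m)) {i : ℤ} (hi : |i - m| ≤ (r + κ : ℕ)) :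
      z i ≠ none := by
    have := h.2 (i - m) hi
    simpa using this
  have hpatch {i : ℤ} (h : (patchLabel S r L κ (shiftBy z i)).Nonempty) :
      ∃ m, |m - i| ≤ r ∧ Marked (r + κ) (shiftBy z m) := by
    obtain ⟨o, j, hj, hm, -⟩ := h
    exact ⟨i + j, by simpa using hj, by simpa using hm⟩
  have hinj (i j : ℤ) (hij : |i - j| < n) (c d) (hc : z i = some c) (hd : z j = some d)
      (hcd : c.1 = d.1) : i = j := by
    by_contra h
    have := hz.inj i j c d hc hd hcd h
    omega
  have hmk {m : ℤ} (h : Marked (r + κ) (shiftBy z m)) := patch_of_marked hL hκ h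
    (fun i j hi hj => hinj i j (by rw [abs_le] at *; rw [abs_lt]; omega))
    (fun j hj hjm => by
      by_contra hne
      have := hz.marked_sep hjm h hne
      omega)
  obtain ⟨m₂, hm₂, hm₂D, hmin⟩ : ∃ m₂ : ℤ, Marked (r + κ) (shiftBy z m₂) ∧ (0 ≤ m₂ ∧ m₂ ≤ D) ∧
      ∀ i, 0 ≤ i → i < m₂ → ¬ Marked (r + κ) (shiftBy z i) := by
    have h1 := Nat.find_spec hm
    refine ⟨Nat.find hm, h1.2, ⟨by omega, by exact_mod_cast h1.1⟩, fun i hi him hmi => ?_⟩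
    refine Nat.find_min hm (m := i.toNat) (by omega) ⟨by omega, ?_⟩
    rwa [Int.toNat_of_nonneg hi]
  -- The search to the left starts at `-1`, as a mark at `0` already counts as the right end.
  by_cases hl : ∃ m : ℕ, m ≤ D ∧ Marked (r + κ) (shiftBy z (-1 - m))
  · obtain ⟨m₁, hm₁, hm₁D, hmax⟩ : ∃ m₁ : ℤ, Marked (r + κ) (shiftBy z m₁) ∧
        (-1 - D ≤ m₁ ∧ m₁ < 0) ∧ ∀ i, m₁ < i → i < 0 → ¬ Marked (r + κ) (shiftBy z i) := by
      have h1 := Nat.find_spec hl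
      refine ⟨-1 - Nat.find hl, h1.2, ⟨by omega, by omega⟩, fun i hi him hmi => ?_⟩
      refine Nat.find_min hl (m := (-1 - i).toNat) (by omega) ⟨by omega, ?_⟩
      rwa [Int.toNat_of_nonneg (by omega), sub_sub_cancel]
    have hno (i) (h1 : m₁ < i) (h2 : i < m₂) : ¬ Marked (r + κ) (shiftBy z i) := by
      rcases lt_or_ge i 0 with h | h
      · exact hmax i h1 h
      · exact hmin i h h2
    have hsep := hz.marked_sep hm₂ hm₁ (by omega)
    rw [abs_of_pos (by omega)] at hsep
    have hlen : (((m₂ - m₁).toNat : ℕ) : ℤ) = m₂ - m₁ := Int.toNat_of_nonneg (by omega)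
    refine windowOK_block (a := m₁ - r) (k := (m₂ - m₁).toNat) (by omega) (by omega) (by omega)
      (fun i hi => Or.inr ?_) (fun i h1 h2 => ⟨?_, fun hp => ?_⟩)
      (fun i j h1 h2 h3 h4 => hinj i j (by rw [abs_lt]; omega)) (fun l hl1 hl2 i hi => ?_)
      (fun g => ?_)
    · rcases hi with hi | hi
      · exact (hmk hm₁).1 i (by rw [abs_le]; omega)
      · exact (hmk hm₂).1 i (by rw [abs_le]; omega)
    · exact hz.conv m₁ i m₂ (by omega) (by omega) (hsome hm₁ (by simp; omega))
        (hsome hm₂ (by simp; omega))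
    · obtain ⟨m, hm, hmm⟩ := hpatch hp
      rw [abs_le] at hm
      exact hno m (by omega) (by omega) hmm
    · constructor
      · rintro ⟨-, h2⟩
        constructor
        · by_contra hc
          exact h2 m₁ (Or.inr ⟨by omega, by omega⟩) hm₁
        · by_contra hc
          exact h2 m₂ (Or.inl ⟨by omega, by omega⟩) hm₂
      · intro hi
        exact ⟨by rw [abs_le]; push_cast; omega, fun j hj => hno j (by omega) (by omega)⟩
    · have h1 := (hmk hm₁).2 g
      have h2 := (hmk hm₂).2 g
      -- The gap has `m₂ - m₁ - (2 * r + 1)` nodes, of which `κ` on each side belong to the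
      -- contexts; `hk` keeps the contexts disjoint.
      have h3 := hL.join _ _ _ _ _ _ _ h1 _ h2
        (factor (inputs z) (m₁ + r + 1 + κ) (m₂ - m₁ - (2 * r + 1 + 2 * κ)).toNat)
      rw [List.reverse_reverse, ofFn_eq_factor, ← factor_add] at h3
      have e1 : m₂ - r - κ = m₁ + r + 1 + ((κ + (m₂ - m₁ - (2 * r + 1 + 2 * κ)).toNat : ℕ) : ℤ) := by
        push_cast; omega
      rw [e1, ← factor_add] at h3
      have e2 : m₂ - r = m₁ + r + 1 +
          ((κ + (m₂ - m₁ - (2 * r + 1 + 2 * κ)).toNat + κ : ℕ) : ℤ) := by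
        push_cast; omega
      rw [e2, ← factor_add, ← e2] at h3
      convert h3 using 2
      · push_cast; ring
      · omega
      · omega
  · obtain ⟨e, he, heD, hmax⟩ : ∃ e : ℤ, z e = none ∧ (-1 - D ≤ e ∧ e < 0) ∧
        ∀ i, e < i → i < 0 → z i ≠ none := by
      have hex : ∃ m : ℕ, m ≤ D ∧ z (-1 - m) = none := by
        by_contra hcon
        push Not at hcon
        obtain ⟨j, hj1, hj2, hj3⟩ := hz.exists_marked (s := r + κ) (i := -1 - D) fun l h1 h2 => by
          have := hcon (-1 - l).toNat (by omega)
          rwa [Int.toNat_of_nonneg (by omega), sub_sub_cancel] at this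
        refine hl ⟨(-1 - j).toNat, by omega, ?_⟩
        rwa [Int.toNat_of_nonneg (by omega), sub_sub_cancel]
      have h1 := Nat.find_spec hex
      refine ⟨-1 - Nat.find hex, h1.2, ⟨by omega, by omega⟩, fun i hi him hmi => ?_⟩
      refine Nat.find_min hex (m := (-1 - i).toNat) (by omega) ⟨by omega, ?_⟩
      rwa [Int.toNat_of_nonneg (by omega), sub_sub_cancel]
    have hlow (i) (hi : i ≤ e) : z i = none := by
      by_contra hc
      exact hz.conv i e 0 hi (by omega) hc h0 he
    have hno (i) (h2 : i < m₂) : ¬ Marked (r + κ) (shiftBy z i) := by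
      intro hi
      rcases lt_or_ge i 0 with h | h
      · have h3 : e < i := by
          by_contra hc
          exact hsome hi (by simp; omega) (hlow i (by omega))
        refine hl ⟨(-1 - i).toNat, by omega, ?_⟩
        rwa [Int.toNat_of_nonneg (by omega), sub_sub_cancel]
      · exact hmin i h h2 hi
    have hm₂e : e < m₂ - r - κ := by
      by_contra hc
      exact hsome hm₂ (i := m₂ - r - κ) (by rw [abs_le]; push_cast; omega) (hlow _ (by omega))
    -- The first state occupies the `2 * r + 1` positions up to `e`, all of them off the path; the
    -- last one is the patch around `m₂`.
    refine windowOK_block (a := e - 2 * r) (k := (m₂ + r - e).toNat) (by omega) (by omega) (by omega)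
      (fun i hi => ?_) (fun i h1 h2 => ⟨?_, fun hp => ?_⟩)
      (fun i j h1 h2 h3 h4 => hinj i j (by rw [abs_lt]; omega)) (fun l hl1 hl2 i hi => ?_)
      (fun g => ?_)
    · rcases hi with hi | hi
      · exact Or.inl (hlow i (by omega))
      · exact Or.inr ((hmk hm₂).1 i (by rw [abs_le]; omega))
    · rcases lt_or_ge i 0 with h | h
      · exact hmax i (by omega) h
      · exact hz.conv 0 i m₂ h (by omega) h0 (hsome hm₂ (by simp; omega))
    · obtain ⟨m, hm, hmm⟩ := hpatch hp
      rw [abs_le] at hm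
      exact hno m (by omega) hmm
    · have hei : e < i := by
        by_contra hc
        exact hi (hlow i (by omega))
      constructor
      · rintro ⟨-, h2⟩
        refine ⟨by omega, ?_⟩
        by_contra hc
        exact h2 m₂ (Or.inl ⟨by omega, by omega⟩) hm₂
      · intro hi'
        exact ⟨by rw [abs_le]; push_cast; omega, fun j hj => hno j (by omega)⟩
    · have h2 := (hmk hm₂).2 g
      have h3 := hL.join_end (hb e he) _ _ _ _ h2
        (factor (inputs z) (e + 1) (m₂ - e - r - κ - 1).toNat)
      rw [List.reverse_reverse, ofFn_eq_factor] at h3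
      have e1 : m₂ - r - κ = e + 1 + (((m₂ - e - r - κ - 1).toNat : ℕ) : ℤ) := by omega
      rw [e1, ← factor_add] at h3
      have e2 : m₂ - r = e + 1 + (((m₂ - e - r - κ - 1).toNat + κ : ℕ) : ℤ) := by
        push_cast; omega
      rw [e2, ← factor_add, ← e2] at h3
      convert h3 using 2
      · rename_i j
        have : z (e - 2 * r + (j : ℕ)) = none := hlow _ (by have := j.2; omega)
        simp [labelsAt, nodeLabel, this]
      · push_cast; ring
      · omega
      · omega

/-- The rule labels all nodes correctly. -/
theorem windowOK_fillOutput (hL : IsPatchLabeling S r b L)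
    (hκ : κ = Nat.card (EffectPair I O r)) (hz : IsRegularSeq n k z) (hb : ∀ i, z i = none → b)
    (hk : 2 * r + 1 + 2 * κ ≤ k) {D : ℕ} (hD : D = 2 * (r + κ) + 2 * k)
    (hn : 2 * D + 4 * r + 10 ≤ n) (p : ℤ) :
    WindowOK S r (fun j => (z (p + j)).map fun a =>
      (a.2.1, fillOutput S r L κ (2 * D + 2) (shiftBy z (p + j)))) := by
  suffices h : ∀ z : ℤ → Option (ℕ × I × Prop), IsRegularSeq n k z → (∀ i, z i = none → b) →
      WindowOK S r (fun j => (z j).map fun a =>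
        (a.2.1, fillOutput S r L κ (2 * D + 2) (shiftBy z j))) by
    have := h (shiftBy z p) (hz.shift p) fun i hi => hb (p + i) hi
    simpa only [shiftBy_shiftBy, shiftBy_apply] using this
  intro z hz hb
  by_cases hr : ∃ m : ℕ, m ≤ D ∧ Marked (r + κ) (shiftBy z m)
  · exact windowOK_of_marked_right hL hκ hz hb hk hD hn hr
  rcases hz0 : z 0 with _ | b0
  · exact WindowOK.of_center (by simp [hz0])
  have h0 : z 0 ≠ none := by simp [hz0]
  -- Without a mark within reach on the right, the path ends there. Being long, it does not end
  -- nearby on the left as well, so the reflected sequence has a mark on its right.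
  have hex : ∃ c : ℤ, 0 < c ∧ c ≤ D ∧ z c = none := by
    by_contra hcon
    push Not at hcon
    obtain ⟨j, hj1, hj2, hj3⟩ := hz.exists_marked (s := r + κ) (i := 0) fun l h1 h2 => by
      rcases h1.eq_or_lt with rfl | h1
      · exact h0
      · exact hcon l h1 (by omega)
    exact hr ⟨j.toNat, by omega, by rwa [Int.toNat_of_nonneg hj1]⟩
  obtain ⟨c, hc0, hcD, hc⟩ := hex
  have hleft : ∃ m : ℕ, m ≤ D ∧ Marked (r + κ) (shiftBy (fun i => z (-i)) m) := by
    obtain ⟨j, hj1, hj2, hj3⟩ := hz.neg.exists_marked (s := r + κ) (i := 0) fun l h1 h2 hcon => by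
      rcases h1.eq_or_lt with rfl | h1
      · exact h0 (by simpa using hcon)
      · have := hz.long (-l) 0 c (by omega) hc0 hcon h0 hc
        omega
    exact ⟨j.toNat, by omega, by rwa [Int.toNat_of_nonneg hj1]⟩
  refine (windowOK_congr fun j hj => ?_).1
    (windowOK_of_marked_right hL hκ hz.neg (fun i hi => hb _ hi) hk hD hn hleft).neg
  rw [shiftBy_neg, neg_neg, (isRule_fillOutput hL).2]

end fill_valid

/-! ### Coloring with few colors -/

/-- A power of a logarithm is eventually below the identity; this is what makes two rounds of color
reduction as good as one logarithm. -/
theorem exists_forall_pow_clog_le (A E : ℕ) :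
    ∃ s₀, ∀ s ≥ s₀, (A * (Nat.clog 2 (A * (s + 1)) + 1)) ^ E ≤ s := by
  rcases Nat.eq_zero_or_pos A with rfl | hA
  · exact ⟨1, fun s hs => by
      rw [Nat.zero_mul]
      exact (pow_le_one₀ (Nat.zero_le _) (Nat.zero_le _)).trans hs⟩
  have hlim := tendsto_pow_const_div_const_pow_of_one_lt E (r := (2 : ℝ)) (by norm_num)
  set K : ℕ := A * ((2 * A) ^ E + 1) with hK
  have hKpos : 0 < K := by positivity
  obtain ⟨c₀, hc₀⟩ := eventually_atTop.1
    (hlim.eventually (ge_mem_nhds (show (0 : ℝ) < 1 / (2 * K) by positivity)))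
  refine ⟨2 ^ (c₀ + 1), fun s hs => ?_⟩
  set c := Nat.clog 2 (A * (s + 1)) with hc
  have hs1 : 2 ^ (c₀ + 1) ≤ A * (s + 1) := by nlinarith
  have hcc : c₀ + 1 ≤ c := by
    have := Nat.clog_mono_right 2 hs1
    rwa [Nat.clog_pow _ _ (by norm_num)] at this
  have h1 : 2 ^ c < 2 * (A * (s + 1)) := by
    have h2 : 1 < A * (s + 1) := lt_of_lt_of_le (Nat.one_lt_two_pow (by omega)) hs1
    have h3 := Nat.pow_pred_clog_lt_self (b := 2) (by norm_num) h2
    obtain ⟨d, hd⟩ : ∃ d, c = d + 1 := ⟨c - 1, by omega⟩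
    rw [← hc, hd, Nat.pred_succ] at h3
    rw [hd, pow_succ]
    omega
  have h2 : 2 * (K * c ^ E) ≤ 2 ^ c := by
    have h3 := hc₀ c (by omega)
    rw [div_le_div_iff₀ (by positivity) (by positivity)] at h3
    have : ((2 * (K * c ^ E) : ℕ) : ℝ) ≤ ((2 ^ c : ℕ) : ℝ) := by
      push_cast
      linarith
    exact_mod_cast this
  have h4 : A * ((A * (c + 1)) ^ E + 1) ≤ K * c ^ E := by
    rw [hK, mul_assoc, add_mul, one_mul, ← mul_pow]
    refine Nat.mul_le_mul_left _ (Nat.add_le_add (Nat.pow_le_pow_left ?_ _)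
      (Nat.one_le_pow _ _ (by omega)))
    rw [mul_assoc, mul_left_comm]
    exact Nat.mul_le_mul_left _ (by omega)
  have h5 : A * ((A * (c + 1)) ^ E + 1) < A * (s + 1) := by omega
  have := Nat.lt_of_mul_lt_mul_left h5
  omega

/-- Positions at distance at most `k` have different colors. -/
def IsProper (k : ℕ) (z : ℤ → Option ℕ) : Prop :=
  ∀ i j : ℤ, i ≠ j → |i - j| ≤ (k : ℤ) → ∀ a, z i = some a → z j ≠ some a

/-- A position where two numbers have different bits. -/
noncomputable def diffBit (a b : ℕ) : ℕ := sInf {i | a.testBit i ≠ b.testBit i}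

theorem testBit_diffBit {a b : ℕ} (h : a ≠ b) :
    a.testBit (diffBit a b) ≠ b.testBit (diffBit a b) := by
  have : {i | a.testBit i ≠ b.testBit i}.Nonempty := by
    by_contra hc
    rw [Set.not_nonempty_iff_eq_empty, Set.eq_empty_iff_forall_notMem] at hc
    exact h (Nat.eq_of_testBit_eq fun i => not_not.1 (hc i))
  exact Nat.sInf_mem this

theorem diffBit_lt {a b s : ℕ} (ha : a < 2 ^ s) (hb : b < 2 ^ s) (h : a ≠ b) : diffBit a b < s := by
  by_contra hc
  have hs : 2 ^ s ≤ 2 ^ diffBit a b := Nat.pow_le_pow_right (by norm_num) (by omega)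
  apply testBit_diffBit h
  rw [Nat.testBit_lt_two_pow (ha.trans_le hs), Nat.testBit_lt_two_pow (hb.trans_le hs)]

/-- The bits of the color of `0` that distinguish it from the colors around. -/
def bitSet (k : ℕ) (z : ℤ → Option ℕ) : Set (ℕ × Bool) :=
  {t | ∃ j : ℤ, |j| ≤ k ∧ ∃ a b, z 0 = some a ∧ z j = some b ∧ a ≠ b ∧ t.1 = diffBit a b ∧
    t.2 = a.testBit t.1}

theorem isRule_bitSet (k : ℕ) : IsRule k (bitSet k) := by
  constructor
  · intro z z' h
    ext t
    refine exists_congr fun j => and_congr_right fun hj => ?_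
    rw [h j hj, h 0 (by simp)]
  · intro z
    ext t
    constructor <;> rintro ⟨j, hj, a, b, ha, hb, h⟩
    · exact ⟨-j, by simpa using hj, a, b, by simpa using ha, hb, h⟩
    · exact ⟨-j, by simpa using hj, a, b, by simpa using ha, by simpa using hb, h⟩

/-- The set of `i` contains a bit position where `a` and `b` differ, together with the bit of `a`.
In the set of `j` each position comes with the bit of `b`. Using sets makes an orientation
unnecessary. -/
theorem bitSet_ne {k : ℕ} {z : ℤ → Option ℕ} (hz : IsProper k z) {i j : ℤ} (hij : i ≠ j)
    (hk : |i - j| ≤ k) {a b : ℕ} (ha : z i = some a) (hb : z j = some b) :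
    bitSet k (shiftBy z i) ≠ bitSet k (shiftBy z j) := by
  have hab : a ≠ b := fun h => hz i j hij hk a ha (h ▸ hb)
  intro h
  have h1 : (diffBit a b, a.testBit (diffBit a b)) ∈ bitSet k (shiftBy z i) :=
    ⟨j - i, by rwa [abs_sub_comm], a, b, by simpa using ha, by simpa using hb, hab, rfl, rfl⟩
  rw [h] at h1
  obtain ⟨l, -, b', d, hb', hd, hbd, h2, h3⟩ := h1
  rw [shiftBy_apply, add_zero, hb, Option.some_inj] at hb'
  subst hb'
  exact testBit_diffBit hab h3

/-- Each of the `2 * k + 1` positions in the window contributes nothing or one of `2 * s` pairs of a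
bit position and a bit. -/
theorem exists_encoding (k s : ℕ) : ∃ enc : Set (ℕ × Bool) → ℕ,
    (∀ T, enc T < (2 * s + 1) ^ (2 * k + 1)) ∧
    ∀ z z' : ℤ → Option ℕ, (∀ i a, z i = some a → a < 2 ^ s) → (∀ i a, z' i = some a → a < 2 ^ s) →
      enc (bitSet k z) = enc (bitSet k z') → bitSet k z = bitSet k z' := by
  classical
  let J := Finset.Icc (-k : ℤ) k
  let decode (f : J → Option (Fin s × Bool)) : Set (ℕ × Bool) :=
    {t | ∃ j u, f j = some u ∧ t.1 = u.1 ∧ t.2 = u.2}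
  have hcard : Fintype.card (J → Option (Fin s × Bool)) = (2 * s + 1) ^ (2 * k + 1) := by
    simp [J]
    congr 1
    · ring
    · omega
  have hdec (z : ℤ → Option ℕ) (hz : ∀ i a, z i = some a → a < 2 ^ s) :
      ∃ f, decode f = bitSet k z := by
    refine ⟨fun j => if h : ∃ u : Fin s × Bool, ∃ a b, z 0 = some a ∧ z j = some b ∧ a ≠ b ∧
      (u.1 : ℕ) = diffBit a b ∧ u.2 = a.testBit u.1 then some h.choose else none, ?_⟩
    ext t
    constructor
    · rintro ⟨j, u, hu, h1, h2⟩
      beta_reduce at hu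
      split_ifs at hu with h
      obtain ⟨a, b, ha, hb, hab, h3, h4⟩ := h.choose_spec
      rw [Option.some_inj] at hu
      rw [hu] at h3 h4
      exact ⟨j, abs_le.2 (Finset.mem_Icc.1 j.2), a, b, ha, hb, hab, h1.trans h3, by rw [h2, h4, h1]⟩
    · rintro ⟨j, hj, a, b, ha, hb, hab, h1, h2⟩
      have h : ∃ u : Fin s × Bool, ∃ a b, z 0 = some a ∧ z j = some b ∧ a ≠ b ∧
          (u.1 : ℕ) = diffBit a b ∧ u.2 = a.testBit u.1 :=
        ⟨(⟨diffBit a b, diffBit_lt (hz _ _ ha) (hz _ _ hb) hab⟩, a.testBit (diffBit a b)),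
          a, b, ha, hb, hab, rfl, rfl⟩
      refine ⟨⟨j, Finset.mem_Icc.2 (abs_le.1 hj)⟩, h.choose, dif_pos h, ?_⟩
      obtain ⟨a', b', ha', hb', -, h3, h4⟩ := h.choose_spec
      rw [ha, Option.some_inj] at ha'
      rw [hb, Option.some_inj] at hb'
      subst ha' hb'
      exact ⟨h1.trans h3.symm, by rw [h4, h2, h1, h3]⟩
  refine ⟨fun T => if h : ∃ f, decode f = T then
    (Fintype.equivFinOfCardEq hcard h.choose : ℕ) else 0, fun T => ?_, fun z z' hz hz' h => ?_⟩
  · beta_reduce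
    split_ifs with h
    · exact Fin.is_lt _
    · positivity
  · have h1 := hdec z hz
    have h2 := hdec z' hz'
    beta_reduce at h
    rw [dif_pos h1, dif_pos h2, Fin.val_inj, Equiv.apply_eq_iff_eq] at h
    rw [← h1.choose_spec, ← h2.choose_spec, h]

/-- Some rule of radius `ρ` turns locally distinct colors below `m` into such colors below `q`. -/
def ColorReducible (q k m ρ : ℕ) : Prop :=
  ∃ Y : (ℤ → Option ℕ) → ℕ, IsRule ρ Y ∧ (∀ z, Y z < q) ∧
    ∀ z, (∀ i a, z i = some a → a < m) → IsProper k z →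
      IsProper k fun i => (z i).map fun _ => Y (shiftBy z i)

theorem ColorReducible.mono {q k m m' ρ ρ' : ℕ} (h : ColorReducible q k m ρ) (hm : m' ≤ m)
    (hρ : ρ ≤ ρ') : ColorReducible q k m' ρ' := by
  obtain ⟨Y, h1, h2, h3⟩ := h
  exact ⟨Y, h1.mono hρ, h2, fun z hz => h3 z fun i a ha => (hz i a ha).trans_le hm⟩

theorem colorReducible_self {q k : ℕ} (hq : 0 < q) : ColorReducible q k q 0 := by
  refine ⟨fun z => if (z 0).getD 0 < q then (z 0).getD 0 else 0, ⟨fun z z' h => ?_, fun z => ?_⟩,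
    fun z => ?_, fun z hz hp => ?_⟩
  · beta_reduce
    rw [h 0 (by simp)]
  · simp
  · beta_reduce
    split_ifs with h
    · exact h
    · exact hq
  · convert hp using 1
    funext i
    rcases hi : z i with _ | a
    · rfl
    · simp [hi, hz i a hi]

theorem ColorReducible.step {q k s ρ : ℕ}
    (h : ColorReducible q k ((2 * s + 1) ^ (2 * k + 1)) ρ) :
    ColorReducible q k (2 ^ s) (ρ + k) := by
  obtain ⟨Y, h1, h2, h3⟩ := h
  obtain ⟨enc, he, henc⟩ := exists_encoding k s
  refine ⟨_, h1.comp (isRule_bitSet k) (fun _ T => enc T), fun z => h2 _, fun z hz hp => ?_⟩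
  have := h3 (fun i => (z i).map fun _ => enc (bitSet k (shiftBy z i))) ?_ ?_
  · convert this using 1
    funext i
    rcases hi : z i with _ | a
    · rfl
    · simp only [Option.map_some, Option.some_inj]
      congr 1
      funext j
      rw [shiftBy_apply, shiftBy_shiftBy]; rfl
  · intro i a ha
    obtain ⟨_, -, rfl⟩ := Option.map_eq_some_iff.1 ha
    exact he _
  · intro i j hij hk a ha hb
    obtain ⟨c, hc, hca⟩ := Option.map_eq_some_iff.1 ha
    obtain ⟨d, hd, hda⟩ := Option.map_eq_some_iff.1 hb
    exact bitSet_ne hp hij hk hc hd (henc _ _ (fun l => hz (i + l)) (fun l => hz (j + l))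
      (hca.trans hda.symm))

/-- The first round leaves a power of `s`, which may exceed `l`; the second leaves a power of a
logarithm of `l`, which `hl` bounds by `l`. -/
theorem ColorReducible.two_steps {q k s l m A ρ : ℕ} (h : ColorReducible q k l ρ) (hm : m ≤ 2 ^ s)
    (hA : 4 * k + 2 ≤ A) (hs : 2 * s + 1 ≤ A * (l + 1))
    (hl : (A * (Nat.clog 2 (A * (l + 1)) + 1)) ^ (2 * k + 1) ≤ l) :
    ColorReducible q k m (ρ + 2 * k) := by
  set c := Nat.clog 2 (A * (l + 1))
  have h1 : ColorReducible q k ((2 * ((2 * k + 1) * c) + 1) ^ (2 * k + 1)) ρ := by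
    refine h.mono ((Nat.pow_le_pow_left ?_ _).trans hl) le_rfl
    nlinarith
  have h2 : (2 * s + 1) ^ (2 * k + 1) ≤ 2 ^ ((2 * k + 1) * c) := by
    rw [mul_comm (2 * k + 1) c, pow_mul]
    exact Nat.pow_le_pow_left (hs.trans (Nat.le_pow_clog (b := 2) (by norm_num) _)) _
  exact (h1.step.mono h2 le_rfl).step.mono hm (by omega)

theorem logStar_of_one_lt {n : ℕ} (hn : 1 < n) : logStar n = 1 + logStar (Nat.clog 2 n) := by
  rw [logStar, if_neg (by omega)]

/-- Two rounds replace `m` by its logarithm, as in the recursion of `logStar`, and cost radius `2 *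
k`. -/
theorem exists_colorReducible (k : ℕ) :
    ∃ q, 0 < q ∧ ∀ m, ColorReducible q k m (2 * k * logStar m) := by
  obtain ⟨s₀, hs₀⟩ := exists_forall_pow_clog_le (4 * k + 2) (2 * k + 1)
  refine ⟨2 ^ s₀ + 1, by positivity, fun m => ?_⟩
  induction m using Nat.strong_induction_on with
  | _ m ih =>
    rcases le_or_gt m (2 ^ s₀ + 1) with hm | hm
    · exact (colorReducible_self (by positivity)).mono hm (Nat.zero_le _)
    · have hm1 : 1 < m := by have := Nat.one_le_two_pow (n := s₀); omega
      have hl : s₀ ≤ Nat.clog 2 m := by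
        have := Nat.clog_mono_right 2 (show 2 ^ s₀ ≤ m by omega)
        rwa [Nat.clog_pow _ _ (by norm_num)] at this
      have := (ih _ (clog_two_lt (by omega))).two_steps (Nat.le_pow_clog (by norm_num) m) le_rfl
        (by nlinarith) (hs₀ _ hl)
      rw [logStar_of_one_lt hm1]
      exact this.mono le_rfl (by ring_nf; rfl)

/-- Distinct names from a polynomial range can be turned into a bounded number of colors. -/
theorem exists_colorReducible_names (k c : ℕ) :
    ∃ q n₀, ∀ n ≥ n₀, ColorReducible q k (n ^ c + 1) (2 * k * logStar n) := by
  obtain ⟨q, -, hq⟩ := exists_colorReducible k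
  obtain ⟨s₀, hs₀⟩ := exists_forall_pow_clog_le (4 * k + 2 * c + 3) (2 * k + 1)
  refine ⟨q, 2 ^ s₀ + 2, fun n hn => ?_⟩
  have hl : s₀ ≤ Nat.clog 2 n := by
    have := Nat.clog_mono_right 2 (show 2 ^ s₀ ≤ n by omega)
    rwa [Nat.clog_pow _ _ (by norm_num)] at this
  have h1 : n ^ c + 1 ≤ 2 ^ (c * Nat.clog 2 n + 1) := by
    have h2 : n ^ c ≤ 2 ^ (c * Nat.clog 2 n) := by
      rw [mul_comm, pow_mul]
      exact Nat.pow_le_pow_left (Nat.le_pow_clog (by norm_num) n) c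
    have := Nat.one_le_two_pow (n := c * Nat.clog 2 n)
    rw [pow_succ]
    omega
  -- The exponent `c` only affects the constant `A`, so polynomially many names cost no extra
  -- rounds.
  have := (hq (Nat.clog 2 n)).two_steps h1 (A := 4 * k + 2 * c + 3) (by omega) (by nlinarith)
    (hs₀ _ hl)
  rw [logStar_of_one_lt (show 1 < n by have := Nat.one_le_two_pow (n := s₀); omega)]
  exact this.mono le_rfl (by ring_nf; rfl)

/-! ### Maximal sets of far apart nodes -/

/-- The position `0` is chosen when the color classes below `t` are added greedily. -/
def Chosen (k : ℕ) : ℕ → (ℤ → Option ℕ) → Prop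
  | 0, _ => False
  | t + 1, z => Chosen k t z ∨ z 0 = some t ∧ ∀ j : ℤ, |j| ≤ k → ¬ Chosen k t (shiftBy z j)

theorem isRule_chosen (k t : ℕ) : IsRule (k * t) (Chosen k t) := by
  induction t with
  | zero => exact ⟨fun _ _ _ => rfl, fun _ => rfl⟩
  | succ t ih =>
    constructor
    · intro z z' h
      rw [Chosen, Chosen, ih.1 z z' fun i hi => h i (hi.trans (by push_cast; nlinarith)),
        h 0 (by simp only [abs_zero]; positivity)]
      refine congrArg (_ ∨ _ ∧ ·) (propext (forall_congr' fun j => forall_congr' fun hj => ?_))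
      rw [ih.1 _ _ (shiftBy_agree h (j := j) (by push_cast at *; linarith))]
    · intro z
      rw [Chosen, Chosen, ih.2, neg_zero]
      refine congrArg (_ ∨ _ ∧ ·) (propext ⟨fun h j hj => ?_, fun h j hj => ?_⟩)
      · have := h (-j) (by simpa using hj)
        rwa [shiftBy_neg, ih.2, neg_neg] at this
      · rw [shiftBy_neg, ih.2]
        exact h (-j) (by simpa using hj)

theorem chosen_mono {k t t' : ℕ} (h : t ≤ t') {z : ℤ → Option ℕ} (hz : Chosen k t z) :
    Chosen k t' z := by
  induction h with
  | refl => exact hz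
  | step _ ih => exact Or.inl ih

/-- A position added later avoids those chosen before, and two positions added in the same round
share a color. -/
theorem chosen_indep {k t : ℕ} {z : ℤ → Option ℕ} (hz : IsProper k z) {i j : ℤ}
    (hi : Chosen k t (shiftBy z i)) (hj : Chosen k t (shiftBy z j)) (hij : i ≠ j) :
    k < |i - j| := by
  induction t with
  | zero => exact hi.elim
  | succ t ih =>
    by_contra hk
    rcases hi with hi | ⟨hi, hi'⟩ <;> rcases hj with hj | ⟨hj, hj'⟩
    · exact hk (ih hi hj)
    · refine hj' (i - j) (by omega) ?_
      rwa [shiftBy_shiftBy, add_sub_cancel]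
    · refine hi' (j - i) (by rw [abs_sub_comm]; omega) ?_
      rwa [shiftBy_shiftBy, add_sub_cancel]
    · exact hz i j hij (by omega) t (by simpa using hi) (by simpa using hj)

theorem exists_chosen {k q : ℕ} {z : ℤ → Option ℕ} {i : ℤ} {a : ℕ} (hi : z i = some a)
    (ha : a < q) : ∃ j, |j - i| ≤ k ∧ Chosen k q (shiftBy z j) := by
  by_cases h : ∃ j : ℤ, |j| ≤ k ∧ Chosen k a (shiftBy (shiftBy z i) j)
  · obtain ⟨j, hj, hc⟩ := h
    exact ⟨i + j, by simpa using hj, chosen_mono ha.le (by simpa using hc)⟩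
  · push Not at h
    exact ⟨i, by simp, chosen_mono (show a + 1 ≤ q from ha) (Or.inr ⟨by simpa using hi, h⟩)⟩

theorem chosen_isSome {k t : ℕ} {z : ℤ → Option ℕ} (h : Chosen k t z) : z 0 ≠ none := by
  induction t with
  | zero => exact h.elim
  | succ t ih =>
    rcases h with h | ⟨h, -⟩
    · exact ih h
    · simp [h]

/-! ### Solving problems in the LOCAL model -/

/-- By convexity all `n` nodes have their positions strictly between the two ends. -/
theorem IsChart.lt_of_none {n : ℕ} {G : SimpleGraph (Fin n)} {ψ : ℤ → Option (Fin n)}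
    (h : IsChart G ψ) {a c b : ℤ} (hac : a < c) (hcb : c < b) (ha : ψ a = none) (hc : ψ c ≠ none)
    (hb : ψ b = none) : n < b - a := by
  choose f hf using h.surj
  have hmem (v) : f v ∈ Finset.Ioo a b := by
    have hv : ψ (f v) ≠ none := by simp [hf]
    rw [Finset.mem_Ioo]
    constructor
    · by_contra hlt
      exact h.conv (f v) a c (by omega) (by omega) hv hc ha
    · by_contra hlt
      exact h.conv c b (f v) (by omega) (by omega) hc hv hb
  have hinj : Function.Injective f := fun v w hvw =>
    Option.some_injective _ (by rw [← hf, ← hf, hvw])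
  have := Finset.card_le_card_of_injOn f (s := Finset.univ) (fun v _ => hmem v) hinj.injOn
  simp at this
  omega

theorem IsChart.isRegularSeq {I : Type*} {n k : ℕ} {G : SimpleGraph (Fin n)}
    {ψ : ℤ → Option (Fin n)} (h : IsChart G ψ) (ident : Fin n ↪ ℕ) (x : Fin n → I) (m : ℤ → Prop)
    (hindep : ∀ i j : ℤ, ψ i ≠ none → ψ j ≠ none → m i → m j → i ≠ j → (k : ℤ) < |i - j|)
    (hdom : ∀ i, ψ i ≠ none → ∃ j, |j - i| ≤ (k : ℤ) ∧ ψ j ≠ none ∧ m j) :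
    IsRegularSeq n k (fun i => (ψ i).map fun v => (ident v, x v, m i)) where
  inj i j a b hi hj hab hij := by
    obtain ⟨v, hv, rfl⟩ := Option.map_eq_some_iff.1 hi
    obtain ⟨w, hw, rfl⟩ := Option.map_eq_some_iff.1 hj
    obtain rfl := ident.injective hab
    exact h.sep i j v hv hw hij
  conv i j l hij hjl hi hl := by
    simp only [ne_eq, Option.map_eq_none_iff] at *
    exact h.conv i j l hij hjl hi hl
  long a c b hac hcb ha hc hb := by
    simp only [ne_eq, Option.map_eq_none_iff] at *
    exact h.lt_of_none hac hcb ha hc hb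
  indep i j a b hi hj ha hb hij := by
    obtain ⟨v, hv, rfl⟩ := Option.map_eq_some_iff.1 hi
    obtain ⟨w, hw, rfl⟩ := Option.map_eq_some_iff.1 hj
    exact hindep i j (by simp [hv]) (by simp [hw]) ha hb hij
  dom i hi := by
    simp only [ne_eq, Option.map_eq_none_iff] at hi
    obtain ⟨j, hj, hj', hm⟩ := hdom i hi
    obtain ⟨v, hv⟩ := Option.ne_none_iff_exists'.1 hj'
    exact ⟨j, _, hj, by rw [hv]; rfl, hm⟩

theorem IsRule.map {α β γ : Type*} {ρ : ℕ} {Y : (ℤ → Option β) → γ} (h : IsRule ρ Y) (f : α → β) :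
    IsRule ρ (fun z => Y fun i => (z i).map f) := by
  refine ⟨fun z z' hz => h.1 _ _ fun i hi => by rw [hz i hi], fun z => ?_⟩
  exact h.2 fun i => (z i).map f

section localView

variable {I O : Type*} {n : ℕ}

theorem localView_adj {t s : ℕ} {G : SimpleGraph (Fin n)} {x : Fin n → I} {ident : Fin n ↪ ℕ}
    {v a : Fin n} (hs : s < t) (ha : a ∈ nbhd G s v) :
    ident '' G.neighborSet a = {b | (localView t G x ident v).graph.Adj (ident a) b} := by
  ext b
  simp only [localView, Set.mem_image, SimpleGraph.mem_neighborSet, Set.mem_ofPred_eq]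
  rw [SimpleGraph.map_adj]
  simp only [spanningCoe_induce_adj]
  constructor
  · rintro ⟨w, hw, rfl⟩
    exact ⟨a, w, ⟨hw, nbhd_mono hs.le v ha, nbhd_mono hs v (mem_nbhd_succ.2 (Or.inr ⟨a, ha, hw⟩))⟩,
      rfl, rfl⟩
  · rintro ⟨a', w, ⟨hw, -⟩, haa, rfl⟩
    obtain rfl := ident.injective haa
    exact ⟨w, hw, rfl⟩

theorem localView_input {t : ℕ} {G : SimpleGraph (Fin n)} {x : Fin n → I} {ident : Fin n ↪ ℕ}
    {v a : Fin n} (ha : a ∈ nbhd G t v) :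
    (localView t G x ident v).input (ident a) = some (x a) := by
  simp only [localView]
  rw [ident.injective.extend_apply, restrictInput, if_pos ha]

/-- Nodes with equal views have equal windows in their charts, up to reversal. -/
theorem window_of_localView {n' : ℕ} (hn : 3 ≤ n) (hn' : 3 ≤ n') {t : ℕ} {G : SimpleGraph (Fin n)}
    {G' : SimpleGraph (Fin n')} {ψ ψ'} (h : IsChart G ψ) (h' : IsChart G' ψ') {x : Fin n → I}
    {x' : Fin n' → I} {ident : Fin n ↪ ℕ} {ident' : Fin n' ↪ ℕ} {v v' p p'} (hp : ψ p = some v)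
    (hp' : ψ' p' = some v') (hview : localView t G x ident v = localView t G' x' ident' v') :
    (∀ i : ℤ, |i| ≤ t → (ψ (p + i)).map (fun v => (ident v, x v)) =
      (ψ' (p' + i)).map fun v => (ident' v, x' v)) ∨
    (∀ i : ℤ, |i| ≤ t → (ψ (p + i)).map (fun v => (ident v, x v)) =
      (ψ' (p' - i)).map fun v => (ident' v, x' v)) := by
  have key (i j : ℤ) (hi : |i| ≤ t) (hj : |j| ≤ t)
      (hij : (ψ (p + i)).map ident = (ψ' (p' + j)).map ident') :
      (ψ (p + i)).map (fun v => (ident v, x v)) =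
        (ψ' (p' + j)).map fun v => (ident' v, x' v) := by
    rcases ha : ψ (p + i) with _ | a <;> rcases hb : ψ' (p' + j) with _ | b <;>
      simp only [ha, hb, Option.map_some, Option.map_none, reduceCtorEq, Option.some_inj] at hij ⊢
    refine Prod.ext hij ?_
    have h1 := localView_input (x := x) (ident := ident) ((h.mem_nbhd_iff hp).2 ⟨i, hi, ha⟩)
    have h2 := localView_input (x := x') (ident := ident') ((h'.mem_nbhd_iff hp').2 ⟨j, hj, hb⟩)
    rw [hview, hij, h2, Option.some_inj] at h1
    exact h1.symm
  rcases window_eq_or_reverse hn hn' h h' ident ident' hp hp' (congrArg LocalView.center hview)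
    (t := t) (fun s hs a ha a' ha' haa => by
      rw [localView_adj (x := x) hs ha, localView_adj (x := x') hs ha', hview, haa]) with h1 | h1
  · exact Or.inl fun i hi => key i i hi hi (h1 i hi)
  · exact Or.inr fun i hi => key i (-i) hi (by rwa [abs_neg]) (h1 i hi)

/-- A view determines the chart around its center up to reversal, which rules ignore. So the
algorithm may evaluate the rule in any instance that has the given view. -/
theorem localSolvable_of_rule [Nonempty O] {P : LabelingProblem I O} {F : GraphFamily} {c ρ : ℕ}
    (hn : 3 ≤ n) {Y : (ℤ → Option (ℕ × I)) → O} (hY : IsRule ρ Y)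
    (hsol : ∀ G ∈ F n, ∃ ψ, IsChart G ψ ∧ ∀ (x : Fin n → I) (ident : Fin n ↪ ℕ),
      (∀ v, 1 ≤ ident v ∧ ident v ≤ n ^ c) → ∀ y : Fin n → O,
      (∀ p v, ψ p = some v → y v = Y fun i => (ψ (p + i)).map fun v => (ident v, x v)) →
      y ∈ P.sol G x) : P.LocalSolvable F c n ρ := by
  let A (view : LocalView I) : Set O := {o | ∃ (G : SimpleGraph (Fin n)) (ψ : ℤ → Option (Fin n))
    (x : Fin n → I) (ident : Fin n ↪ ℕ) (p : ℤ) (v : Fin n), IsChart G ψ ∧ ψ p = some v ∧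
    localView ρ G x ident v = view ∧ o = Y fun i => (ψ (p + i)).map fun v => (ident v, x v)}
  refine ⟨fun view => pick (A view), fun G hG x ident hident => ?_⟩
  obtain ⟨ψ, hψ, h⟩ := hsol G hG
  refine h x ident hident _ fun p v hp => ?_
  obtain ⟨G', ψ', x', ident', p', v', hψ', hp', hview, ho⟩ :=
    pick_mem (s := A (localView ρ G x ident v)) ⟨_, G, ψ, x, ident, p, v, hψ, hp, rfl, rfl⟩
  refine ho.trans ?_
  rcases window_of_localView hn hn hψ' hψ hp' hp hview with h1 | h1
  · exact hY.1 _ _ h1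
  · refine (hY.1 _ _ h1).trans ?_
    simpa only [sub_neg_eq_add] using (hY.2 fun i => (ψ (p - i)).map fun v => (ident v, x v)).symm

end localView

theorem IsPatchLabeling.exists_localSolvable {I O : Type*} [Finite I] [Finite O] [Nonempty I]
    [Nonempty O] {P : LabelingProblem I O} {S : Set (CenteredLabeledGraph I O)} {r Δ : ℕ}
    (hΔ : 2 ≤ Δ) (hS : ∀ (n : ℕ) (G : SimpleGraph (Fin n)) (x : Fin n → I), DegreeAtMost G Δ →
      ∀ y : Fin n → O, y ∈ P.sol G x ↔ ∀ v, ∃ H ∈ S, NbhdIso G x y r v H)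
    {F : GraphFamily} (hF : F = paths ∨ F = cycles ∨ F = pathsAndCycles) {L}
    (hL : IsPatchLabeling S r (F ≠ cycles) L) (c : ℕ) :
    ∃ C n₀, ∀ n ≥ n₀, P.LocalSolvable F c n (C * logStar n + C) := by
  set κ := Nat.card (EffectPair I O r) with hκ
  set k := 2 * r + 1 + 2 * κ with hk
  set D := 2 * (r + κ) + 2 * k with hD
  obtain ⟨q, n₀, hq⟩ := exists_colorReducible_names k c
  refine ⟨(2 * D + 2) + 3 * r + κ + k * q + 2 * k, n₀ + (2 * D + 4 * r + 10), fun n hn => ?_⟩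
  obtain ⟨Yc, hYc, hYq, hYp⟩ := hq n (by omega)
  have hM : IsRule (k * q + 2 * k * logStar n) (fun z : ℤ → Option (ℕ × I) =>
      Chosen k q fun i => (z i).map fun _ => Yc fun j => (shiftBy z i j).map Prod.fst) :=
    (isRule_chosen k q).comp (hYc.map Prod.fst) fun _ a => a
  have hrule := (isRule_fillOutput (κ := κ) (B := 2 * D + 2) hL).comp hM
    fun (a : ℕ × I) m => (a.1, a.2, m)
  refine localSolvable_of_rule (by omega) (hrule.mono (by
    have h1 : 2 * k * logStar n ≤ ((2 * D + 2) + 3 * r + κ + k * q + 2 * k) * logStar n :=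
      Nat.mul_le_mul_right _ (by omega)
    omega)) fun G hG => ?_
  obtain ⟨ψ, hψ, hFψ⟩ := exists_chart hF hG
  refine ⟨ψ, hψ, fun x ident hident y hy => ?_⟩
  set zc : ℤ → Option ℕ := fun i => (ψ i).map fun _ => Yc fun j => (ψ (i + j)).map ident with hzc
  set m : ℤ → Prop := fun i => Chosen k q (shiftBy zc i) with hm
  have hproper : IsProper k zc := by
    have := hYp (fun i => (ψ i).map ident) (fun i a ha => ?_) fun i j hij hijk a ha hb => ?_
    · convert this using 1
      funext i
      rw [Option.map_map]
      rfl
    · obtain ⟨v, -, rfl⟩ := Option.map_eq_some_iff.1 ha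
      exact Nat.lt_succ_of_le (hident v).2
    · obtain ⟨v, hv, rfl⟩ := Option.map_eq_some_iff.1 ha
      obtain ⟨w, hw, hvw⟩ := Option.map_eq_some_iff.1 hb
      obtain rfl := ident.injective hvw
      have := hψ.sep i j w hv hw hij
      omega
  have hreg : IsRegularSeq n k (fun i => (ψ i).map fun v => (ident v, x v, m i)) := by
    refine hψ.isRegularSeq ident x m (fun i j _ _ hi hj => chosen_indep hproper hi hj)
      fun i hi => ?_
    obtain ⟨v, hv⟩ := Option.ne_none_iff_exists'.1 hi
    obtain ⟨j, hj, hjc⟩ := exists_chosen (k := k) (z := zc) (i := i) (by rw [hzc]; simp [hv])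
      (hYq fun j => (ψ (i + j)).map ident)
    refine ⟨j, hj, ?_, hjc⟩
    have := chosen_isSome hjc
    simpa [hzc] using this
  rw [hψ.mem_sol_iff hΔ hS x y (by omega)]
  intro p
  have := windowOK_fillOutput hL hκ hreg (fun i hi hcyc => hFψ hcyc i (by simpa using hi)) hk.ge hD
    (by omega) p
  refine this.congr fun j hj => ?_
  rcases hv : ψ (p + j) with _ | v
  · simp
  · simp only [Option.map_some, Option.some_inj, Prod.mk.injEq, true_and]
    rw [hy _ v hv]
    congr 1
    funext i
    simp only [shiftBy_apply, Option.map_map]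
    refine congrArg (Option.map · _) ?_
    funext u
    refine congrArg (fun M => (ident u, x u, M)) ?_
    simp only [hm]
    congr 1
    funext l
    simp only [hzc, shiftBy_apply, ← add_assoc]
    rfl

/-! ### Solving problems in the online-LOCAL model -/

theorem onlineRun_eq {I O : Type*} {n : ℕ} {a : OnlineView n I O → O} {t : ℕ}
    {G : SimpleGraph (Fin n)} {x : Fin n → I} {σ : Equiv.Perm (Fin n)} (m : ℕ) (v : Fin n) :
    onlineRun a t G x σ m v = if (σ.symm v : ℕ) < m then
      some (a (onlineView t G x σ (σ.symm v) (onlineRun a t G x σ (σ.symm v)))) else none := by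
  induction m with
  | zero => simp [onlineRun]
  | succ m ih =>
    rw [onlineRun]
    split_ifs with hm h1 h1
    · rcases eq_or_ne v (σ ⟨m, hm⟩) with rfl | hne
      · simp
      · rw [Function.update_of_ne hne, ih, if_pos]
        have : (σ.symm v : ℕ) ≠ m := fun h => hne (by
          rw [← σ.apply_symm_apply v]; congr 1; exact Fin.ext h)
        omega
    · rw [Function.update_of_ne, ih, if_neg (by omega)]
      rintro rfl
      simp at h1
    · rw [ih, if_pos (by omega)]
    · have := (σ.symm v).2; omega

/-- For deterministic algorithms whose answers do not depend on the earlier outputs. -/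
theorem randOnlineSolvable_of_forall {I O : Type*} {P : LabelingProblem I O} {F : GraphFamily}
    {n t : ℕ} (a : OnlineView n I O → O)
    (h : ∀ G ∈ F n, ∀ (x : Fin n → I) (σ : Equiv.Perm (Fin n)), ∃ y ∈ P.sol G x,
      ∀ (j : Fin n) out, a (onlineView t G x σ j out) = y (σ j)) : P.RandOnlineSolvable F n t := by
  classical
  refine ⟨PMF.pure a, fun G hG x σ => ?_⟩
  rw [PMF.toOuterMeasure_pure_apply, if_neg]
  · exact zero_le
  · obtain ⟨y, hy, h⟩ := h G hG x σ
    refine not_not.2 ⟨y, hy, ?_⟩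
    funext v
    rw [onlineRun_eq, if_pos (σ.symm v).2, h, σ.apply_symm_apply]

theorem nbhd_subset_revealed {n t k : ℕ} {G : SimpleGraph (Fin n)} {σ : Equiv.Perm (Fin n)}
    {j : Fin n} (hj : (j : ℕ) ≤ k) : nbhd G t (σ j) ⊆ revealed t G σ k :=
  fun _ hu => ⟨j, hj, hu⟩

/-- An online-LOCAL algorithm can use the names of the nodes as identifiers. -/
theorem LabelingProblem.LocalSolvable.randOnlineSolvable {I O : Type*} {P : LabelingProblem I O}
    {F : GraphFamily} {c n t : ℕ} (hc : 1 ≤ c) (h : P.LocalSolvable F c n t) :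
    P.RandOnlineSolvable F n t := by
  obtain ⟨a, ha⟩ := h
  let ident : Fin n ↪ ℕ := ⟨fun v => v + 1, fun v w hvw => Fin.ext (Nat.succ_injective hvw)⟩
  have hident (v : Fin n) : 1 ≤ ident v ∧ ident v ≤ n ^ c :=
    ⟨Nat.le_add_left 1 v, (show (v : ℕ) + 1 ≤ n from v.2).trans (Nat.le_self_pow (by omega) n)⟩
  rcases isEmpty_or_nonempty I with hI | hI
  · obtain ⟨f⟩ : Nonempty (OnlineView n I O → O) := ⟨fun _ => a ⟨0, ⊥, fun _ => none⟩⟩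
    refine randOnlineSolvable_of_forall f fun G hG x σ => ?_
    exact ⟨_, ha G hG x ident hident, fun j => (hI.false (x j)).elim⟩
  -- Unrevealed nodes get an arbitrary input; they are not in the local view of the last node.
  · refine randOnlineSolvable_of_forall (fun view => if hv : view.order = [] then a ⟨0, ⊥, fun _ => none⟩
      else a (localView t view.graph (fun u => (view.input u).getD (Classical.arbitrary I)) ident
        (view.order.getLast hv))) fun G hG x σ => ⟨_, ha G hG x ident hident, fun j out => ?_⟩
    have horder : (onlineView t G x σ j out).order =
        ((List.finRange n).take j).map σ ++ [σ j] := by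
      simp [onlineView, List.take_add_one]
    have hsub := nbhd_subset_revealed (t := t) (G := G) (σ := σ) (le_refl (j : ℕ))
    have hne : (onlineView t G x σ j out).order ≠ [] := by simp [horder]
    rw [dif_neg hne]
    have hlast : (onlineView t G x σ j out).order.getLast hne = σ j := by simp [horder]
    rw [hlast]
    congr 1
    have hnb : nbhd (onlineView t G x σ j out).graph t (σ j) = nbhd G t (σ j) := nbhd_induce hsub
    rw [localView, localView, hnb]
    congr 1
    · congr 1
      ext u w
      simp only [onlineView, spanningCoe_induce_adj]
      constructor
      · rintro ⟨⟨h, -⟩, h'⟩; exact ⟨h, h'⟩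
      · rintro ⟨h, h1, h2⟩; exact ⟨⟨h, hsub h1, hsub h2⟩, h1, h2⟩
    · congr 1
      funext u
      unfold restrictInput
      split_ifs with hu
      · simp [onlineView, restrictInput, hsub hu]
      · rfl

/-- The greedy maximal set of nodes at pairwise distance more than `k`. -/
def Greedy {V : Type*} (G : SimpleGraph V) (k : ℕ) (key : V → ℕ) (u : V) : Prop :=
  ∀ w, w ∈ nbhd G k u → key w < key u → ¬ Greedy G k key w
termination_by key u

theorem greedy_indep {V : Type*} {G : SimpleGraph V} {k : ℕ} {key : V → ℕ}
    (hkey : Function.Injective key) {u w : V} (hu : Greedy G k key u) (hw : Greedy G k key w)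
    (huw : u ≠ w) : w ∉ nbhd G k u := by
  intro h
  rcases lt_or_gt_of_ne (hkey.ne huw) with hlt | hlt
  · rw [Greedy] at hw
    exact hw u (mem_nbhd_symm.1 h) hlt hu
  · rw [Greedy] at hu
    exact hu w h hlt hw

theorem exists_greedy {V : Type*} (G : SimpleGraph V) (k : ℕ) (key : V → ℕ) (u : V) :
    ∃ w ∈ nbhd G k u, Greedy G k key w := by
  by_cases h : Greedy G k key u
  · exact ⟨u, self_mem_nbhd G k u, h⟩
  · rw [Greedy] at h
    push Not at h
    obtain ⟨w, h1, -, h2⟩ := h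
    exact ⟨w, h1, h2⟩

/-! ### Greedy sets in the order of revealing -/

section reveal

variable {n : ℕ} (R : ℕ) (G : SimpleGraph (Fin n)) (σ : Equiv.Perm (Fin n))

/-- The first time at which a node within distance `R` of `u` is presented. -/
noncomputable def firstReveal (u : Fin n) : ℕ := sInf {j | ∃ i : Fin n, (i : ℕ) = j ∧ u ∈ nbhd G R (σ i)}

/-- Nodes are ordered by the time at which they are revealed, then by name. -/
noncomputable def revealKey (u : Fin n) : ℕ := firstReveal R G σ u * n + u

variable {R G σ}

theorem firstReveal_spec (u : Fin n) :
    ∃ i : Fin n, (i : ℕ) = firstReveal R G σ u ∧ u ∈ nbhd G R (σ i) :=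
  Nat.sInf_mem (s := {j | ∃ i : Fin n, (i : ℕ) = j ∧ u ∈ nbhd G R (σ i)})
    ⟨_, σ.symm u, rfl, by rw [σ.apply_symm_apply]; exact self_mem_nbhd G R u⟩

theorem firstReveal_le {u i : Fin n} (h : u ∈ nbhd G R (σ i)) : firstReveal R G σ u ≤ i :=
  Nat.sInf_le ⟨i, rfl, h⟩

theorem revealKey_injective : Function.Injective (revealKey R G σ) := by
  intro u w h
  have h1 := congrArg (· % n) h
  simp only [revealKey, Nat.mul_add_mod_self_right, Nat.mod_eq_of_lt u.2, Nat.mod_eq_of_lt w.2] at h1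
  exact Fin.ext h1

theorem firstReveal_le_of_revealKey_lt {u w : Fin n} (h : revealKey R G σ w < revealKey R G σ u) :
    firstReveal R G σ w ≤ firstReveal R G σ u := by
  by_contra hc
  have h1 : (firstReveal R G σ u + 1) * n ≤ firstReveal R G σ w * n :=
    Nat.mul_le_mul_right n (by omega)
  have := u.2
  rw [revealKey, revealKey] at h
  rw [add_mul, one_mul] at h1
  omega

/-- Two graphs and orders that have revealed the same up to time `j`. -/
structure SameReveal (t : ℕ) (G G' : SimpleGraph (Fin n)) (σ σ' : Equiv.Perm (Fin n)) (j : ℕ) :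
    Prop where
  order : ∀ i : Fin n, (i : ℕ) ≤ j → σ i = σ' i
  nodes : revealed t G σ j = revealed t G' σ' j
  graph : (G.induce (revealed t G σ j)).spanningCoe = (G'.induce (revealed t G' σ' j)).spanningCoe

variable {t j k : ℕ} {G' : SimpleGraph (Fin n)} {σ' : Equiv.Perm (Fin n)}

theorem SameReveal.symm (h : SameReveal t G G' σ σ' j) : SameReveal t G' G σ' σ j where
  order i hi := (h.order i hi).symm
  nodes := h.nodes.symm
  graph := h.graph.symm

theorem SameReveal.adj (h : SameReveal t G G' σ σ' j) {a b : Fin n} (ha : a ∈ revealed t G σ j)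
    (hb : b ∈ revealed t G σ j) (hab : G.Adj a b) : G'.Adj a b := by
  have h1 : (G.induce (revealed t G σ j)).spanningCoe.Adj a b :=
    spanningCoe_induce_adj.2 ⟨hab, ha, hb⟩
  rw [h.graph] at h1
  exact (spanningCoe_induce_adj.1 h1).1

theorem SameReveal.nbhd_eq (h : SameReveal t G G' σ σ' j) {i : Fin n} (hi : (i : ℕ) ≤ j) {s : ℕ}
    (hs : s ≤ t) : nbhd G s (σ i) = nbhd G' s (σ' i) := by
  rw [← nbhd_induce ((nbhd_mono hs _).trans (nbhd_subset_revealed hi)), h.graph, h.order i hi,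
    nbhd_induce ((nbhd_mono hs _).trans (nbhd_subset_revealed hi))]

/-- Small neighborhoods of the nodes around presented nodes agree. -/
theorem SameReveal.nbhd_inner_eq (h : SameReveal t G G' σ σ' j) (hRk : R + k ≤ t) {u i : Fin n}
    (hi : (i : ℕ) ≤ j) (hu : u ∈ nbhd G R (σ i)) : nbhd G k u = nbhd G' k u := by
  have hu' : u ∈ nbhd G' R (σ' i) := (h.nbhd_eq (s := R) hi (by omega)) ▸ hu
  have h1 {G : SimpleGraph (Fin n)} {σ : Equiv.Perm (Fin n)} (hu : u ∈ nbhd G R (σ i)) :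
      nbhd G k u ⊆ revealed t G σ j := fun w hw =>
    nbhd_subset_revealed hi (nbhd_mono hRk _ (mem_nbhd_trans hu hw))
  rw [← nbhd_induce (h1 hu), h.graph, nbhd_induce (h1 hu')]

theorem SameReveal.firstReveal_le (h : SameReveal t G G' σ σ' j) (hRk : R ≤ t) {u i : Fin n}
    (hi : (i : ℕ) ≤ j) (hu : u ∈ nbhd G R (σ i)) :
    firstReveal R G' σ' u ≤ firstReveal R G σ u := by
  obtain ⟨l, hl, hul⟩ := firstReveal_spec (R := R) (G := G) (σ := σ) u
  have := _root_.firstReveal_le hu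
  rw [← hl]
  refine _root_.firstReveal_le ?_
  rwa [← h.nbhd_eq (by omega) hRk]

theorem SameReveal.revealKey_eq (h : SameReveal t G G' σ σ' j) (hRk : R ≤ t) {u i : Fin n}
    (hi : (i : ℕ) ≤ j) (hu : u ∈ nbhd G R (σ i)) :
    revealKey R G σ u = revealKey R G' σ' u := by
  rw [revealKey, revealKey, le_antisymm (h.firstReveal_le hRk hi hu)
    (h.symm.firstReveal_le hRk hi (h.nbhd_eq hi hRk ▸ hu))]

/-- The decision on `u` depends on nodes within `k` that have smaller keys. These came within
distance `R` of a presented node no later than `u`, so the recursion never leaves the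
`R`-neighborhoods of presented nodes, and locality `R + k` shows all that it uses. -/
theorem SameReveal.greedy_iff (hRk : R + k ≤ t) (N : ℕ) :
    ∀ {G G' : SimpleGraph (Fin n)} {σ σ' : Equiv.Perm (Fin n)}, SameReveal t G G' σ σ' j →
    ∀ u i : Fin n, (i : ℕ) ≤ j → u ∈ nbhd G R (σ i) → revealKey R G σ u < N →
    Greedy G k (revealKey R G σ) u → Greedy G' k (revealKey R G' σ') u := by
  induction N with
  | zero => intro _ _ _ _ _ _ _ _ _ h; omega
  | succ N ih =>
    intro G G' σ σ' h u i hi hu hN hg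
    rw [Greedy] at hg ⊢
    intro w hw hlt hgw
    rw [← h.nbhd_inner_eq hRk hi hu] at hw
    obtain ⟨l, hl, hwl⟩ := firstReveal_spec (R := R) (G := G') (σ := σ') w
    have h1 := firstReveal_le_of_revealKey_lt hlt
    have h2 := _root_.firstReveal_le (h.nbhd_eq (s := R) hi (by omega) ▸ hu)
    have hlj : (l : ℕ) ≤ j := by omega
    have hkw := h.symm.revealKey_eq (by omega) hlj hwl
    have hku := h.revealKey_eq (R := R) (by omega) hi hu
    rw [hkw, ← hku] at hlt
    exact hg w hw hlt (ih h.symm w l hlj hwl (by omega) hgw)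

end reveal

theorem sameReveal_of_onlineView_eq {I O : Type*} {n t : ℕ} {G G' : SimpleGraph (Fin n)}
    {σ σ' : Equiv.Perm (Fin n)} {x x' : Fin n → I} {j j' : Fin n} {out out' : Fin n → Option O}
    (h : onlineView t G x σ j out = onlineView t G' x' σ' j' out') :
    j = j' ∧ SameReveal t G G' σ σ' j ∧ ∀ u ∈ revealed t G σ j, x u = x' u := by
  have horder := congrArg OnlineView.order h
  have hgraph := congrArg OnlineView.graph h
  have hinput := congrArg OnlineView.input h
  simp only [onlineView] at horder hgraph hinput
  have hj : j = j' := by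
    have := congrArg List.length horder
    simp at this
    omega
  subst hj
  have hnodes : revealed t G σ j = revealed t G' σ' j := by
    ext u
    have := congrFun hinput u
    unfold restrictInput at this
    split_ifs at this <;> simp_all
  refine ⟨rfl, ⟨fun i hi => ?_, hnodes, hgraph⟩, fun u hu => ?_⟩
  · have := congrArg (fun l => l[(i : ℕ)]?) horder
    simpa [List.getElem?_take, show (i : ℕ) < j + 1 by omega] using this
  · have := congrFun hinput u
    rw [restrictInput, restrictInput, if_pos hu, if_pos (hnodes ▸ hu)] at this
    exact Option.some_injective _ this

theorem IsPatchLabeling.exists_randOnlineSolvable {I O : Type*} [Finite I] [Finite O] [Nonempty I]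
    [Nonempty O] {P : LabelingProblem I O} {S : Set (CenteredLabeledGraph I O)} {r Δ : ℕ}
    (hΔ : 2 ≤ Δ) (hS : ∀ (n : ℕ) (G : SimpleGraph (Fin n)) (x : Fin n → I), DegreeAtMost G Δ →
      ∀ y : Fin n → O, y ∈ P.sol G x ↔ ∀ v, ∃ H ∈ S, NbhdIso G x y r v H)
    {F : GraphFamily} (hF : F = paths ∨ F = cycles ∨ F = pathsAndCycles) {L}
    (hL : IsPatchLabeling S r (F ≠ cycles) L) :
    ∃ t n₀, ∀ n ≥ n₀, P.RandOnlineSolvable F n t := by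
  set κ := Nat.card (EffectPair I O r) with hκ
  set k := 2 * r + 1 + 2 * κ with hk
  set D := 2 * (r + κ) + 2 * k with hD
  set R := (2 * D + 2) + 3 * r + κ with hR
  have hrule := isRule_fillOutput (κ := κ) (B := 2 * D + 2) hL
  refine ⟨R + k, 2 * D + 4 * r + 10, fun n hn => ?_⟩
  let out (G : SimpleGraph (Fin n)) (ψ : ℤ → Option (Fin n)) (x : Fin n → I)
      (σ : Equiv.Perm (Fin n)) (p : ℤ) : O :=
    fillOutput S r L κ (2 * D + 2) fun i => (ψ (p + i)).map fun v : Fin n =>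
      ((v : ℕ), x v, Greedy G k (revealKey R G σ) v)
  have hout {G G' : SimpleGraph (Fin n)} {ψ ψ'} {x x' : Fin n → I} {σ σ' : Equiv.Perm (Fin n)}
      {p p' : ℤ} {j j' : Fin n} {o o' : Fin n → Option O} (hψ : IsChart G ψ) (hψ' : IsChart G' ψ')
      (hp : ψ p = some (σ j)) (hp' : ψ' p' = some (σ' j'))
      (hv : onlineView (R + k) G x σ j o = onlineView (R + k) G' x' σ' j' o') :
      out G ψ x σ p = out G' ψ' x' σ' p' := by
    obtain ⟨rfl, hs, hx⟩ := sameReveal_of_onlineView_eq hv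
    have hrev {s : ℕ} (hs : s ≤ R + k) {G : SimpleGraph (Fin n)} {σ : Equiv.Perm (Fin n)} :
        nbhd G s (σ j) ⊆ revealed (R + k) G σ j :=
      (nbhd_mono hs _).trans (nbhd_subset_revealed le_rfl)
    have hadj {G G' : SimpleGraph (Fin n)} {σ σ' : Equiv.Perm (Fin n)}
        (h : SameReveal (R + k) G G' σ σ' j) {s : ℕ} (hs : s < R) {a b : Fin n}
        (ha : a ∈ nbhd G s (σ j)) (hab : G.Adj a b) : G'.Adj a b :=
      h.adj (hrev (by omega) ha)
        (hrev (s := s + 1) (by omega) (mem_nbhd_succ.2 (Or.inr ⟨a, ha, hab⟩))) hab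
    have hwin := window_eq_or_reverse (by omega) (by omega) hψ hψ' (Function.Embedding.refl _)
      (Function.Embedding.refl _) hp hp' (hs.order j le_rfl) (t := R)
      (fun s hsR a ha a' ha' haa => by
        obtain rfl : a = a' := haa
        congr 1
        ext b
        exact ⟨hadj hs hsR ha, hadj hs.symm hsR ha'⟩)
    have key (i i' : ℤ) (hi : |i| ≤ R) (h : (ψ (p + i)).map (Function.Embedding.refl _) =
        (ψ' (p' + i')).map (Function.Embedding.refl _)) :
        ((ψ (p + i)).map fun v : Fin n => ((v : ℕ), x v, Greedy G k (revealKey R G σ) v)) =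
          (ψ' (p' + i')).map fun v : Fin n => ((v : ℕ), x' v, Greedy G' k (revealKey R G' σ') v) := by
      have h' : ψ (p + i) = ψ' (p' + i') := by
        simpa [Function.Embedding.coe_refl, Option.map_id] using h
      rw [← h']
      rcases hv : ψ (p + i) with _ | v
      · rfl
      · have hvn : v ∈ nbhd G R (σ j) := (hψ.mem_nbhd_iff hp).2 ⟨i, hi, hv⟩
        have hg : Greedy G k (revealKey R G σ) v ↔ Greedy G' k (revealKey R G' σ') v :=
          ⟨hs.greedy_iff le_rfl _ v j le_rfl hvn (Nat.lt_succ_self _),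
            hs.symm.greedy_iff le_rfl _ v j le_rfl ((hs.nbhd_eq (s := R) le_rfl (by omega)) ▸ hvn)
              (Nat.lt_succ_self _)⟩
        simp only [Option.map_some, hx v (hrev (by omega) hvn), hg]
    rcases hwin with h1 | h1
    · exact hrule.1 _ _ fun i hi => key i i hi (h1 i hi)
    · refine (hrule.1 _ _ fun i hi => key i (-i) hi (h1 i hi)).trans ?_
      exact hrule.2 fun i => (ψ' (p' + i)).map fun v : Fin n =>
        ((v : ℕ), x' v, Greedy G' k (revealKey R G' σ') v)
  let A (view : OnlineView n I O) : Set O := {o | ∃ (G : SimpleGraph (Fin n))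
    (ψ : ℤ → Option (Fin n)) (x : Fin n → I) (σ : Equiv.Perm (Fin n)) (p : ℤ) (j : Fin n)
    (y : Fin n → Option O), IsChart G ψ ∧ ψ p = some (σ j) ∧ onlineView (R + k) G x σ j y = view ∧
    o = out G ψ x σ p}
  refine randOnlineSolvable_of_forall (fun view => pick (A view)) fun G hG x σ => ?_
  obtain ⟨ψ, hψ, hFψ⟩ := exists_chart hF hG
  choose pos hpos using hψ.surj
  refine ⟨fun v => out G ψ x σ (pos v), ?_, fun j y => ?_⟩
  · set m : ℤ → Prop := fun i => ∃ v, ψ i = some v ∧ Greedy G k (revealKey R G σ) v with hm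
    have hreg : IsRegularSeq n k (fun i => (ψ i).map fun v : Fin n => ((v : ℕ), x v, m i)) := by
      refine hψ.isRegularSeq Fin.valEmbedding x m (fun i j hi hj hmi hmj hij => ?_) fun i hi => ?_
      · obtain ⟨v, hv, hgv⟩ := hmi
        obtain ⟨w, hw, hgw⟩ := hmj
        by_contra hc
        rcases eq_or_ne v w with rfl | hvw
        · have := hψ.sep i j v hv hw hij
          omega
        · refine greedy_indep revealKey_injective hgv hgw hvw ((hψ.mem_nbhd_iff hv).2 ⟨j - i, ?_, ?_⟩)
          · rw [abs_sub_comm]; omega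
          · rwa [add_sub_cancel]
      · obtain ⟨v, hv⟩ := Option.ne_none_iff_exists'.1 hi
        obtain ⟨w, hw, hgw⟩ := exists_greedy G k (revealKey R G σ) v
        obtain ⟨l, hl, hwl⟩ := (hψ.mem_nbhd_iff hv).1 hw
        exact ⟨i + l, by simpa using hl, by simp [hwl], w, hwl, hgw⟩
    rw [hψ.mem_sol_iff hΔ hS x _ (by omega)]
    intro p
    have := windowOK_fillOutput hL hκ hreg (fun i hi hcyc => hFψ hcyc i (by simpa using hi)) hk.ge hD
      (by omega) p
    refine this.congr fun j hj => ?_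
    rcases hv : ψ (p + j) with _ | v
    · simp
    · simp only [Option.map_some, Option.some_inj, Prod.mk.injEq, true_and, out]
      congr 1
      funext i
      -- On a cycle a node has many positions; periodicity makes its output independent of the
      -- position chosen for it.
      rw [shiftBy_apply, hψ.per _ _ v hv (hpos v)]
      rcases hu : ψ (pos v + i) with _ | u
      · rfl
      · have h2 : ψ (p + j + i) = some u := by rw [hψ.per _ _ v hv (hpos v), hu]
        simp [hm, h2]
  · obtain ⟨G', ψ', x', σ', p', j', y', hψ', hp', hview, ho⟩ :=
      pick_mem (s := A (onlineView (R + k) G x σ j y))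
        ⟨_, G, ψ, x, σ, pos (σ j), j, y, hψ, hpos _, rfl, rfl⟩
    exact ho.trans (hout hψ' hψ hp' (hpos _) hview)

/-! ### Far apart fragments in the online-LOCAL model -/

section strings

variable {I O E : Type*} {n : ℕ}

/-- The chart contains the nodes `nm e 0, nm e 1, …, nm e (len e - 1)` in this or in the reverse
order, with inputs `w e`. -/
def ContainsStrings (ψ : ℤ → Option (Fin n)) (x : Fin n → I) (len : E → ℕ) (nm : E → ℕ → Fin n)
    (w : E → ℕ → I) : Prop :=
  ∀ e, (∀ k < len e, x (nm e k) = w e k) ∧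
    ∃ q s : ℤ, (s = 1 ∨ s = -1) ∧ ∀ k : ℕ, k < len e → ψ (q + s * k) = some (nm e k)

variable {G G' : SimpleGraph (Fin n)} {ψ ψ' : ℤ → Option (Fin n)} {x x' : Fin n → I}
  {len : E → ℕ} {nm : E → ℕ → Fin n} {w : E → ℕ → I}

theorem ContainsStrings.adj_iff (h : ContainsStrings ψ x len nm w) (hψ : IsChart G ψ) {e : E}
    {k : ℕ} (hk : 0 < k) (hk' : k + 1 < len e) {b : Fin n} :
    G.Adj (nm e k) b ↔ b = nm e (k + 1) ∨ b = nm e (k - 1) := by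
  obtain ⟨-, q, s, hs, hq⟩ := h e
  rw [hψ.adj _ _ b (hq k (by omega))]
  have h1 := hq (k + 1) hk'
  have h2 := hq (k - 1) (by omega)
  push_cast [Nat.cast_sub hk] at h1 h2
  rcases hs with rfl | rfl
  · rw [show q + 1 * (k : ℤ) + 1 = q + 1 * (k + 1) by ring,
      show q + 1 * (k : ℤ) - 1 = q + 1 * (k - 1) by ring, h1, h2, Option.some_inj, Option.some_inj,
      eq_comm, eq_comm (a := nm e (k - 1))]
  · rw [show q + -1 * (k : ℤ) + 1 = q + -1 * (k - 1) by ring,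
      show q + -1 * (k : ℤ) - 1 = q + -1 * (k + 1) by ring, h1, h2, Option.some_inj, Option.some_inj,
      eq_comm, eq_comm (a := nm e (k + 1)), or_comm]

theorem ContainsStrings.of_mem_nbhd (h : ContainsStrings ψ x len nm w) (hψ : IsChart G ψ) {e : E}
    {k t : ℕ} (hk : t ≤ k) (hk' : k + t < len e) {u : Fin n} (hu : u ∈ nbhd G t (nm e k)) :
    ∃ l, u = nm e l ∧ k ≤ l + t ∧ l ≤ k + t := by
  obtain ⟨-, q, s, hs, hq⟩ := h e
  obtain ⟨i, hi, hu⟩ := (hψ.mem_nbhd_iff (hq k (by omega))).1 hu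
  rw [abs_le] at hi
  have key (l : ℕ) (hl : q + s * k + i = q + s * l) (h1 : k ≤ l + t) (h2 : l ≤ k + t) :
      ∃ l, u = nm e l ∧ k ≤ l + t ∧ l ≤ k + t := by
    rw [hl, hq l (by omega)] at hu
    exact ⟨l, (Option.some_injective _ hu).symm, h1, h2⟩
  rcases hs with rfl | rfl
  · exact key (k + i).toNat (by omega) (by omega) (by omega)
  · exact key (k - i).toNat (by omega) (by omega) (by omega)

variable {d t K : ℕ} {pos : E → ℕ} {σ : Equiv.Perm (Fin n)}

/-- As long as only nodes in the middle of the strings are presented, the algorithm cannot tell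
how the strings are arranged. -/
theorem onlineView_eq_of_containsStrings (h : ContainsStrings ψ x len nm w)
    (h' : ContainsStrings ψ' x' len nm w) (hψ : IsChart G ψ) (hψ' : IsChart G' ψ')
    (hpos : ∀ e, t + 1 ≤ pos e ∧ pos e + d + t + 1 ≤ len e)
    (hσ : ∀ i : Fin n, (i : ℕ) < K → ∃ e k, pos e ≤ k ∧ k < pos e + d ∧ σ i = nm e k)
    {j : ℕ} (hj : j < K) (y : Fin n → Option O) :
    onlineView t G x σ j y = onlineView t G' x' σ j y := by
  have hnb {i : Fin n} (hi : (i : ℕ) ≤ j) : nbhd G t (σ i) = nbhd G' t (σ i) := by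
    obtain ⟨e, k, h1, h2, h3⟩ := hσ i (by omega)
    rw [h3]
    refine nbhd_congr fun s hs a ha b => ?_
    have := hpos e
    obtain ⟨l, rfl, hl1, hl2⟩ := h.of_mem_nbhd hψ (by omega) (by omega) ha
    rw [h.adj_iff hψ (by omega) (by omega), h'.adj_iff hψ' (by omega) (by omega)]
  have hrev : revealed t G σ j = revealed t G' σ j := by
    ext u
    exact exists_congr fun i => and_congr_right fun hi => by rw [hnb hi]
  -- The margin `t + 1` keeps revealed nodes away from the ends of their strings, so their edges are
  -- known.
  have hin {u : Fin n} (hu : u ∈ revealed t G σ j) :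
      ∃ e k, 0 < k ∧ k + 1 < len e ∧ u = nm e k := by
    obtain ⟨i, hi, hu⟩ := hu
    obtain ⟨e, k, h1, h2, h3⟩ := hσ i (by omega)
    rw [h3] at hu
    have := hpos e
    obtain ⟨l, rfl, hl1, hl2⟩ := h.of_mem_nbhd hψ (by omega) (by omega) hu
    exact ⟨e, l, by omega, by omega, rfl⟩
  rw [onlineView, onlineView, ← hrev]
  congr 1
  · ext a b
    rw [spanningCoe_induce_adj, spanningCoe_induce_adj]
    refine and_congr_left fun hab => ?_
    obtain ⟨e, k, h1, h2, rfl⟩ := hin hab.1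
    rw [h.adj_iff hψ h1 h2, h'.adj_iff hψ' h1 h2]
  · funext u
    unfold restrictInput
    split_ifs with hu
    · obtain ⟨e, k, h1, h2, rfl⟩ := hin hu
      rw [(h e).1 k (by omega), (h' e).1 k (by omega)]
    · rfl

theorem onlineRun_eq_of_containsStrings (h : ContainsStrings ψ x len nm w)
    (h' : ContainsStrings ψ' x' len nm w) (hψ : IsChart G ψ) (hψ' : IsChart G' ψ')
    (hpos : ∀ e, t + 1 ≤ pos e ∧ pos e + d + t + 1 ≤ len e)
    (hσ : ∀ i : Fin n, (i : ℕ) < K → ∃ e k, pos e ≤ k ∧ k < pos e + d ∧ σ i = nm e k)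
    (a : OnlineView n I O → O) {m : ℕ} (hm : m ≤ K) :
    onlineRun a t G x σ m = onlineRun a t G' x' σ m := by
  induction m with
  | zero => rfl
  | succ m ih =>
    rw [onlineRun, onlineRun, ih (by omega),
      onlineView_eq_of_containsStrings h h' hψ hψ' hpos hσ (by omega)]

/-- Gives the order of the adversary: all nodes in the middle of strings first. -/
theorem exists_perm_lt_iff_mem (A : Finset (Fin n)) :
    ∃ σ : Equiv.Perm (Fin n), ∀ i : Fin n, (i : ℕ) < A.card ↔ σ i ∈ A := by
  have hA : A.card ≤ n := by simpa using A.card_le_univ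
  let f : {i : Fin n // (i : ℕ) < A.card} ≃ Fin A.card :=
    ⟨fun i => ⟨i.1, i.2⟩, fun i => ⟨⟨i, by omega⟩, i.2⟩, fun _ => rfl, fun _ => rfl⟩
  let e := f.trans A.equivFin.symm
  exact ⟨e.extendSubtype, fun i => ⟨fun hi => e.extendSubtype_mem i hi,
    fun hi => by_contra fun hc => e.extendSubtype_not_mem i hc hi⟩⟩

theorem exists_perm_of_nodup {l : List (Fin n)} (hl : l.Nodup) :
    ∃ π : Equiv.Perm (Fin n), ∀ (i : Fin n) (h : (i : ℕ) < l.length), π i = l[(i : ℕ)] := by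
  have hn : l.length ≤ n := by simpa using hl.length_le_card
  let f : {i : Fin n // (i : ℕ) < l.length} ≃ Fin l.length :=
    ⟨fun i => ⟨i.1, i.2⟩, fun i => ⟨⟨i, by omega⟩, i.2⟩, fun _ => rfl, fun _ => rfl⟩
  let e := f.trans (hl.getEquiv l)
  exact ⟨e.extendSubtype, fun i h => e.extendSubtype_apply_of_mem i h⟩

/-- Union bound: fewer than `n` events of probability at most `1 / n` do not cover everything. -/
theorem PMF.exists_forall_not_mem {α ι : Type*} [Fintype ι] (A : PMF α) (bad : ι → Set α)
    (h : ∀ j, A.toOuterMeasure (bad j) ≤ (n : ℝ≥0∞)⁻¹) (hn : Fintype.card ι < n) :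
    ∃ a, ∀ j, a ∉ bad j := by
  by_contra! hc
  have h1 : A.toOuterMeasure (⋃ j, bad j) = 1 := by
    rw [PMF.toOuterMeasure_apply_eq_one_iff]
    exact fun a _ => Set.mem_iUnion.2 (hc a)
  have h2 : (1 : ℝ≥0∞) ≤ Fintype.card ι * (n : ℝ≥0∞)⁻¹ := by
    calc (1 : ℝ≥0∞) = A.toOuterMeasure (⋃ j, bad j) := h1.symm
      _ ≤ ∑ j, A.toOuterMeasure (bad j) := MeasureTheory.measure_iUnion_fintype_le _ _
      _ ≤ ∑ _j : ι, (n : ℝ≥0∞)⁻¹ := Finset.sum_le_sum fun j _ => h j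
      _ = _ := by simp
  rw [← div_eq_mul_inv, ENNReal.le_div_iff_mul_le (by left; simp; omega) (by left; simp), one_mul]
    at h2
  exact absurd (Nat.cast_le.1 h2) (by omega)

/-- On finitely many arrangements, an algorithm that fails with small probability can give the same
outputs in the middle of the strings. -/
theorem LabelingProblem.RandOnlineSolvable.exists_common_output {P : LabelingProblem I O}
    {F : GraphFamily} (hP : P.RandOnlineSolvable F n t) {ι : Type*} [Fintype ι] [Nonempty ι]
    [Finite E] (hn : Fintype.card ι < n) {G : ι → SimpleGraph (Fin n)} (hG : ∀ j, G j ∈ F n)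
    {ψ : ι → ℤ → Option (Fin n)} (hψ : ∀ j, IsChart (G j) (ψ j)) {x : ι → Fin n → I}
    (h : ∀ j, ContainsStrings (ψ j) (x j) len nm w)
    (hpos : ∀ e, t + 1 ≤ pos e ∧ pos e + d + t + 1 ≤ len e) :
    ∃ y₀ : E → ℕ → O, ∀ j, ∃ y ∈ P.sol (G j) (x j), ∀ e k, pos e ≤ k → k < pos e + d →
      y (nm e k) = y₀ e k := by
  classical
  obtain ⟨A, hA⟩ := hP
  obtain ⟨σ, hσ⟩ := exists_perm_lt_iff_mem
    (Finset.univ.filter fun v : Fin n => ∃ e k, pos e ≤ k ∧ k < pos e + d ∧ v = nm e k)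
  simp only [Finset.mem_filter, Finset.mem_univ, true_and] at hσ
  -- The order `σ` is common to all arrangements, as is the deterministic algorithm `a` that
  -- succeeds on all of them.
  obtain ⟨a, ha⟩ := A.exists_forall_not_mem _ (fun j => hA (G j) (hG j) (x j) σ) hn
  simp only [Set.mem_ofPred_eq, not_not] at ha
  choose y hy hrun using ha
  have key (j j' : ι) (e : E) (k : ℕ) (h1 : pos e ≤ k) (h2 : k < pos e + d) :
      y j (nm e k) = y j' (nm e k) := by
    have hlt := (hσ (σ.symm (nm e k))).2 ⟨e, k, h1, h2, σ.apply_symm_apply _⟩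
    have h3 := congrFun (hrun j) (nm e k)
    have h4 := congrFun (hrun j') (nm e k)
    have hσ' := fun i hi => (hσ i).1 hi
    rw [onlineRun_eq, if_pos (σ.symm (nm e k)).2] at h3 h4
    rw [onlineRun_eq_of_containsStrings (h j) (h j') (hψ j) (hψ j') hpos hσ' a hlt.le,
      onlineView_eq_of_containsStrings (h j) (h j') (hψ j) (hψ j') hpos hσ' hlt, h4] at h3
    exact (Option.some_injective _ h3).symm
  exact ⟨fun e k => y (Classical.arbitrary ι) (nm e k), fun j => ⟨y j, hy j, fun e k => key _ _ e k⟩⟩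

end strings

/-! ### Arrangements of fragments -/

section occurs

variable {α : Type*}

/-- The sequence `ψ` contains the list `l` at position `a`. -/
def Occurs (ψ : ℤ → Option α) (a : ℤ) (l : List α) : Prop :=
  ∀ (i : ℕ) (h : i < l.length), ψ (a + i) = some l[i]

theorem occurs_append {ψ : ℤ → Option α} {a : ℤ} {l l' : List α} :
    Occurs ψ a (l ++ l') ↔ Occurs ψ a l ∧ Occurs ψ (a + l.length) l' := by
  constructor
  · refine fun h => ⟨fun i hi => ?_, fun i hi => ?_⟩
    · rw [h i (by simp; omega), List.getElem_append_left hi]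
    · have := h (l.length + i) (by simpa using hi)
      rw [List.getElem_append_right (by omega)] at this
      simpa [add_assoc] using this
  · rintro ⟨h1, h2⟩ i hi
    rw [List.getElem_append]
    split_ifs with hc
    · exact h1 i hc
    · have := h2 (i - l.length) (by simp at hi; omega)
      rw [← this]
      congr 1
      omega

end occurs

section reach

variable {I O : Type*} {S : Set (CenteredLabeledGraph I O)} {r n : ℕ}
  {ψ : ℤ → Option (Fin n)} {x : Fin n → I} {y : Fin n → O}

theorem factor_eq_map_of_occurs {X : ℤ → I} {a : ℤ} {l : List (Fin n)} (h : Occurs ψ a l)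
    (hX : ∀ i v, ψ i = some v → X i = x v) : factor X a l.length = l.map x := by
  rw [← ofFn_eq_factor, ← List.ofFn_getElem_eq_map]
  congr 1
  funext j
  exact hX _ _ (h j j.2)

theorem reach_of_occurs
    (hy : ∀ p, WindowOK S r (fun i => (ψ (p + i)).map fun v => (x v, y v))) {a : ℤ}
    {l : List (Fin n)} (h : Occurs ψ (a + (2 * r + 1 : ℕ)) l) :
    Reach S r (labelsAt _ (fun i => (ψ i).map fun v => (x v, y v)) a) (l.map x)
      (labelsAt _ (fun i => (ψ i).map fun v => (x v, y v)) (a + l.length)) := by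
  rcases l.eq_nil_or_concat with rfl | ⟨l', v, rfl⟩
  · simp [Reach]
  · have hX (i u) (hu : ψ i = some u) : (fun i => ((ψ i).map x).getD (x v)) i = x u := by simp [hu]
    rw [← factor_eq_map_of_occurs h hX]
    refine reach_of_labeling fun i hi1 hi2 => ⟨pairOK_labelsAt.2 ⟨hy _, hy _⟩, ?_⟩
    have := h (i - a).toNat (by omega)
    rw [show a + ((2 * r + 1 : ℕ) : ℤ) + ((i - a).toNat : ℤ) = i + (2 * r + 1 : ℕ) by omega] at this
    exact ⟨_, by rw [this]; simp; rfl⟩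

end reach

section arrangement

variable {I E : Type*} {n Λ d : ℕ}

theorem map_range_getD (l : List I) (i₀ : I) :
    (List.range l.length).map (fun k => l.getD k i₀) = l :=
  List.ext_getElem (by simp) fun i h1 h2 => by simp [h2]

theorem exists_names [Finite E] (h : Nat.card E * Λ ≤ n) (hn : 0 < n) : ∃ nm : E → ℕ → Fin n,
    ∀ a b k l, k < Λ → l < Λ → nm a k = nm b l → a = b ∧ k = l := by
  have := Fintype.ofFinite E
  obtain ⟨f⟩ : Nonempty (E × Fin Λ ↪ Fin n) :=
    Function.Embedding.nonempty_of_card_le (by simpa using h)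
  refine ⟨fun a k => if h : k < Λ then f (a, ⟨k, h⟩) else ⟨0, hn⟩, fun a b k l hk hl hab => ?_⟩
  simp only [dif_pos hk, dif_pos hl] at hab
  simpa using f.injective hab

theorem exists_input_of_names [Nonempty I] {nm : E → ℕ → Fin n}
    (hnm : ∀ a b k l, k < Λ → l < Λ → nm a k = nm b l → a = b ∧ k = l) (X : E → ℕ → I) :
    ∃ x : Fin n → I, ∀ a k, k < Λ → x (nm a k) = X a k := by
  classical
  refine ⟨fun v => if h : ∃ p : E × ℕ, p.2 < Λ ∧ nm p.1 p.2 = v then X h.choose.1 h.choose.2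
    else Classical.arbitrary I, fun a k hk => ?_⟩
  have hex : ∃ p : E × ℕ, p.2 < Λ ∧ nm p.1 p.2 = nm a k := ⟨(a, k), hk, rfl⟩
  obtain ⟨h1, h2⟩ := hnm _ _ _ _ hex.choose_spec.1 hk hex.choose_spec.2
  exact (dif_pos hex).trans (by rw [h1, h2])

variable (fl fr : E → List I) (fu : E → Fin d → I)

/-- The inputs of a fragment: a patch of `d` nodes and the words that leave it. -/
def fragmentWord (e : E) : List I := (fl e).reverse ++ List.ofFn (fu e) ++ fr e

/-- The nodes of a string, in reverse order if `s` holds. -/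
def orientedString (nm : ℕ → Fin n) (len : ℕ) (s : Bool) : List (Fin n) :=
  if s then ((List.range len).map nm).reverse else (List.range len).map nm

variable {fl fr fu} {nm : ℕ → Fin n} {x : Fin n → I} {e : E}

theorem mem_orientedString {len : ℕ} {s : Bool} {v : Fin n} :
    v ∈ orientedString nm len s ↔ ∃ k < len, nm k = v := by
  cases s <;> simp [orientedString]

theorem nodup_orientedString {len : ℕ} {s : Bool}
    (h : ∀ k l, k < len → l < len → nm k = nm l → k = l) : (orientedString nm len s).Nodup := by
  have : ((List.range len).map nm).Nodup := List.nodup_range.map_on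
    fun k hk l hl => h k l (List.mem_range.1 hk) (List.mem_range.1 hl)
  cases s
  · exact this
  · exact List.nodup_reverse.2 this

theorem exists_direction_of_occurs {ψ : ℤ → Option (Fin n)} {a : ℤ} {len : ℕ} {s : Bool}
    (h : Occurs ψ a (orientedString nm len s)) :
    ∃ q s : ℤ, (s = 1 ∨ s = -1) ∧ ∀ k : ℕ, k < len → ψ (q + s * k) = some (nm k) := by
  cases s
  · refine ⟨a, 1, Or.inl rfl, fun k hk => ?_⟩
    have := h k (by simpa [orientedString] using hk)
    simpa [orientedString] using this
  · refine ⟨a + len - 1, -1, Or.inr rfl, fun k hk => ?_⟩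
    have := h (len - 1 - k) (by simp [orientedString]; omega)
    rw [show a + ((len - 1 - k : ℕ) : ℤ) = a + len - 1 + -1 * k by omega] at this
    rw [this]
    simp only [orientedString, if_true, List.getElem_reverse, List.getElem_map, List.getElem_range,
      List.length_map, List.length_range]
    congr 2
    omega

/-- Since the words at both sides are read outward, a reversed fragment has the same shape, with its
sides exchanged and its patch reversed. -/
theorem exists_orientedString_eq (hx : (List.range (fragmentWord fl fr fu e).length).map
    (fun k => x (nm k)) = fragmentWord fl fr fu e) (s : Bool) :
    ∃ A B C, orientedString nm (fragmentWord fl fr fu e).length s = A ++ B ++ C ∧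
      A.map x = (if s then fr e else fl e).reverse ∧
      B = List.ofFn (fun j : Fin d => nm ((fl e).length + (if s then j.rev else j : Fin d))) ∧
      B.map x = List.ofFn (if s then fu e ∘ Fin.rev else fu e) ∧
      C.map x = if s then fl e else fr e := by
  have hlen : (fragmentWord fl fr fu e).length = (fl e).length + d + (fr e).length := by
    simp [fragmentWord, add_assoc]
  obtain ⟨A, B, C, h, hA, hB, hB', hC⟩ : ∃ A B C,
      (List.range (fragmentWord fl fr fu e).length).map nm = A ++ B ++ C ∧
      A.map x = (fl e).reverse ∧ B = List.ofFn (fun j : Fin d => nm ((fl e).length + j)) ∧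
      B.map x = List.ofFn (fu e) ∧ C.map x = fr e := by
    have hsplit : (List.range (fragmentWord fl fr fu e).length).map nm =
        (List.range (fl e).length).map nm ++
          List.ofFn (fun j : Fin d => nm ((fl e).length + j)) ++
            (List.range (fr e).length).map fun k => nm ((fl e).length + d + k) := by
      rw [hlen, List.range_add, List.range_add]
      simp only [List.map_append, List.map_map]
      congr 2
      refine List.ext_getElem (by simp) fun i h1 h2 => by simp
    have hx' := congrArg (List.map x) hsplit
    rw [List.map_map, show x ∘ nm = fun k => x (nm k) from rfl, hx, fragmentWord,
      List.map_append, List.map_append] at hx'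
    obtain ⟨h1, h2⟩ := List.append_inj hx' (by simp)
    obtain ⟨h3, h4⟩ := List.append_inj h1 (by simp)
    exact ⟨_, _, _, hsplit, h3.symm, rfl, h4.symm, h2.symm⟩
  cases s
  · exact ⟨A, B, C, h, hA, by simpa using hB, by simpa using hB', by simpa using hC⟩
  · refine ⟨C.reverse, B.reverse, A.reverse, ?_, ?_, ?_, ?_, ?_⟩
    · simp [orientedString, h]
    · simp [hC]
    · rw [hB]
      refine List.ext_getElem (by simp) fun i h1 h2 => ?_
      simp only [List.getElem_reverse, List.getElem_ofFn, List.length_ofFn, Fin.val_rev, if_true]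
      congr 2
      omega
    · rw [List.map_reverse, hB']
      refine List.ext_getElem (by simp) fun i h1 h2 => ?_
      simp only [List.getElem_reverse, List.getElem_ofFn, List.length_ofFn, if_true,
        Function.comp_apply]
      congr 1
      refine Fin.ext ?_
      simp only [Fin.val_rev]
      omega
    · simp [hA]

/-- The nodes of a fragment, preceded by nodes that lie between two fragments. -/
def block (nm : E ⊕ E → ℕ → Fin n) (len : E → ℕ) (s : E → Bool) (m : ℕ) (e : E) :
    List (Fin n) :=
  orientedString (nm (Sum.inr e)) m false ++ orientedString (nm (Sum.inl e)) (len e) (s e)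

theorem nodup_flatMap_block {nm : E ⊕ E → ℕ → Fin n}
    (hnm : ∀ a b k l, k < Λ → l < Λ → nm a k = nm b l → a = b ∧ k = l) {len : E → ℕ}
    (hlen : ∀ e, len e ≤ Λ) (s : E → Bool) {m : ℕ} (hm : m ≤ Λ) {order : List E}
    (horder : order.Nodup) : (order.flatMap (block nm len s m)).Nodup := by
  have hmem {e : E} {v : Fin n} (hv : v ∈ block nm len s m e) :
      ∃ a k, k < Λ ∧ (a = Sum.inl e ∨ a = Sum.inr e) ∧ nm a k = v := by
    rcases List.mem_append.1 hv with hv | hv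
    · obtain ⟨k, hk, hv⟩ := mem_orientedString.1 hv
      exact ⟨_, k, by omega, Or.inr rfl, hv⟩
    · obtain ⟨k, hk, hv⟩ := mem_orientedString.1 hv
      exact ⟨_, k, hk.trans_le (hlen e), Or.inl rfl, hv⟩
  refine List.nodup_flatMap.2 ⟨fun e _ => List.nodup_append'.2 ⟨?_, ?_, ?_⟩,
    horder.imp fun {e e'} hne v hv hv' => ?_⟩
  · exact nodup_orientedString fun k l hk hl h => (hnm _ _ k l (by omega) (by omega) h).2
  · exact nodup_orientedString fun k l hk hl h =>
      (hnm _ _ k l (hk.trans_le (hlen e)) (hl.trans_le (hlen e)) h).2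
  · intro v hv hv'
    obtain ⟨k, hk, rfl⟩ := mem_orientedString.1 hv
    obtain ⟨l, hl, h⟩ := mem_orientedString.1 hv'
    simpa using (hnm _ _ l k (hl.trans_le (hlen e)) (by omega) h).1
  · obtain ⟨a, k, hk, ha, h⟩ := hmem hv
    obtain ⟨b, l, hl, hb, h'⟩ := hmem hv'
    obtain ⟨rfl, -⟩ := hnm _ _ _ _ hk hl (h.trans h'.symm)
    rcases ha with rfl | rfl <;> rcases hb with hb | hb
    · exact hne (Sum.inl_injective hb)
    · cases hb
    · cases hb
    · exact hne (Sum.inr_injective hb)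

/-- The fragments can be arranged such that two given ones, with given directions, come first, each
preceded by a given word. -/
theorem exists_arrangement [Finite E] [Nonempty I] {O : Type*} {F : GraphFamily}
    (hF : F = paths ∨ F = cycles ∨ F = pathsAndCycles) (hn : 3 ≤ n) {nm : E ⊕ E → ℕ → Fin n}
    (hnm : ∀ a b k l, k < Λ → l < Λ → nm a k = nm b l → a = b ∧ k = l) {r : ℕ} {fl fr : E → List I}
    {fu : E → Fin (2 * r + 1) → I} (hlen : ∀ e, (fragmentWord fl fr fu e).length ≤ Λ) {m : List I}
    (hm : m.length ≤ Λ) {e₁ e₂ : E} (he : e₁ ≠ e₂) (s : E → Bool) :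
    ∃ G ∈ F n, ∃ (ψ : ℤ → Option (Fin n)) (x : Fin n → I), IsChart G ψ ∧
      ContainsStrings ψ x (fun e => (fragmentWord fl fr fu e).length) (fun e => nm (Sum.inl e))
        (fun e k => (fragmentWord fl fr fu e).getD k (Classical.arbitrary I)) ∧
      ∀ (S : Set (CenteredLabeledGraph I O)) (y : Fin n → O),
        (∀ p, WindowOK S r (fun i => (ψ (p + i)).map fun v => (x v, y v))) →
        let lab (e : E) (j : Fin (2 * r + 1)) : Option (I × O) :=
          some (fu e (if s e then j.rev else j),
            y (nm (Sum.inl e) ((fl e).length + (if s e then j.rev else j : Fin (2 * r + 1)))))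
        Reach S r (lab e₁) ((if s e₁ then fl e₁ else fr e₁) ++ m ++
          (if s e₂ then fr e₂ else fl e₂).reverse ++
            List.ofFn (if s e₂ then fu e₂ ∘ Fin.rev else fu e₂)) (lab e₂) ∧
        (F ≠ cycles → Reach S r (fun _ => none) (m ++ (if s e₁ then fr e₁ else fl e₁).reverse ++
            List.ofFn (if s e₁ then fu e₁ ∘ Fin.rev else fu e₁)) (lab e₁)) := by
  classical
  have := Fintype.ofFinite E
  set i₀ := Classical.arbitrary I
  obtain ⟨x, hx⟩ := exists_input_of_names hnm
    (Sum.elim (fun e k => (fragmentWord fl fr fu e).getD k i₀) fun _ k => m.getD k i₀)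
  have hxl (e k) (hk : k < (fragmentWord fl fr fu e).length) :
      x (nm (Sum.inl e) k) = (fragmentWord fl fr fu e).getD k i₀ := hx _ k (hk.trans_le (hlen e))
  have hmap (e : E) : (List.range (fragmentWord fl fr fu e).length).map
      (fun k => x (nm (Sum.inl e) k)) = fragmentWord fl fr fu e := by
    conv_rhs => rw [← map_range_getD (fragmentWord fl fr fu e) i₀]
    exact List.map_congr_left fun k hk => hxl e k (List.mem_range.1 hk)
  have hmid (e : E) : (orientedString (nm (Sum.inr e)) m.length false).map x = m := by
    conv_rhs => rw [← map_range_getD m i₀]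
    rw [orientedString, if_neg (by simp), List.map_map]
    exact List.map_congr_left fun k hk => hx (Sum.inr e) k ((List.mem_range.1 hk).trans_le hm)
  -- The other fragments must also occur, as the algorithm labels their patches too; their order is
  -- irrelevant.
  set rest := Finset.univ.toList.filter fun e : E => e ≠ e₁ ∧ e ≠ e₂ with hrest
  set B := block nm (fun e => (fragmentWord fl fr fu e).length) s m.length with hB
  have hnodup : (e₁ :: e₂ :: rest).Nodup := by
    simp [rest, he, (Finset.nodup_toList _).filter]
  obtain ⟨π, hπ⟩ := exists_perm_of_nodup (nodup_flatMap_block hnm hlen s hm hnodup)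
  obtain ⟨G, hG, ψ, hψ, hψπ, hnone⟩ := exists_mem_family_of_perm hF hn π
  have hocc : Occurs ψ 0 ((e₁ :: e₂ :: rest).flatMap B) := by
    intro i hi
    have hin : i < n := hi.trans_le
      (by simpa using (nodup_flatMap_block hnm hlen s hm hnodup).length_le_card)
    rw [← hπ ⟨i, hin⟩ hi, ← hψπ]
    simp
  refine ⟨G, hG, ψ, x, hψ, fun e => ⟨fun k hk => hxl e k hk, ?_⟩, fun S y hy => ?_⟩
  · have hmem : e ∈ e₁ :: e₂ :: rest := by
      by_cases h1 : e = e₁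
      · simp [h1]
      · by_cases h2 : e = e₂ <;> simp [h1, h2, rest]
    obtain ⟨l, l', hl⟩ := List.append_of_mem hmem
    rw [hl, List.flatMap_append, List.flatMap_cons, occurs_append, occurs_append, hB, block,
      occurs_append] at hocc
    exact exists_direction_of_occurs hocc.2.1.2
  · obtain ⟨A₁, B₁, C₁, h1, hA1, hB1, hB1', hC1⟩ := exists_orientedString_eq (hmap e₁) (s e₁)
    obtain ⟨A₂, B₂, C₂, h2, hA2, hB2, hB2', hC2⟩ := exists_orientedString_eq (hmap e₂) (s e₂)
    have hlab (e : E) (L : List (Fin n)) (a : ℤ) (hL : L = List.ofFn fun j : Fin (2 * r + 1) =>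
        nm (Sum.inl e) ((fl e).length + (if s e then j.rev else j : Fin (2 * r + 1))))
        (hL' : L.map x = List.ofFn (if s e then fu e ∘ Fin.rev else fu e)) (ha : Occurs ψ a L) :
        labelsAt _ (fun i => (ψ i).map fun v => (x v, y v)) a = fun j : Fin (2 * r + 1) =>
          some (fu e (if s e then j.rev else j),
            y (nm (Sum.inl e) ((fl e).length + (if s e then j.rev else j : Fin (2 * r + 1))))) := by
      subst hL
      rw [List.map_ofFn, List.ofFn_inj] at hL'
      funext j
      have h1 := ha j (by rw [List.length_ofFn]; exact j.2)
      have h2 := congrFun hL' j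
      simp only [Function.comp_apply] at h2
      simp only [labelsAt, h1, List.getElem_ofFn, Option.map_some, h2]
      cases s e <;> rfl
    simp only [List.flatMap_cons, hB, block, h1, h2] at hocc
    have hM₁ := hmid e₁
    have hM₂ := hmid e₂
    set M₁ := orientedString (nm (Sum.inr e₁)) m.length false
    set M₂ := orientedString (nm (Sum.inr e₂)) m.length false
    have hB1l : B₁.length = 2 * r + 1 := by simp [hB1]
    have hB2l : B₂.length = 2 * r + 1 := by simp [hB2]
    rw [show M₁ ++ (A₁ ++ B₁ ++ C₁) ++ (M₂ ++ (A₂ ++ B₂ ++ C₂) ++ rest.flatMap B) =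
      (M₁ ++ A₁) ++ (B₁ ++ ((C₁ ++ M₂ ++ A₂ ++ B₂) ++ (C₂ ++ rest.flatMap B))) by
        simp only [List.append_assoc]] at hocc
    obtain ⟨hocc0, hocc1⟩ := occurs_append.1 hocc
    obtain ⟨hocc2, hocc3⟩ := occurs_append.1 hocc1
    obtain ⟨hocc4, -⟩ := occurs_append.1 hocc3
    have hocc5 := (occurs_append.1 hocc4).2
    constructor
    · have := reach_of_occurs hy (hB1l ▸ hocc4)
      rw [hlab e₁ B₁ _ hB1 hB1' hocc2, hlab e₂ B₂ _ hB2 hB2' ?_] at this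
      · simpa only [List.map_append, hC1, hM₂, hA2, hB2'] using this
      · convert hocc5 using 1
        simp only [List.length_append, hB1l, hB2l]
        push_cast
        ring
    · intro hcyc
      -- The path starts at `0`, so the state just before it consists of `none` only.
      have := reach_of_occurs hy (a := -(2 * r + 1 : ℕ)) (l := M₁ ++ A₁ ++ B₁)
        (by rw [neg_add_cancel]; exact occurs_append.2 ⟨hocc0, hocc2⟩)
      have h0 : labelsAt (2 * r + 1) (fun i => (ψ i).map fun v => (x v, y v))
          (-(2 * r + 1 : ℕ)) = fun _ => none := by
        funext j
        simp only [labelsAt]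
        rw [hnone hcyc _ (by omega)]
        rfl
      rw [h0, hlab e₁ B₁ _ hB1 hB1' ?_] at this
      · simpa only [List.map_append, hM₁, hA1, hB1'] using this
      · convert hocc2 using 1
        simp only [List.length_append, hB1l]
        push_cast
        ring

end arrangement

/-! ### From fast online algorithms to patch labelings -/

section lower

variable {I O : Type*} {S : Set (CenteredLabeledGraph I O)} {r : ℕ}

/-- The context of a patch, read from the other side. -/
def orientContext (s : Bool) (c : EffectPair I O r × (Fin (2 * r + 1) → I) × EffectPair I O r) :
    EffectPair I O r × (Fin (2 * r + 1) → I) × EffectPair I O r :=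
  if s then (c.2.2, c.2.1 ∘ Fin.rev, c.1) else c

theorem orientContext_not (s : Bool)
    (c : EffectPair I O r × (Fin (2 * r + 1) → I) × EffectPair I O r) :
    orientContext (!s) c = ((orientContext s c).2.2, (orientContext s c).2.1 ∘ Fin.rev,
      (orientContext s c).1) := by
  cases s
  · rfl
  · obtain ⟨α, u, β⟩ := c
    simp [orientContext, Function.comp_assoc, Fin.rev_involutive.comp_self]

theorem reach_replace {p q : State I O r} {v v' m m' w w' u : List I}
    (hv : effect S r v = effect S r v') (hm : effect S r m = effect S r m')
    (hw : effect S r w = effect S r w') (h : Reach S r p (v ++ m ++ w.reverse ++ u) q) :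
    Reach S r p (v' ++ m' ++ w'.reverse ++ u) q := by
  simp only [reach_append] at h ⊢
  obtain ⟨a, ⟨b, ⟨c, h1, h2⟩, h3⟩, h4⟩ := h
  exact ⟨a, ⟨b, ⟨c, (reach_congr hv).1 h1, (reach_congr hm).1 h2⟩, (reach_reverse_congr hw).1 h3⟩,
    h4⟩

/-- Pumping serves the effects of words of length `κ`. Any other effect gets a dummy word, so that
the length bounds hold throughout. -/
theorem exists_long_representative [Finite I] [Finite O] [Nonempty I] (L : ℕ)
    (α : EffectPair I O r) : ∃ w : List I, L ≤ w.length ∧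
      w.length ≤ Nat.card (EffectPair I O r) * (L + 1) ∧
      ((∃ v : List I, v.length = Nat.card (EffectPair I O r) ∧ effect S r v = α) →
        effect S r w = α) := by
  by_cases h : ∃ v : List I, v.length = Nat.card (EffectPair I O r) ∧ effect S r v = α
  · obtain ⟨v, hv, rfl⟩ := h
    obtain ⟨w, hw, h1, h2⟩ := effect_pump (S := S) hv.ge L
    exact ⟨w, h1, hv ▸ h2, fun _ => hw⟩
  · refine ⟨List.replicate L (Classical.arbitrary I), by simp, ?_, fun h' => absurd h' h⟩
    have : 0 < Nat.card (EffectPair I O r) := Nat.card_pos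
    rw [List.length_replicate]
    nlinarith

theorem exists_bounded_representatives [Finite I] [Finite O] :
    ∃ (rep : EffectPair I O r → List I) (B : ℕ), (∀ α, (rep α).length ≤ B) ∧
      ∀ w, effect S r (rep (effect S r w)) = effect S r w := by
  have h (α : EffectPair I O r) : ∃ w, ∀ v, effect S r v = α → effect S r w = α := by
    by_cases hα : ∃ v, effect S r v = α
    · exact ⟨_, fun _ _ => hα.choose_spec⟩
    · exact ⟨[], fun v hv => absurd ⟨v, hv⟩ hα⟩
  choose rep hrep using h
  obtain ⟨B, hB⟩ := (Set.finite_range fun α => (rep α).length).bddAbove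
  exact ⟨rep, B, fun α => hB ⟨α, rfl⟩, fun w => hrep _ w rfl⟩

/-- An online algorithm of small locality gives labels of patches that fit together: otherwise the
patches could be arranged, after they have been labeled, such that the labeling has no completion. -/
theorem exists_isPatchLabeling [Finite I] [Finite O] [Nonempty I] {P : LabelingProblem I O} {Δ : ℕ}
    (hΔ : 2 ≤ Δ) (hS : ∀ (n : ℕ) (G : SimpleGraph (Fin n)) (x : Fin n → I), DegreeAtMost G Δ →
      ∀ y : Fin n → O, y ∈ P.sol G x ↔ ∀ v, ∃ H ∈ S, NbhdIso G x y r v H)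
    {F : GraphFamily} (hF : F = paths ∨ F = cycles ∨ F = pathsAndCycles) :
    ∃ K N, ∀ n ≥ N, ∀ t, K * (t + 1) ≤ n → P.RandOnlineSolvable F n t →
      ∃ L, IsPatchLabeling S r (F ≠ cycles) L := by
  classical
  obtain ⟨mrep, B, hB, hmrep⟩ := exists_bounded_representatives (S := S) (r := r)
  set κ := Nat.card (EffectPair I O r) with hκ
  have hκ0 : 0 < κ := Nat.card_pos
  let Ctx := EffectPair I O r × (Fin (2 * r + 1) → I) × EffectPair I O r
  -- One more copy of each context than there are states, for the pigeonhole.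
  let E := Ctx × Fin (Nat.card (State I O r) + 1)
  let J := {j : E × E × (E → Bool) × EffectPair I O r // j.1 ≠ j.2.1}
  have : Finite Ctx := inferInstanceAs
    (Finite (EffectPair I O r × (Fin (2 * r + 1) → I) × EffectPair I O r))
  have : Finite E := inferInstanceAs (Finite (Ctx × Fin _))
  have : Fintype J := @Fintype.ofFinite J (@Subtype.finite (E × E × (E → Bool) × _) inferInstance _)
  -- Each fragment has a connecting string of its own, hence `E ⊕ E`. The two long words of a
  -- fragment have at most `κ * (t + 2) ≤ 2 * κ * (t + 1)` letters each. The threshold exceeds the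
  -- number of arrangements, which does not depend on `n`.
  refine ⟨Nat.card (E ⊕ E) * (4 * κ + (2 * r + 1) + B), Fintype.card J + 2 * r + 4,
    fun n hn t hK hsol => ?_⟩
  choose rep hrep1 hrep2 hrep3 using exists_long_representative (S := S) (r := r) (t + 1)
  let fl (e : E) : List I := rep e.1.1
  let fr (e : E) : List I := rep e.1.2.2
  let fu (e : E) : Fin (2 * r + 1) → I := e.1.2.1
  set Λ := (4 * κ + (2 * r + 1) + B) * (t + 1) with hΛ
  have hlen (e : E) : (fragmentWord fl fr fu e).length =
      (fl e).length + (2 * r + 1) + (fr e).length := by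
    simp [fragmentWord]; ring
  have hlenΛ (e : E) : (fragmentWord fl fr fu e).length ≤ Λ := by
    have h1 : (fl e).length ≤ κ * (t + 1 + 1) := hrep2 e.1.1
    have h2 : (fr e).length ≤ κ * (t + 1 + 1) := hrep2 e.1.2.2
    rw [hlen]
    nlinarith [Nat.zero_le (κ * t), Nat.zero_le (r * t), Nat.zero_le (B * t)]
  have hmΛ (α) : (mrep α).length ≤ Λ := by
    have := hB α
    nlinarith [Nat.zero_le (κ * t), Nat.zero_le (r * t), Nat.zero_le (B * t)]
  obtain ⟨nm, hnm⟩ := exists_names (E := E ⊕ E) (Λ := Λ) (n := n) (by rwa [hΛ, ← mul_assoc])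
    (by omega)
  choose G hG ψ x hψ hstr hreach using fun j : J => exists_arrangement (O := O) hF (by omega) hnm
    hlenΛ (hmΛ j.1.2.2.2) j.2 j.1.2.2.1
  have c₀ : Ctx := (effect S r [], fun _ => Classical.arbitrary I, effect S r [])
  have hne : Nonempty J := ⟨⟨((c₀, 0), (c₀, Fin.last _), fun _ => false, effect S r []), fun h =>
    absurd (Prod.ext_iff.1 h).2 (Fin.last_pos' (n := Nat.card (State I O r))).ne⟩⟩
  obtain ⟨y₀, hy₀⟩ := hsol.exists_common_output (by omega) hG hψ hstr
    (pos := fun e => (fl e).length) (d := 2 * r + 1) fun e => by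
      have h1 : t + 1 ≤ (fl e).length := hrep1 e.1.1
      have h2 : t + 1 ≤ (fr e).length := hrep1 e.1.2.2
      rw [hlen]
      omega
  let lab (e : E) (s : Bool) : State I O r := fun j => some (fu e (if s then j.rev else j),
    y₀ e ((fl e).length + (if s then j.rev else j : Fin (2 * r + 1))))
  have hjoin {e₁ e₂ : E} (he : e₁ ≠ e₂) (s₁ s₂ : Bool) (α : EffectPair I O r) :
      Reach S r (lab e₁ s₁) ((if s₁ then fl e₁ else fr e₁) ++ mrep α ++
        (if s₂ then fr e₂ else fl e₂).reverse ++
          List.ofFn (if s₂ then fu e₂ ∘ Fin.rev else fu e₂)) (lab e₂ s₂) ∧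
      (F ≠ cycles → Reach S r (fun _ => none) (mrep α ++ (if s₁ then fr e₁ else fl e₁).reverse ++
          List.ofFn (if s₁ then fu e₁ ∘ Fin.rev else fu e₁)) (lab e₁ s₁)) := by
    let s (e : E) : Bool := if e = e₁ then s₁ else s₂
    obtain ⟨y, hy, hyy⟩ := hy₀ ⟨(e₁, e₂, s, α), he⟩
    have h := hreach ⟨(e₁, e₂, s, α), he⟩ S y
      (((hψ _).mem_sol_iff hΔ hS _ _ (by omega)).1 hy)
    have hs1 : s e₁ = s₁ := if_pos rfl
    have hs2 : s e₂ = s₂ := if_neg he.symm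
    have hlab (e : E) (s : Bool) : lab e s = fun j => some (fu e (if s then j.rev else j),
        y (nm (Sum.inl e) ((fl e).length + (if s then j.rev else j : Fin (2 * r + 1))))) := by
      funext j
      rw [hyy e _ (by omega) (by omega)]
    simp only [hs1, hs2] at h
    rw [hlab, hlab]
    exact h
  have hpigeon (c : Ctx) : ∃ k₁ k₂, k₁ ≠ k₂ ∧ lab (c, k₁) false = lab (c, k₂) false := by
    have := Fintype.ofFinite (State I O r)
    exact Fintype.exists_ne_map_eq_of_card_lt (fun k => lab (c, k) false)
      (by simp [Nat.card_eq_fintype_card])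
  choose k₁ k₂ hk hlabk using hpigeon
  have hlabs (c : Ctx) (s : Bool) : lab (c, k₁ c) s = lab (c, k₂ c) s := by
    cases s
    · exact hlabk c
    · exact congrArg (· ∘ Fin.rev) (hlabk c)
  let long (α : EffectPair I O r) : Prop := ∃ v : List I, v.length = κ ∧ effect S r v = α
  have hleft {s : Bool} {c : Ctx} {k α u β} (h : orientContext s c = (α, u, β)) :
      (if s then fr (c, k) else fl (c, k)) = rep α ∧ (if s then fl (c, k) else fr (c, k)) = rep β ∧
        (if s then fu (c, k) ∘ Fin.rev else fu (c, k)) = u := by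
    cases s <;> exact ⟨congrArg (fun c : Ctx => rep c.1) h, congrArg (fun c : Ctx => rep c.2.2) h,
      congrArg (fun c : Ctx => c.2.1) h⟩
  -- Both orientations of a context are admitted, for closure under reversal; `long` ensures that
  -- representatives have the effect they stand for.
  refine ⟨fun α u β => {p | long α ∧ long β ∧ ∃ c s, orientContext s c = (α, u, β) ∧
    p = lab (c, k₁ c) s}, ?_, ?_, ?_, ?_, ?_⟩
  · exact fun v w u hv hw => ⟨_, ⟨v, hv, rfl⟩, ⟨w, hw, rfl⟩, (_, u, _), false, rfl, rfl⟩
  · rintro α u β p ⟨-, -, c, s, h, rfl⟩ j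
    rw [← (hleft (k := k₁ c) h).2.2]
    cases s <;> exact ⟨_, rfl⟩
  · rintro α u β p ⟨hα, hβ, c, s, h, rfl⟩
    refine ⟨hβ, hα, c, !s, by rw [orientContext_not, h], ?_⟩
    funext j
    cases s <;> simp [lab, -Fin.val_rev]
  · rintro α u v w u' β p ⟨-, hv, c₁, s₁, h1, rfl⟩ q ⟨hw, -, c₂, s₂, h2, rfl⟩ m
    -- The second patch is replaced by its twin of equal label, so that the two fragments differ
    -- even if their contexts agree.
    rw [hlabs c₂]
    have hne : (c₁, k₁ c₁) ≠ (c₂, k₂ c₂) := fun h => by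
      obtain ⟨rfl, h⟩ := Prod.ext_iff.1 h
      exact hk _ h
    have := (hjoin hne s₁ s₂ (effect S r m)).1
    rw [(hleft h1).2.1, (hleft h2).1, (hleft h2).2.2] at this
    exact reach_replace (hrep3 _ hv) (hmrep m) (hrep3 _ hw) this
  · rintro hcyc w u β q ⟨hw, -, c, s, h, rfl⟩ m
    have := (hjoin (e₁ := (c, k₁ c)) (e₂ := (c, k₂ c)) (fun h => hk c (Prod.ext_iff.1 h).2) s s
      (effect S r m)).2 hcyc
    rw [(hleft h).1, (hleft h).2.2] at this
    exact reach_replace (v := []) (v' := []) rfl (hmrep m) (hrep3 _ hw) this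

end lower

/-! ### Solving a problem by gathering the whole graph -/

section gather

variable {I O : Type*} {P : LabelingProblem I O} {F : GraphFamily} {n t c : ℕ}

theorem two_le_of_mem_family (hF : F = paths ∨ F = cycles ∨ F = pathsAndCycles)
    {G : SimpleGraph (Fin n)} (hG : G ∈ F n) : 2 ≤ n := by
  rcases hF with rfl | rfl | rfl
  · exact hG.1
  · exact (Nat.le_succ 2).trans hG.1
  · exact hG.elim And.left fun h => (Nat.le_succ 2).trans h.1

theorem connected_of_mem_family (hF : F = paths ∨ F = cycles ∨ F = pathsAndCycles)
    {G : SimpleGraph (Fin n)} (hG : G ∈ F n) : G.Connected := by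
  have hp {n : ℕ} {G : SimpleGraph (Fin n)} (hG : G ∈ paths n) : G.Connected := by
    obtain ⟨hn, ⟨φ⟩⟩ := hG
    obtain ⟨m, rfl⟩ : ∃ m, n = m + 1 := ⟨n - 1, by omega⟩
    exact φ.connected_iff.2 (SimpleGraph.pathGraph_connected m)
  have hc {n : ℕ} {G : SimpleGraph (Fin n)} (hG : G ∈ cycles n) : G.Connected := by
    obtain ⟨hn, ⟨φ⟩⟩ := hG
    obtain ⟨m, rfl⟩ : ∃ m, n = m + 1 := ⟨n - 1, by omega⟩
    exact φ.connected_iff.2 SimpleGraph.cycleGraph_connected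
  rcases hF with rfl | rfl | rfl
  · exact hp hG
  · exact hc hG
  · exact hG.elim hp hc

theorem nbhd_eq_univ_of_connected {G : SimpleGraph (Fin n)} (hG : G.Connected) (v : Fin n) :
    nbhd G n v = Set.univ := by
  refine Set.eq_univ_of_forall fun u => mem_nbhd_iff_walk.2 ?_
  obtain ⟨p, hp⟩ := (hG.preconnected v u).exists_isPath
  exact ⟨p, by simpa using hp.length_lt.le⟩

theorem localView_of_connected {G : SimpleGraph (Fin n)} (hG : G.Connected) (x : Fin n → I)
    (ident : Fin n ↪ ℕ) (v : Fin n) : localView n G x ident v =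
      ⟨ident v, G.map ident, Function.extend ident (fun u => some (x u)) fun _ => none⟩ := by
  rw [localView, nbhd_eq_univ_of_connected hG]
  congr 2
  · ext a b
    simp
  · funext u
    exact if_pos (Set.mem_univ u)

/-- Two instances with the same names are isomorphic. -/
theorem comp_ident_mem_sol {G G' : SimpleGraph (Fin n)} {x x' : Fin n → I} {ident ident' : Fin n ↪ ℕ}
    (hgraph : G.map ident = G'.map ident')
    (hinput : Function.extend ident (fun u => some (x u)) (fun _ => none) =
      Function.extend ident' (fun u => some (x' u)) fun _ => none) {g : ℕ → O}
    (h : g ∘ ident' ∈ P.sol G' x') : g ∘ ident ∈ P.sol G x := by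
  have hex (v : Fin n) : ∃ w, ident' w = ident v := by
    by_contra hc
    have := congrFun hinput (ident v)
    rw [ident.injective.extend_apply, Function.extend_apply' _ _ _ hc] at this
    simp at this
  choose f hf using hex
  have hinj : Function.Injective f := fun a b hab =>
    ident.injective (by rw [← hf a, ← hf b, hab])
  let φ : G ≃g G' := ⟨Equiv.ofBijective f (Finite.injective_iff_bijective.1 hinj), fun {a b} => by
    change G'.Adj (f a) (f b) ↔ G.Adj a b
    rw [← SimpleGraph.map_adj_apply (f := ident'), hf, hf, ← hgraph, SimpleGraph.map_adj_apply]⟩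
  have hφ (v : Fin n) : ident' (φ v) = ident v := hf v
  have hx : x' ∘ φ = x := by
    funext v
    have := congrFun hinput (ident v)
    rw [ident.injective.extend_apply, ← hφ v, ident'.injective.extend_apply] at this
    exact (Option.some_injective _ this).symm
  have := P.iso_closed G G' φ x' _ h
  rw [hx] at this
  convert this using 1
  funext v
  exact congrArg g (hφ v).symm

/-- All nodes see the same named instance, so they pick the same solution as a function of the
identifiers. -/
theorem localSolvable_self [Nonempty O] (hF : F = paths ∨ F = cycles ∨ F = pathsAndCycles)
    (h : ∀ G ∈ F n, ∀ x, (P.sol G x).Nonempty) : P.LocalSolvable F c n n := by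
  let A (H : SimpleGraph ℕ) (f : ℕ → Option I) : Set (ℕ → O) := {g | ∃ G ∈ F n, ∃ (x : Fin n → I)
    (ident : Fin n ↪ ℕ), H = G.map ident ∧
      f = Function.extend ident (fun u => some (x u)) (fun _ => none) ∧ g ∘ ident ∈ P.sol G x}
  refine ⟨fun view => pick (A view.graph view.input) view.center, fun G hG x ident _ => ?_⟩
  simp only [localView_of_connected (connected_of_mem_family hF hG)]
  obtain ⟨y, hy⟩ := h G hG x
  have hy' : Function.extend ident y (fun _ => Classical.arbitrary O) ∘ ident ∈ P.sol G x := by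
    rwa [Function.extend_comp ident.injective]
  obtain ⟨G', -, x', ident', h1, h2, h3⟩ := pick_mem (s := A _ _) ⟨_, G, hG, x, ident, rfl, rfl, hy'⟩
  exact comp_ident_mem_sol h1 h2 h3

theorem LabelingProblem.RandOnlineSolvable.nonempty_output (h : P.RandOnlineSolvable F n t) :
    Nonempty O := by
  obtain ⟨A, -⟩ := h
  obtain ⟨a, -⟩ := A.support_nonempty
  exact ⟨a ⟨[], ⊥, fun _ => none, fun _ => none⟩⟩

/-- As `n ≥ 2`, a failure probability of at most `1 / n` leaves a successful run. -/
theorem LabelingProblem.RandOnlineSolvable.sol_nonempty (h : P.RandOnlineSolvable F n t)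
    (hF : F = paths ∨ F = cycles ∨ F = pathsAndCycles) {G : SimpleGraph (Fin n)} (hG : G ∈ F n)
    (x : Fin n → I) : (P.sol G x).Nonempty := by
  obtain ⟨A, hA⟩ := h
  have := two_le_of_mem_family hF hG
  obtain ⟨a, ha⟩ := A.exists_forall_not_mem (ι := Unit) _
    (fun _ => hA G hG x (Equiv.refl _)) (by simpa)
  obtain ⟨y, hy, -⟩ := not_not.1 (ha ())
  exact ⟨y, hy⟩

theorem LabelingProblem.RandOnlineSolvable.localSolvable_self (h : P.RandOnlineSolvable F n t)
    (hF : F = paths ∨ F = cycles ∨ F = pathsAndCycles) : P.LocalSolvable F c n n :=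
  have := h.nonempty_output
  _root_.localSolvable_self hF fun _ hG x => h.sol_nonempty hF hG x

end gather

/-! ### The dichotomy -/

theorem one_le_logStar {n : ℕ} (hn : 2 ≤ n) : 1 ≤ logStar n := by
  rw [logStar_of_one_lt hn]
  omega

theorem logStar_le_self (n : ℕ) : logStar n ≤ n := by
  induction n using Nat.strong_induction_on with
  | _ n ih =>
    by_cases hn : n ≤ 1
    · rw [logStar, if_pos hn]
      omega
    · have := clog_two_lt hn
      have := ih _ this
      rw [logStar_of_one_lt (by omega)]
      omega

/-- After one logarithm the trivial bound `logStar_le_self` is already good enough for powers of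
two. -/
theorem exists_mul_logStar_le (C N : ℕ) : ∃ n ≥ N, C * (logStar n + 1) ≤ n := by
  set m := 2 * C + N + 4 with hm
  have h1 : logStar (2 ^ (2 * m)) ≤ 2 * m + 1 := by
    rw [logStar_of_one_lt (Nat.one_lt_two_pow (by omega)), Nat.clog_pow 2 _ (by norm_num)]
    have := logStar_le_self (2 * m)
    omega
  have h2 : m < 2 ^ m := Nat.lt_two_pow_self
  have h3 : m * (m + 2) ≤ 2 ^ (2 * m) := by
    rw [two_mul, pow_add]
    nlinarith
  refine ⟨2 ^ (2 * m), by nlinarith, ?_⟩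
  nlinarith

/-- One good `n` suffices, because the patch labeling it yields solves the problem for all large
`n`. -/
theorem dichotomy {I O : Type*} [Finite I] [Finite O] [Nonempty O] {P : LabelingProblem I O}
    {r Δ : ℕ} (hΔ : 2 ≤ Δ) (hP : P.IsLCL r Δ) {F : GraphFamily}
    (hF : F = paths ∨ F = cycles ∨ F = pathsAndCycles) (c : ℕ) :
    ∃ K N, ∀ n ≥ N, ∀ t, K * (t + 1) ≤ n → P.RandOnlineSolvable F n t →
      ∃ C t₀ n₀, ∀ n ≥ n₀, P.LocalSolvable F c n (C * logStar n + C) ∧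
        P.RandOnlineSolvable F n t₀ := by
  obtain ⟨S, -, hS⟩ := hP
  rcases isEmpty_or_nonempty I with hI | hI
  · have hx {n : ℕ} (G : SimpleGraph (Fin n)) (hG : G ∈ F n) (x : Fin n → I) : False :=
      hI.false (x ⟨0, by have := two_le_of_mem_family hF hG; omega⟩)
    refine ⟨0, 0, fun _ _ _ _ _ => ⟨0, 0, 0, fun n _ => ⟨⟨fun _ => Classical.arbitrary O,
      fun G hG x => (hx G hG x).elim⟩, PMF.pure fun _ => Classical.arbitrary O,
      fun G hG x => (hx G hG x).elim⟩⟩⟩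
  · obtain ⟨K, N, h⟩ := exists_isPatchLabeling hΔ hS hF
    refine ⟨K, N, fun n hn t hK hsol => ?_⟩
    obtain ⟨L, hL⟩ := h n hn t hK hsol
    obtain ⟨C, n₀, h1⟩ := hL.exists_localSolvable hΔ hS hF c
    obtain ⟨t₀, n₁, h2⟩ := hL.exists_randOnlineSolvable hΔ hS hF
    exact ⟨C, t₀, max n₀ n₁, fun n hn => ⟨h1 n (le_of_max_le_left hn), h2 n (le_of_max_le_right hn)⟩⟩

theorem mainTheorem11 {I O : Type*} [Finite I] [Finite O] (P : LabelingProblem I O)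
    (r Δ : ℕ) (hΔ : 2 ≤ Δ) (hP : P.IsLCL r Δ)
    (F : GraphFamily) (hF : F = paths ∨ F = cycles ∨ F = pathsAndCycles)
    (c : ℕ) (hc : 1 ≤ c) :
    (∀ T : ℕ → ℕ, P.HasRandOnlineLocality F T →
      ∃ T' : ℕ → ℕ, P.HasLocalLocality F c T' ∧
        (fun n => (T' n : ℝ)) =O[atTop] (fun n => (T n : ℝ) + (logStar n : ℝ))) ∧
    (∀ T : ℕ → ℕ, P.IsRandOnlineComplexity F T →
      (fun n => (T n : ℝ)) =O[atTop] (fun _ => (1 : ℝ)) ∨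
        (fun n => (T n : ℝ)) =Θ[atTop] (fun n => (n : ℝ))) ∧
    ((∃ T : ℕ → ℕ, P.HasRandOnlineLocality F T ∧
        (fun n => (T n : ℝ)) =O[atTop] (fun _ => (1 : ℝ))) ↔
      ∃ T' : ℕ → ℕ, P.HasLocalLocality F c T' ∧
        (fun n => (T' n : ℝ)) =O[atTop] (fun n => (logStar n : ℝ))) := by
  rcases isEmpty_or_nonempty O with hO | hO
  · have hno (T) : ¬ P.HasRandOnlineLocality F T := fun h => not_isEmpty_iff.2 (h 0).nonempty_output hO
    refine ⟨fun T hT => (hno T hT).elim, fun T hT => (hno T fun n => (hT n).1).elim,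
      fun ⟨T, hT, _⟩ => (hno T hT).elim,
      fun ⟨T, hT, _⟩ => (hno T fun n => (hT n).randOnlineSolvable hc).elim⟩
  have isBigO_of_le {f g : ℕ → ℕ} (C N : ℕ) (h : ∀ n ≥ N, f n ≤ C * g n) :
      (fun n => (f n : ℝ)) =O[atTop] (fun n => (g n : ℝ)) := by
    refine IsBigO.of_bound C (eventually_atTop.2 ⟨N, fun n hn => ?_⟩)
    rw [Real.norm_natCast, Real.norm_natCast]
    exact_mod_cast h n hn
  have le_of_isBigO {f g : ℕ → ℕ} (h : (fun n => (f n : ℝ)) =O[atTop] (fun n => (g n : ℝ))) :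
      ∃ C N : ℕ, ∀ n ≥ N, f n ≤ C * g n := by
    obtain ⟨C, hC⟩ := h.bound
    obtain ⟨N, hN⟩ := eventually_atTop.1 hC
    obtain ⟨C', hC'⟩ := exists_nat_ge C
    refine ⟨C', N, fun n hn => ?_⟩
    have := hN n hn
    rw [Real.norm_natCast, Real.norm_natCast] at this
    exact_mod_cast this.trans (mul_le_mul_of_nonneg_right hC' (Nat.cast_nonneg _))
  obtain ⟨K, N, hKN⟩ := dichotomy hΔ hP hF c
  have hlocal {T : ℕ → ℕ} (hT : P.HasRandOnlineLocality F T) {C t₀ n₀ : ℕ}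
      (h : ∀ n ≥ n₀, P.LocalSolvable F c n (C * logStar n + C) ∧ P.RandOnlineSolvable F n t₀) :
      ∃ T' : ℕ → ℕ, P.HasLocalLocality F c T' ∧ ∀ n ≥ max n₀ 2, T' n ≤ 2 * C * logStar n := by
    -- For small `n` the whole graph is gathered.
    refine ⟨fun n => if n₀ ≤ n then C * logStar n + C else n, fun n => ?_, fun n hn => ?_⟩
    · dsimp only
      split_ifs with hn
      · exact (h n hn).1
      · exact (hT n).localSolvable_self hF
    · have := one_le_logStar (le_of_max_le_right hn)
      simp only [if_pos (le_of_max_le_left hn)]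
      nlinarith
  have hsmall {T : ℕ → ℕ} (hT : P.HasRandOnlineLocality F T) :
      (∃ C t₀ n₀, ∀ n ≥ n₀, P.LocalSolvable F c n (C * logStar n + C) ∧
        P.RandOnlineSolvable F n t₀) ∨ ∀ n ≥ N, n ≤ K * (T n + 1) := by
    by_cases h : ∃ n ≥ N, K * (T n + 1) ≤ n
    · obtain ⟨n, hn, h⟩ := h
      exact Or.inl (hKN n hn _ h (hT n))
    · push Not at h
      exact Or.inr fun n hn => (h n hn).le
  refine ⟨fun T hT => ?_, fun T hT => ?_, ⟨?_, ?_⟩⟩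
  · have hcast : (fun n => (T n : ℝ) + (logStar n : ℝ)) = fun n => ((T n + logStar n : ℕ) : ℝ) := by
      funext n; push_cast; rfl
    rw [hcast]
    rcases hsmall hT with ⟨C, t₀, n₀, h⟩ | h
    · obtain ⟨T', hT', h'⟩ := hlocal hT h
      exact ⟨T', hT', isBigO_of_le (2 * C) _ fun n hn => (h' n hn).trans (by gcongr; omega)⟩
    -- Gathering costs `n ≤ K * (T n + 1)`, and `logStar n ≥ 1` absorbs the summand `1`.
    · refine ⟨fun n => n, fun n => (hT n).localSolvable_self hF,
        isBigO_of_le K (max N 2) fun n hn => (h n (le_of_max_le_left hn)).trans ?_⟩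
      have := one_le_logStar (le_of_max_le_right hn)
      gcongr
  · have hT' : P.HasRandOnlineLocality F T := fun n => (hT n).1
    rcases hsmall hT' with ⟨C, t₀, n₀, h⟩ | h
    · left
      simpa using isBigO_of_le (g := fun _ => 1) t₀ n₀ fun n hn => by
        simpa using (hT n).2 (h n hn).2
    · right
      -- Gathering gives `T n ≤ n`. For `n > K` the bound forces `T n ≥ 1`, hence `T n + 1 ≤ 2 * T
      -- n`.
      refine ⟨isBigO_of_le 1 0 fun n _ => ?_, isBigO_of_le (2 * K) (max N (K + 1)) fun n hn => ?_⟩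
      · rw [one_mul]
        exact (hT n).2 (((hT n).1.localSolvable_self (c := c) hF).randOnlineSolvable hc)
      · have h1 := h n (le_of_max_le_left hn)
        have h2 := le_of_max_le_right hn
        have : 0 < T n := by
          by_contra h0
          obtain h0 : T n = 0 := by omega
          rw [h0] at h1
          omega
        nlinarith
  · rintro ⟨T, hT, hT1⟩
    obtain ⟨M, n₁, hM⟩ := le_of_isBigO (f := T) (g := fun _ => 1) (by simpa using hT1)
    set n := max (max N n₁) (K * (M + 1))
    have hM' := hM n (by simp [n])
    obtain ⟨C, t₀, n₀, h⟩ := hKN n (by simp [n]) (T n)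
      (le_trans (Nat.mul_le_mul_left K (by omega)) (le_max_right _ _)) (hT n)
    obtain ⟨T', hT', h'⟩ := hlocal hT h
    exact ⟨T', hT', isBigO_of_le (2 * C) _ h'⟩
  · rintro ⟨T', hT', hlog⟩
    have hT (n) : P.RandOnlineSolvable F n (T' n) := (hT' n).randOnlineSolvable hc
    obtain ⟨M, n₁, hM⟩ := le_of_isBigO hlog
    -- At this `n` the locality `M * logStar n` is below the linear threshold of the dichotomy.
    obtain ⟨n, hn, h1⟩ := exists_mul_logStar_le (K * (M + 1)) (max N n₁)
    have hM' := hM n (le_of_max_le_right hn)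
    obtain ⟨C, t₀, n₀, h⟩ := hKN n (le_of_max_le_left hn) (T' n) (by
      refine le_trans ?_ h1
      rw [mul_assoc]
      exact Nat.mul_le_mul_left K (by nlinarith)) (hT n)
    refine ⟨fun n => if n₀ ≤ n then t₀ else T' n, fun n => ?_, ?_⟩
    · dsimp only
      split_ifs with hn
      · exact (h n hn).2
      · exact hT n
    · simpa using isBigO_of_le (g := fun _ => 1) t₀ n₀
        (f := fun n => if n₀ ≤ n then t₀ else T' n) fun n hn => by simp [hn]
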